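/- Let $ds^2=\mathcal A(r)(dx^0)^2-\mathcal B^{-1}(r)\,\delta_{ij}dx^idx^j$, $x^0=ct$, $r=|\boldsymbol x|$, be the static, spherically symmetric metric, in isotropic coordinates, of a central body with mass parameter $m=GM/c^2>0$. Assume that outside a sphere of radius $r_h=hm$ ($h>0$ a fixed number) $\mathcal A$ and $\mathcal B^{-1}$ are positive and given by convergent expansions $$\mathcal A=1-\frac{2m}{r}+\sum_{n\ge 2}\frac{(-1)^n n}{2^{n-2}}\beta_n\frac{m^n}{r^n},\qquad \mathcal B^{-1}=1+2\gamma\frac mr+\frac32\epsilon\frac{m^2}{r^2}+\frac12\gamma_3\frac{m^3}{r^3}+\frac1{16}\gamma_4\frac{m^4}{r^4}+\sum_{n\ge5}(\gamma_n-1)\frac{m^n}{r^n},$$ with arbitrary constant parameters $\beta_n,\gamma,\epsilon,\gamma_n$ and $\gamma\ne-1$. For points $\boldsymbol x_A\neq\boldsymbol x_B$ such that the straight segment joining them avoids the origin, consider the quasi-Minkowskian light ray from $\boldsymbol x_A$ to $\boldsymbol x_B$, i.e. the null geodesic, lying in $r>r_h$ and affinely parametrized by $\xi\in[0,1]$, given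 by power series in $G$ (equivalently in the mass parameter), $$x^0=ct_A+\xi|\boldsymbol x_B-\boldsymbol x_A|+\sum_{n\ge1}X^0_{(n)}(\xi),\qquad \boldsymbol x=\boldsymbol x_A+\xi(\boldsymbol x_B-\boldsymbol x_A)+\sum_{n\ge1}\boldsymbol X_{(n)}(\xi),$$ whose terms of order $n$ satisfy $X^0_{(n)}(0)=0$ and $\boldsymbol X_{(n)}(0)=\boldsymbol X_{(n)}(1)=0$; it is assumed that for every such pair this ray exists for all sufficiently small positive values of the mass parameter. Let $\mathcal T^{(n)}(\boldsymbol x_A,\boldsymbol x_B)$, proportional to $m^n$, be the term of order $n$ in the expansion in powers of $G$ of the travel time along this ray, $$t_B-t_A=\frac{|\boldsymbol x_B-\boldsymbol x_A|}{c}+\sum_{n\ge1}\mathcal T^{(n)}(\boldsymbol x_A,\boldsymbol x_B).$$ Put $r_A=|\boldsymbol x_A|$, $r_B=|\boldsymbol x_B|$, $\boldsymbol n_A=\boldsymbol x_A/r_A$, $\boldsymbol n_B=\boldsymbol x_B/r_B$, and let $$r_c=\frac{r_Ar_B}{|\boldsymbol x_B-\boldsymbol x_A|}\,|\boldsymbol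 n_A\times\boldsymbol n_B|$$ be the Euclidean distance from the origin to the straight line through $\boldsymbol x_A$ and $\boldsymbol x_B$. Then, when $1+\boldsymbol n_A\cdot\boldsymbol n_B\to0$ (with $\boldsymbol n_B\ne-\boldsymbol n_A$), $$\mathcal T^{(1)}\sim\frac{(1+\gamma)m}{c}\ln\frac{4r_Ar_B}{r_c^2},\qquad \mathcal T^{(2)}\sim-2\,\frac{(1+\gamma)^2m^2}{c(r_A+r_B)}\,\frac{r_Ar_B}{r_c^2},\qquad \mathcal T^{(3)}\sim4\,\frac{(1+\gamma)^3m^3}{c(r_A+r_B)^2}\left(\frac{r_Ar_B}{r_c^2}\right)^2,$$ where $f\sim g$ means that $f/g\to1$ (uniformly in $r_A,r_B>0$). -/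

import Mathlib

open Filter Topology Asymptotics

noncomputable section

namespace TimeTransfer

/-- Euclidean 3-space, in which the quasi-Cartesian isotropic coordinates `𝐱 = (x¹, x², x³)` live. -/
abbrev E3 : Type := EuclideanSpace ℝ (Fin 3)

/-- Coefficients of the expansion of `𝒜` in powers of `m / r`:
`𝒜 = 1 - 2 (m/r) + 2 β (m/r)² - (3/2) β₃ (m/r)³ + β₄ (m/r)⁴ + ∑_{n ≥ 5} (-1)ⁿ n / 2ⁿ⁻² βₙ (m/r)ⁿ`,
where `β 2` is the parameter usually written `β` (all the terms with `n ≥ 2` have the general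
form `(-1)ⁿ n / 2ⁿ⁻² βₙ`). -/
def coeffA (β : ℕ → ℝ) : ℕ → ℝ
  | 0 => 1
  | 1 => -2
  | n + 2 => (-1) ^ (n + 2) * ((n + 2 : ℕ) : ℝ) / 2 ^ n * β (n + 2)

/-- Coefficients of the expansion of `ℬ⁻¹` in powers of `m / r`:
`ℬ⁻¹ = 1 + 2 γ (m/r) + (3/2) ε (m/r)² + (1/2) γ₃ (m/r)³ + (1/16) γ₄ (m/r)⁴
  + ∑_{n ≥ 5} (γₙ - 1) (m/r)ⁿ`, with `γs n = γₙ` for `n ≥ 3`. -/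
def coeffBinv (γ ε : ℝ) (γs : ℕ → ℝ) : ℕ → ℝ
  | 0 => 1
  | 1 => 2 * γ
  | 2 => 3 / 2 * ε
  | 3 => 1 / 2 * γs 3
  | 4 => 1 / 16 * γs 4
  | n + 5 => γs (n + 5) - 1

/-- A static, spherically symmetric metric in isotropic coordinates,
`ds² = 𝒜(r) (dx⁰)² - ℬ⁻¹(r) δᵢⱼ dxⁱ dxʲ`, generalizing the exterior Schwarzschild metric: it is
given by its post-Newtonian parameters and by the ratio `h = r_h / m`. Outside the
sphere of radius `r_h = h m`, that is for `0 ≤ m / r < 1 / h`, the functions `𝒜` and `ℬ⁻¹` are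
positive and represented by their expansions in powers of `m / r`. -/
structure PPNMetric where
  /-- `β n` is the parameter `βₙ`, and `β 2` is `β` -/
  β : ℕ → ℝ
  γ : ℝ
  ε : ℝ
  /-- `γs n` is the parameter `γₙ` (`n ≥ 3`) -/
  γs : ℕ → ℝ
  /-- the ratio `r_h / m` -/
  h : ℝ
  h_pos : 0 < h
  summable_A : ∀ u : ℝ, 0 ≤ u → u * h < 1 → Summable fun n => coeffA β n * u ^ n
  summable_Binv : ∀ u : ℝ, 0 ≤ u → u * h < 1 → Summable fun n => coeffBinv γ ε γs n * u ^ n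
  A_pos : ∀ u : ℝ, 0 ≤ u → u * h < 1 → 0 < ∑' n, coeffA β n * u ^ n
  Binv_pos : ∀ u : ℝ, 0 ≤ u → u * h < 1 → 0 < ∑' n, coeffBinv γ ε γs n * u ^ n

namespace PPNMetric

/-- The potential `𝒜(r)` of a central body with mass parameter `m = G M / c²`. -/
def A (g : PPNMetric) (m r : ℝ) : ℝ := ∑' n, coeffA g.β n * (m / r) ^ n

/-- The potential `ℬ⁻¹(r)` of a central body with mass parameter `m = G M / c²`. -/
def Binv (g : PPNMetric) (m r : ℝ) : ℝ := ∑' n, coeffBinv g.γ g.ε g.γs n * (m / r) ^ n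

/-- `ξ ↦ (x⁰(ξ), 𝐱(ξ))`, `0 ≤ ξ ≤ 1`, is a future-directed, affinely parametrized null geodesic of
`ds² = 𝒜(r) (dx⁰)² - ℬ⁻¹(r) δᵢⱼ dxⁱ dxʲ` lying in the region `r > r_h`. The geodesic equations are
the Euler-Lagrange equations of
`L = (1/2) (𝒜(|𝐱|) (dx⁰/dξ)² - ℬ⁻¹(|𝐱|) |d𝐱/dξ|²)`. -/
structure IsNullGeodesic (g : PPNMetric) (m : ℝ) (x0 : ℝ → ℝ) (x : ℝ → E3) : Prop where
  contDiff_time : ∀ ξ ∈ Set.Icc (0 : ℝ) 1, ContDiffAt ℝ 2 x0 ξ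
  contDiff_space : ∀ ξ ∈ Set.Icc (0 : ℝ) 1, ContDiffAt ℝ 2 x ξ
  mem_domain : ∀ ξ ∈ Set.Icc (0 : ℝ) 1, g.h * m < ‖x ξ‖
  future : ∀ ξ ∈ Set.Icc (0 : ℝ) 1, 0 < deriv x0 ξ
  null : ∀ ξ ∈ Set.Icc (0 : ℝ) 1,
    g.A m ‖x ξ‖ * deriv x0 ξ ^ 2 - g.Binv m ‖x ξ‖ * ‖deriv x ξ‖ ^ 2 = 0
  geodesic_time : ∀ ξ ∈ Set.Icc (0 : ℝ) 1,
    HasDerivAt (fun s => g.A m ‖x s‖ * deriv x0 s) 0 ξ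
  geodesic_space : ∀ ξ ∈ Set.Icc (0 : ℝ) 1,
    HasDerivAt (fun s => -(g.Binv m ‖x s‖ • deriv x s))
      ((1 / 2 : ℝ) • gradient
        (fun y : E3 => g.A m ‖y‖ * deriv x0 ξ ^ 2 - g.Binv m ‖y‖ * ‖deriv x ξ‖ ^ 2) (x ξ)) ξ

/-- `(M, ξ) ↦ (x⁰, 𝐱)` describes the quasi-Minkowskian light ray emitted at `𝐱_A` at time `t_A`
and received at `𝐱_B`, as a function of the mass parameter `M`:
`x⁰ = c t_A + ξ |𝐱_B - 𝐱_A| + ∑_{n ≥ 1} X⁰₍ₙ₎` and `𝐱 = 𝐱_A + ξ (𝐱_B - 𝐱_A) + ∑_{n ≥ 1} 𝐗₍ₙ₎`,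
where the terms of order `n` are the terms of degree `n` of a power series in `M`, and
`X⁰₍ₙ₎` vanishes at `ξ = 0`, `𝐗₍ₙ₎` at `ξ = 0` and `ξ = 1`. -/
structure IsQuasiMinkowskianRay (g : PPNMetric) (c tA : ℝ) (xA xB : E3)
    (x0 : ℝ → ℝ → ℝ) (x : ℝ → ℝ → E3) : Prop where
  analytic_time : ∀ ξ ∈ Set.Icc (0 : ℝ) 1, AnalyticAt ℝ (fun p : ℝ × ℝ => x0 p.1 p.2) (0, ξ)
  analytic_space : ∀ ξ ∈ Set.Icc (0 : ℝ) 1, AnalyticAt ℝ (fun p : ℝ × ℝ => x p.1 p.2) (0, ξ)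
  zeroth_time : ∀ ξ ∈ Set.Icc (0 : ℝ) 1, x0 0 ξ = c * tA + ξ * ‖xB - xA‖
  zeroth_space : ∀ ξ ∈ Set.Icc (0 : ℝ) 1, x 0 ξ = xA + ξ • (xB - xA)
  start_time : ∀ᶠ M in 𝓝[>] (0 : ℝ), x0 M 0 = c * tA
  start_space : ∀ᶠ M in 𝓝[>] (0 : ℝ), x M 0 = xA
  end_space : ∀ᶠ M in 𝓝[>] (0 : ℝ), x M 1 = xB
  geodesic : ∀ᶠ M in 𝓝[>] (0 : ℝ), g.IsNullGeodesic M (x0 M) (x M)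

/-- `T n` is, for each `n`, the term of order `n` (in the gravitational constant, equivalently in
the mass parameter) of the travel time `t_B - t_A` of a photon along the quasi-Minkowskian light
ray from `𝐱_A` to `𝐱_B`, for the value `m` of the mass parameter. A term of order `n` is
proportional to the `n`-th power of the mass parameter, so that it equals `T n * (M / m) ^ n` for
the value `M`. -/
def IsTimeTransferExpansion (g : PPNMetric) (c m : ℝ) (xA xB : E3) (T : ℕ → ℝ) : Prop :=
  ∃ (tA : ℝ) (x0 : ℝ → ℝ → ℝ) (x : ℝ → ℝ → E3),
    g.IsQuasiMinkowskianRay c tA xA xB x0 x ∧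
      ∀ᶠ M in 𝓝[>] (0 : ℝ), HasSum (fun n => T n * (M / m) ^ n) ((x0 M 1 - x0 M 0) / c)

end PPNMetric

/-- The unit vector `𝐧 = 𝐱 / |𝐱|`. -/
def unitVec (x : E3) : E3 := ‖x‖⁻¹ • x

/-- The cross product of Euclidean 3-vectors. -/
def cross (a b : E3) : E3 := WithLp.toLp 2 (crossProduct (WithLp.ofLp a) (WithLp.ofLp b))

/-- `r_c = r_A r_B |𝐧_A × 𝐧_B| / |𝐱_B - 𝐱_A|`, the Euclidean distance between the origin and the
straight line through `𝐱_A` and `𝐱_B`. -/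
def rc (xA xB : E3) : ℝ := ‖xA‖ * ‖xB‖ / ‖xB - xA‖ * ‖cross (unitVec xA) (unitVec xB)‖

/-- The limit `1 + 𝐧_A · 𝐧_B → 0` (through nonzero values), with no other restriction on the pair
`(𝐱_A, 𝐱_B)`. -/
def oppositeLimit : Filter (E3 × E3) :=
  comap (fun p => 1 + inner ℝ (unitVec p.1) (unitVec p.2)) (𝓝[≠] (0 : ℝ))

end TimeTransfer

end

/-! Along a null geodesic the travel time is an optical length. Let `p` be the spatial momentum
divided by the conserved energy. Then `|p|² = ℬ⁻¹/𝒜 = 1 + 2μ/r + k₂(M/r)² + k₃(M/r)³ + O(M⁴)`, where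
`μ = (1+γ)M`, `k₂ = index₂`, `k₃ = index₃`. The ray satisfies `d𝐱/dξ = Λp` and `dx⁰/dξ = Λ|p|²`.

The truncated problem `|∇S|² = 1 + 2μ/r` is Hamilton's characteristic function for the Kepler
problem with a vertex at `𝐱_A`. As in Lambert's theorem it separates in `σ± = r_A + r ± |𝐱 - 𝐱_A|`,
and `S = ½ ∫ √(1 + 4μ/σ) dσ` from `σ₋` to `σ₊`. Replacing the root by its cubic Taylor polynomial
gives the explicit `eikonal`, with error `O(M⁴)` in the equation. For `q = ∇S` along the true ray,
`dx⁰/dξ - dS/dξ = Λ(|p|² - p·q) = (Λ/2)(|p - q|² + |p|² - |q|²)`. This is the usual Fermat gain: `p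
- q = O(M²)` (`Chord.IsRay.defect`) enters only through its square. What remains is `k₂` and `k₃`
times powers of `M/r`, integrated along the first order ray. Hence `Chord.IsRay.travel_time`, which
gives the time up to `O(M⁴)`, and `Chord.IsRay.coefficients`, which gives closed forms of the first
three orders.

Near opposition, with `δ = 1 + 𝐧_A·𝐧_B` and `b = r_c`, the identities `σ₊σ₋ = 2 r_A r_B δ` (at
`𝐱_B`) and `R²b² = (r_A r_B)² δ(2 - δ)` show that `1/σ₋` carries the divergence. The `k₂`, `k₃`
terms are smaller by a factor `O(√δ)`, because `(r_A + r_B) b / (r_A r_B) ≤ 3√δ`. All bounds depend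
on `δ` and the metric only, which gives uniformity in `r_A`, `r_B`. -/

noncomputable section

namespace TimeTransfer

/-! ### Orders of magnitude in the mass parameter, uniform along the ray. -/

section UniformOrder

set_option linter.unusedSectionVars false

variable {E F : Type*} [NormedAddCommGroup E] [NormedSpace ℝ E]
  [NormedAddCommGroup F] [NormedSpace ℝ F] {s : Set ℝ} {i j k : ℕ}

/-- The filter of pairs `(M, ξ)` with `M → 0⁺`, uniformly in `ξ ∈ s`. -/
def unif (s : Set ℝ) : Filter (ℝ × ℝ) := 𝓝[>] (0 : ℝ) ×ˢ 𝓟 s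

/-- `f (M, ξ) = O(M ^ k)` as `M → 0⁺`, uniformly in `ξ ∈ s`. -/
def UnifBigO (s : Set ℝ) (k : ℕ) (f : ℝ × ℝ → E) : Prop :=
  f =O[unif s] fun p => p.1 ^ k

theorem eventually_unif_iff {P : ℝ × ℝ → Prop} :
    (∀ᶠ p in unif s, P p) ↔ ∀ᶠ M in 𝓝[>] (0 : ℝ), ∀ ξ ∈ s, P (M, ξ) :=
  eventually_prod_principal_iff

theorem tendsto_fst_unif : Tendsto Prod.fst (unif s) (𝓝[>] (0 : ℝ)) := tendsto_fst

theorem eventually_pos_unif : ∀ᶠ p in unif s, 0 < p.1 :=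
  tendsto_fst_unif.eventually self_mem_nhdsWithin

theorem eventually_lt_unif {ε : ℝ} (hε : 0 < ε) : ∀ᶠ p in unif s, p.1 < ε :=
  tendsto_fst_unif.eventually (mem_nhdsWithin_of_mem_nhds (Iio_mem_nhds hε))

theorem eventually_mem_unif : ∀ᶠ p in unif s, p.2 ∈ s :=
  eventually_unif_iff.2 (Eventually.of_forall fun _ _ h => h)

theorem unif_mono {t : Set ℝ} (h : s ⊆ t) : unif s ≤ unif t :=
  Filter.prod_mono le_rfl (principal_mono.2 h)

namespace UnifBigO

theorem mono_set {t : Set ℝ} {f : ℝ × ℝ → E} (hf : UnifBigO t k f) (h : s ⊆ t) :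
    UnifBigO s k f :=
  IsBigO.mono hf (unif_mono h)

theorem iff_bound {f : ℝ × ℝ → E} :
    UnifBigO s k f ↔ ∃ C : ℝ, 0 ≤ C ∧
      ∀ᶠ M in 𝓝[>] (0 : ℝ), ∀ ξ ∈ s, ‖f (M, ξ)‖ ≤ C * M ^ k := by
  have key : ∀ C : ℝ, (∀ᶠ p in unif s, ‖f p‖ ≤ C * ‖p.1 ^ k‖) ↔
      ∀ᶠ M in 𝓝[>] (0 : ℝ), ∀ ξ ∈ s, ‖f (M, ξ)‖ ≤ C * M ^ k := by
    intro C
    rw [eventually_unif_iff]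
    refine eventually_congr ?_
    filter_upwards [self_mem_nhdsWithin] with M hM
    have : ‖M ^ k‖ = M ^ k := by
      rw [Real.norm_eq_abs, abs_of_pos (pow_pos hM k)]
    simp only [this]
  constructor
  · intro h
    obtain ⟨C, hC, hb⟩ := h.exists_nonneg
    exact ⟨C, hC, (key C).1 hb.bound⟩
  · rintro ⟨C, -, hb⟩
    exact IsBigO.of_bound C ((key C).2 hb)

theorem congr' {f g : ℝ × ℝ → E} (hf : UnifBigO s k f) (h : ∀ᶠ p in unif s, f p = g p) :
    UnifBigO s k g :=
  IsBigO.congr' hf h EventuallyEq.rfl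

theorem congr {f g : ℝ × ℝ → E} (hf : UnifBigO s k f) (h : ∀ p, f p = g p) : UnifBigO s k g :=
  hf.congr' (Eventually.of_forall h)

theorem of_le {f : ℝ × ℝ → E} (hf : UnifBigO s k f) (h : j ≤ k) : UnifBigO s j f := by
  refine IsBigO.trans hf (IsBigO.of_bound 1 ?_)
  filter_upwards [eventually_pos_unif, eventually_lt_unif one_pos] with p h0 h1
  rw [Real.norm_eq_abs, Real.norm_eq_abs, abs_of_pos (pow_pos h0 k), abs_of_pos (pow_pos h0 j),
    one_mul]
  exact pow_le_pow_of_le_one h0.le h1.le h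

theorem add {f g : ℝ × ℝ → E} (hf : UnifBigO s k f) (hg : UnifBigO s k g) :
    UnifBigO s k (fun p => f p + g p) := IsBigO.add hf hg

theorem sub {f g : ℝ × ℝ → E} (hf : UnifBigO s k f) (hg : UnifBigO s k g) :
    UnifBigO s k (fun p => f p - g p) := IsBigO.sub hf hg

theorem neg {f : ℝ × ℝ → E} (hf : UnifBigO s k f) : UnifBigO s k (fun p => - f p) :=
  IsBigO.neg_left hf

theorem smul {f : ℝ × ℝ → ℝ} {g : ℝ × ℝ → E} (hf : UnifBigO s i f) (hg : UnifBigO s j g)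
    (h : k ≤ i + j := by omega) : UnifBigO s k (fun p => f p • g p) := by
  refine of_le (k := i + j) ?_ h
  exact (IsBigO.smul hf hg).congr_right fun p => by simp [pow_add]

theorem mul {f g : ℝ × ℝ → ℝ} (hf : UnifBigO s i f) (hg : UnifBigO s j g)
    (h : k ≤ i + j := by omega) : UnifBigO s k (fun p => f p * g p) := hf.smul hg h

theorem bilin {G : Type*} [NormedAddCommGroup G] [NormedSpace ℝ G] (B : E →L[ℝ] F →L[ℝ] G)
    {f : ℝ × ℝ → E} {g : ℝ × ℝ → F} (hf : UnifBigO s i f) (hg : UnifBigO s j g)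
    (h : k ≤ i + j := by omega) : UnifBigO s k (fun p => B (f p) (g p)) := by
  refine of_le (k := i + j) ?_ h
  have h1 : (fun p => B (f p) (g p)) =O[unif s] fun p => ‖f p‖ * ‖g p‖ :=
    IsBigO.of_bound ‖B‖ (Eventually.of_forall fun p => by
      simpa [mul_assoc] using B.le_opNorm₂ (f p) (g p))
  exact h1.trans ((IsBigO.mul hf.norm_left hg.norm_left).congr_right fun p => by
    simp [pow_add])

theorem inner {f g : ℝ × ℝ → E3} (hf : UnifBigO s i f) (hg : UnifBigO s j g)
    (h : k ≤ i + j := by omega) : UnifBigO s k (fun p => inner ℝ (f p) (g p)) :=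
  (hf.bilin (innerSL ℝ) hg h).congr fun _ => rfl

theorem clm (L : E →L[ℝ] F) {f : ℝ × ℝ → E} (hf : UnifBigO s k f) :
    UnifBigO s k (fun p => L (f p)) := (L.isBigO_comp f _).trans hf

theorem norm {f : ℝ × ℝ → E} (hf : UnifBigO s k f) : UnifBigO s k (fun p => ‖f p‖) :=
  IsBigO.norm_left hf

theorem norm_sub_norm {f g : ℝ × ℝ → E} (hf : UnifBigO s k (fun p => f p - g p)) :
    UnifBigO s k (fun p => ‖f p‖ - ‖g p‖) :=
  IsBigO.trans (IsBigO.of_bound 1 (Eventually.of_forall fun p => by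
    simpa using abs_norm_sub_norm_le (f p) (g p))) hf

theorem fst : UnifBigO s 1 (fun p => p.1) :=
  (isBigO_refl (fun p : ℝ × ℝ => p.1) _).congr_right fun _ => (pow_one _).symm

theorem fst_pow (k : ℕ) : UnifBigO s k (fun p => p.1 ^ k) := isBigO_refl _ _

theorem const (c : E) : UnifBigO s 0 (fun _ => c) :=
  (isBigO_const_const c (one_ne_zero (α := ℝ)) _).congr_right fun _ => (pow_zero _).symm

theorem of_continuousOn {f : ℝ → E} (hs : IsCompact s) (hf : ContinuousOn f s) :
    UnifBigO s 0 (fun p => f p.2) := by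
  obtain ⟨C, hC⟩ := hs.exists_bound_of_continuousOn hf
  refine iff_bound.2 ⟨max C 0, le_max_right _ _, Eventually.of_forall fun M ξ hξ => ?_⟩
  simpa using Or.inl (hC ξ hξ)

/-- A function close to a bounded one is bounded. -/
theorem bounded_of_sub {f g : ℝ × ℝ → E} (hf : UnifBigO s k (fun p => f p - g p))
    (hg : UnifBigO s 0 g) : UnifBigO s 0 f :=
  ((hf.of_le (Nat.zero_le k)).add hg).congr fun p => by simp

theorem tendsto_zero {f : ℝ × ℝ → E} (hf : UnifBigO s 1 f) : Tendsto f (unif s) (𝓝 0) := by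
  refine IsBigO.trans_tendsto hf ?_
  simpa using (tendsto_fst_unif (s := s)).mono_right nhdsWithin_le_nhds

/-- A function close to one that is bounded below by a positive constant is itself bounded below
by a positive constant. -/
theorem eventually_half_le {f g : ℝ × ℝ → ℝ} (hf : UnifBigO s 1 (fun p => f p - g p)) {c : ℝ}
    (hc : 0 < c) (hg : ∀ᶠ p in unif s, c ≤ g p) : ∀ᶠ p in unif s, c / 2 ≤ f p := by
  have h := hf.tendsto_zero.eventually (Ioi_mem_nhds (show -(c / 2) < 0 by linarith))
  filter_upwards [h, hg] with p h1 h2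
  have h3 : -(c / 2) < f p - g p := h1
  linarith

theorem inv {f : ℝ × ℝ → ℝ} {c : ℝ} (hc : 0 < c) (hf : ∀ᶠ p in unif s, c ≤ f p) :
    UnifBigO s 0 (fun p => (f p)⁻¹) := by
  refine IsBigO.of_bound c⁻¹ ?_
  filter_upwards [hf] with p hp
  have : 0 < f p := hc.trans_le hp
  simpa [abs_of_pos this] using inv_anti₀ hc hp

theorem inv_sub_inv {f g : ℝ × ℝ → ℝ} {c c' : ℝ} (hc : 0 < c) (hc' : 0 < c')
    (h : UnifBigO s k (fun p => f p - g p)) (hf : ∀ᶠ p in unif s, c ≤ f p)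
    (hg : ∀ᶠ p in unif s, c' ≤ g p) : UnifBigO s k (fun p => (f p)⁻¹ - (g p)⁻¹) := by
  refine (((h.neg.mul (inv hc hf) (k := k)).mul (inv hc' hg) (k := k))).congr' ?_
  filter_upwards [hf, hg] with p h1 h2
  have h3 : f p ≠ 0 := (hc.trans_le h1).ne'
  have h4 : g p ≠ 0 := (hc'.trans_le h2).ne'
  field_simp
  ring

/-- Products of close bounded functions are close. -/
theorem mul_sub_mul {f f₀ g g₀ : ℝ × ℝ → ℝ} (hf : UnifBigO s k (fun p => f p - f₀ p))
    (hg : UnifBigO s k (fun p => g p - g₀ p)) (hf₀ : UnifBigO s 0 f₀) (hb : UnifBigO s 0 g) :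
    UnifBigO s k (fun p => f p * g p - f₀ p * g₀ p) :=
  ((hf.mul hb (k := k)).add (hf₀.mul hg (k := k))).congr fun p => by ring

theorem smul_sub_smul {f f₀ : ℝ × ℝ → ℝ} {g g₀ : ℝ × ℝ → E}
    (hf : UnifBigO s k (fun p => f p - f₀ p)) (hg : UnifBigO s k (fun p => g p - g₀ p))
    (hf₀ : UnifBigO s 0 f₀) (hb : UnifBigO s 0 g) :
    UnifBigO s k (fun p => f p • g p - f₀ p • g₀ p) :=
  ((hf.smul hb (k := k)).add (hf₀.smul hg (k := k))).congr fun p => by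
    simp only [smul_sub, sub_smul]; abel

/-- The mean value inequality, uniformly in the parameter. -/
theorem mean_value {f f' : ℝ × ℝ → E}
    (hc : ∀ᶠ M in 𝓝[>] (0 : ℝ), ContinuousOn (fun ξ => f (M, ξ)) (Set.Icc 0 1))
    (hd : ∀ᶠ M in 𝓝[>] (0 : ℝ), ∀ ξ ∈ Set.Ioo (0 : ℝ) 1,
      HasDerivAt (fun ξ => f (M, ξ)) (f' (M, ξ)) ξ)
    (h : UnifBigO (Set.Ioo 0 1) k f') :
    ∃ C : ℝ, 0 ≤ C ∧ ∀ᶠ M in 𝓝[>] (0 : ℝ), ∀ ξ ∈ Set.Icc (0 : ℝ) 1,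
      ‖f (M, ξ) - f (M, 0)‖ ≤ C * M ^ k * ξ := by
  obtain ⟨C, hC, hb⟩ := iff_bound.1 h
  refine ⟨C, hC, ?_⟩
  filter_upwards [hc, hd, hb] with M hc hd hb ξ hξ
  rcases hξ.1.eq_or_lt with rfl | h0
  · simp
  -- The derivative is assumed on the open interval only, since the eikonal function has a conical
  -- point at its vertex `ξ = 0`. Hence the start at `η > 0`, followed by `η → 0`.
  have key : ∀ η ∈ Set.Ioo 0 ξ, ‖f (M, ξ) - f (M, η)‖ ≤ C * M ^ k * (ξ - η) := by
    intro η hη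
    refine norm_image_sub_le_of_norm_deriv_right_le_segment (f := fun ξ => f (M, ξ))
      (f' := fun ξ => f' (M, ξ)) (a := η) (b := ξ)
      (hc.mono (Set.Icc_subset_Icc hη.1.le hξ.2)) (fun y hy => ?_) (fun y hy => ?_) ξ
      (Set.right_mem_Icc.2 hη.2.le)
    · exact (hd y ⟨hη.1.trans_le hy.1, hy.2.trans_le hξ.2⟩).hasDerivWithinAt
    · exact hb y ⟨hη.1.trans_le hy.1, hy.2.trans_le hξ.2⟩
  have hlim : Tendsto (fun η => f (M, η)) (𝓝[>] 0) (𝓝 (f (M, 0))) := by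
    have := (hc 0 ⟨le_rfl, zero_le_one⟩).mono_left
      (nhdsWithin_mono _ (Set.Ioo_subset_Icc_self (a := (0 : ℝ)) (b := 1)))
    rwa [nhdsWithin_Ioo_eq_nhdsGT zero_lt_one] at this
  have hlim' : Tendsto (fun η : ℝ => C * M ^ k * (ξ - η)) (𝓝[>] 0) (𝓝 (C * M ^ k * (ξ - 0))) :=
    (Continuous.tendsto (by fun_prop) 0).mono_left nhdsWithin_le_nhds
  rw [sub_zero] at hlim'
  refine le_of_tendsto_of_tendsto ((tendsto_const_nhds.sub hlim).norm) hlim' ?_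
  filter_upwards [Ioo_mem_nhdsGT h0] with η hη using key η hη

theorem of_deriv {f f' : ℝ × ℝ → E}
    (hc : ∀ᶠ M in 𝓝[>] (0 : ℝ), ContinuousOn (fun ξ => f (M, ξ)) (Set.Icc 0 1))
    (hd : ∀ᶠ M in 𝓝[>] (0 : ℝ), ∀ ξ ∈ Set.Ioo (0 : ℝ) 1,
      HasDerivAt (fun ξ => f (M, ξ)) (f' (M, ξ)) ξ)
    (h : UnifBigO (Set.Ioo 0 1) k f') :
    UnifBigO (Set.Icc 0 1) k (fun p => f p - f (p.1, 0)) := by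
  obtain ⟨C, hC, hb⟩ := mean_value hc hd h
  refine iff_bound.2 ⟨C, hC, ?_⟩
  filter_upwards [hb, self_mem_nhdsWithin] with M hb hM ξ hξ
  have : 0 ≤ M ^ k := (pow_pos hM k).le
  exact (hb ξ hξ).trans (mul_le_of_le_one_right (by positivity) hξ.2)

/-- Controls difference quotients from `ξ = 0`, uniformly down to `ξ = 0`. This is needed because
the eikonal gradient contains the unit vector from `𝐱_A` to the moving point. -/
theorem of_deriv_slope {f f' : ℝ × ℝ → E}
    (hc : ∀ᶠ M in 𝓝[>] (0 : ℝ), ContinuousOn (fun ξ => f (M, ξ)) (Set.Icc 0 1))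
    (hd : ∀ᶠ M in 𝓝[>] (0 : ℝ), ∀ ξ ∈ Set.Ioo (0 : ℝ) 1,
      HasDerivAt (fun ξ => f (M, ξ)) (f' (M, ξ)) ξ)
    (h : UnifBigO (Set.Ioo 0 1) k f') :
    UnifBigO (Set.Ioo 0 1) k (fun p => p.2⁻¹ • (f p - f (p.1, 0))) := by
  obtain ⟨C, hC, hb⟩ := mean_value hc hd h
  refine iff_bound.2 ⟨C, hC, ?_⟩
  filter_upwards [hb] with M hb ξ hξ
  rw [norm_smul, norm_inv, Real.norm_eq_abs, abs_of_pos hξ.1, inv_mul_le_iff₀ hξ.1, mul_comm]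
  exact hb ξ ⟨hξ.1.le, hξ.2.le⟩

/-- Evaluation at a fixed parameter value. -/
theorem eval {f : ℝ × ℝ → E} (hf : UnifBigO s k f) {ξ : ℝ} (hξ : ξ ∈ s) {t : Set ℝ} :
    UnifBigO t k (fun p => f (p.1, ξ)) := by
  obtain ⟨C, hC, hb⟩ := iff_bound.1 hf
  exact iff_bound.2 ⟨C, hC, hb.mono fun M h _ _ => h ξ hξ⟩

theorem comp_of_isBigO {φ : ℝ → ℝ} {f : ℝ × ℝ → ℝ} (hφ : φ =O[𝓝 0] fun u => u ^ k)
    (hf : UnifBigO s 1 f) : UnifBigO s k (fun p => φ (f p)) :=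
  (hφ.comp_tendsto hf.tendsto_zero).trans
    ((IsBigO.pow hf k).congr_right fun p => by rw [pow_one])

/-- An analytic family is Lipschitz in the parameter, uniformly on compact sets. -/
theorem of_analyticAt {f : ℝ × ℝ → E} (hs : IsCompact s)
    (hf : ∀ ξ ∈ s, AnalyticAt ℝ f (0, ξ)) :
    UnifBigO s 1 (fun p => f p - f (0, p.2)) := by
  have : ∃ C : ℝ, 0 ≤ C ∧ ∀ᶠ M in 𝓝[>] (0 : ℝ), ∀ ξ ∈ s,
      ‖f (M, ξ) - f (0, ξ)‖ ≤ C * M ^ 1 := by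
    refine hs.induction_on (p := fun s => ∃ C : ℝ, 0 ≤ C ∧ ∀ᶠ M in 𝓝[>] (0 : ℝ), ∀ ξ ∈ s,
      ‖f (M, ξ) - f (0, ξ)‖ ≤ C * M ^ 1) ⟨0, le_rfl, by simp⟩ ?_ ?_ ?_
    · rintro s t hst ⟨C, hC, h⟩
      exact ⟨C, hC, h.mono fun M h ξ hξ => h ξ (hst hξ)⟩
    · rintro s t ⟨C, hC, h⟩ ⟨C', hC', h'⟩
      refine ⟨max C C', le_max_of_le_left hC, ?_⟩
      filter_upwards [h, h', self_mem_nhdsWithin] with M h h' hM ξ hξ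
      rw [pow_one] at *
      rcases hξ with hξ | hξ
      · exact (h ξ hξ).trans (mul_le_mul_of_nonneg_right (le_max_left _ _) (le_of_lt hM))
      · exact (h' ξ hξ).trans (mul_le_mul_of_nonneg_right (le_max_right _ _) (le_of_lt hM))
    · intro ξ hξ
      -- Strict differentiability makes `f` Lipschitz on a whole neighbourhood of `(0, ξ)`, so one
      -- constant serves all nearby parameters; compactness then patches these constants.
      obtain ⟨K, t, ht, hK⟩ :=
        (hf ξ hξ).hasStrictFDerivAt.exists_lipschitzOnWith
      rw [nhds_prod_eq] at ht
      obtain ⟨u, hu, v, hv, huv⟩ := Filter.mem_prod_iff.1 ht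
      refine ⟨v, mem_nhdsWithin_of_mem_nhds hv, K, K.2, ?_⟩
      filter_upwards [mem_nhdsWithin_of_mem_nhds hu, self_mem_nhdsWithin] with M hM hM0 η hη
      have := hK.dist_le_mul (M, η) (huv ⟨hM, hη⟩) (0, η) (huv ⟨mem_of_mem_nhds hu, hη⟩)
      rw [dist_eq_norm] at this
      refine this.trans_eq ?_
      simp [Prod.dist_eq, abs_of_pos (show (0:ℝ) < M from hM0)]
      exact Or.inl hM0.le
  exact iff_bound.2 this

end UnifBigO

end UniformOrder

/-! ### Power series known to converge on a half-interval. -/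

section PowerSeries

variable {a : ℕ → ℝ} {h : ℝ}

/-- Convergence at the single positive point `1/(2h)` already forces a positive radius, hence
analyticity on both sides of `0`. -/
theorem hasFPowerSeriesAt_tsum (hh : 0 < h)
    (hs : ∀ u : ℝ, 0 ≤ u → u * h < 1 → Summable fun n => a n * u ^ n) :
    HasFPowerSeriesAt (fun u : ℝ => ∑' n, a n * u ^ n)
      (FormalMultilinearSeries.ofScalars ℝ a) 0 := by
  have hu : (0 : ℝ) < (2 * h)⁻¹ := by positivity
  have h1 := hs (2 * h)⁻¹ hu.le (by rw [mul_inv, mul_assoc, inv_mul_cancel₀ hh.ne']; norm_num)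
  have hr : ((Real.toNNReal (2 * h)⁻¹ : NNReal) : ENNReal) ≤
      (FormalMultilinearSeries.ofScalars ℝ a).radius := by
    refine FormalMultilinearSeries.le_radius_of_tendsto (l := 0) _ ?_
    have := h1.tendsto_atTop_zero.norm
    simpa [FormalMultilinearSeries.ofScalars_norm, abs_of_pos hh,
      max_eq_left (show (0 : ℝ) ≤ h⁻¹ * 2⁻¹ by positivity)] using this
  have hpos : 0 < (FormalMultilinearSeries.ofScalars ℝ a).radius :=
    lt_of_lt_of_le (ENNReal.coe_pos.2 (Real.toNNReal_pos.2 hu)) hr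
  have := (FormalMultilinearSeries.hasFPowerSeriesOnBall _ hpos).hasFPowerSeriesAt
  convert this using 1
  ext u
  rw [← FormalMultilinearSeries.ofScalarsSum, FormalMultilinearSeries.ofScalarsSum_eq_tsum]
  simp

theorem tsum_sub_partialSum_isBigO (hh : 0 < h)
    (hs : ∀ u : ℝ, 0 ≤ u → u * h < 1 → Summable fun n => a n * u ^ n) (n : ℕ) :
    (fun u : ℝ => ∑' n, a n * u ^ n - ∑ k ∈ Finset.range n, a k * u ^ k)
      =O[𝓝 0] fun u => u ^ n := by
  have := (hasFPowerSeriesAt_tsum hh hs).isBigO_sub_partialSum_pow n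
  simp only [zero_add, FormalMultilinearSeries.partialSum,
    FormalMultilinearSeries.ofScalars_apply_eq, smul_eq_mul] at this
  refine (this.congr_right fun u => ?_).trans (isBigO_refl _ _).norm_left
  simp

theorem deriv_tsum_sub_isBigO (hh : 0 < h)
    (hs : ∀ u : ℝ, 0 ≤ u → u * h < 1 → Summable fun n => a n * u ^ n) :
    (fun u : ℝ => deriv (fun u : ℝ => ∑' n, a n * u ^ n) u - a 1) =O[𝓝 0] fun u => u ^ 1 := by
  have hp := hasFPowerSeriesAt_tsum hh hs
  have h0 : deriv (fun u : ℝ => ∑' n, a n * u ^ n) 0 = a 1 := by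
    rw [hp.deriv]
    simp
  have := hp.analyticAt.deriv.differentiableAt.isBigO_sub
  rw [h0] at this
  simpa using this

end PowerSeries

/-! ### Expansion of the squared refractive index. -/

namespace PPNMetric

variable (g : PPNMetric)

/-- `𝒜` as a function of `u = m / r`. -/
def Afun (u : ℝ) : ℝ := ∑' n, coeffA g.β n * u ^ n

/-- `ℬ⁻¹` as a function of `u = m / r`. -/
def Bfun (u : ℝ) : ℝ := ∑' n, coeffBinv g.γ g.ε g.γs n * u ^ n

theorem analyticAt_Afun : AnalyticAt ℝ g.Afun 0 :=
  (hasFPowerSeriesAt_tsum g.h_pos g.summable_A).analyticAt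

theorem analyticAt_Bfun : AnalyticAt ℝ g.Bfun 0 :=
  (hasFPowerSeriesAt_tsum g.h_pos g.summable_Binv).analyticAt

/-- Second order coefficient in the expansion of the squared refractive index `ℬ⁻¹ / 𝒜` in powers
of `m / r`. -/
def index₂ : ℝ := 3 / 2 * g.ε + 4 * g.γ + 4 - 2 * g.β 2

/-- Third order coefficient in the expansion of `ℬ⁻¹ / 𝒜` in powers of `m / r`. -/
def index₃ : ℝ :=
  1 / 2 * g.γs 3 - (-2 * g.index₂ + 2 * g.β 2 * (2 * (1 + g.γ)) - 3 / 2 * g.β 3)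

theorem Afun_isBigO : (fun u => g.Afun u - (1 - 2 * u + 2 * g.β 2 * u ^ 2
    - 3 / 2 * g.β 3 * u ^ 3)) =O[𝓝 0] fun u => u ^ 4 := by
  refine (tsum_sub_partialSum_isBigO g.h_pos g.summable_A 4).congr_left fun u => ?_
  simp only [Finset.sum_range_succ, Finset.sum_range_zero, coeffA, Afun]
  push_cast
  ring

theorem Bfun_isBigO : (fun u => g.Bfun u - (1 + 2 * g.γ * u + 3 / 2 * g.ε * u ^ 2
    + 1 / 2 * g.γs 3 * u ^ 3)) =O[𝓝 0] fun u => u ^ 4 := by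
  refine (tsum_sub_partialSum_isBigO g.h_pos g.summable_Binv 4).congr_left fun u => ?_
  simp only [Finset.sum_range_succ, Finset.sum_range_zero, coeffBinv, Bfun]
  ring

theorem Afun_zero : g.Afun 0 = 1 := by
  rw [Afun, tsum_eq_single 0]
  · simp [coeffA]
  · intro n hn; simp [hn]

theorem index_isBigO : (fun u => g.Bfun u / g.Afun u -
    (1 + 2 * (1 + g.γ) * u + g.index₂ * u ^ 2 + g.index₃ * u ^ 3)) =O[𝓝 0] fun u => u ^ 4 := by
  have hA : Tendsto g.Afun (𝓝 0) (𝓝 1) := by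
    have := g.analyticAt_Afun.continuousAt.tendsto
    rwa [g.Afun_zero] at this
  have hne : ∀ᶠ u in 𝓝 (0 : ℝ), g.Afun u ≠ 0 := hA.eventually_ne one_ne_zero
  have hinv : (fun u => (g.Afun u)⁻¹) =O[𝓝 0] fun _ => (1 : ℝ) :=
    (hA.inv₀ one_ne_zero).isBigO_one ℝ
  have hN : (fun u => 1 + 2 * (1 + g.γ) * u + g.index₂ * u ^ 2 + g.index₃ * u ^ 3)
      =O[𝓝 0] fun _ => (1 : ℝ) :=
    Tendsto.isBigO_one ℝ (Continuous.tendsto (by fun_prop) 0)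
  -- These are the coefficients of `u⁴`, `u⁵`, `u⁶` in the product of the cubic truncations of `𝒜`
  -- and of the quotient; the lower ones reproduce `ℬ⁻¹` by the choice of `index₂` and `index₃`.
  have hR : (fun u : ℝ => ((2 * g.β 2) * g.index₂ - 3 / 2 * g.β 3 * (2 * (1 + g.γ))
      - 2 * g.index₃) + (2 * g.β 2 * g.index₃ - 3 / 2 * g.β 3 * g.index₂) * u
      - 3 / 2 * g.β 3 * g.index₃ * u ^ 2) =O[𝓝 0] fun _ => (1 : ℝ) :=
    Tendsto.isBigO_one ℝ (Continuous.tendsto (by fun_prop) 0)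
  have key := (((g.Bfun_isBigO.sub ((g.Afun_isBigO.mul hN).congr_right fun u => mul_one _)).sub
    ((hR.mul (isBigO_refl (fun u : ℝ => u ^ 4) (𝓝 0))).congr_right
      fun u => one_mul _)).mul hinv).congr_right fun u => mul_one _
  refine key.congr' ?_ EventuallyEq.rfl
  filter_upwards [hne] with u hu
  rw [div_eq_mul_inv]
  have : g.Afun u * (g.Afun u)⁻¹ = 1 := mul_inv_cancel₀ hu
  have h3 : g.index₃ = 1 / 2 * g.γs 3
    - (-2 * g.index₂ + 2 * g.β 2 * (2 * (1 + g.γ)) - 3 / 2 * g.β 3) := rfl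
  have h2 : g.index₂ = 3 / 2 * g.ε + 4 * g.γ + 4 - 2 * g.β 2 := rfl
  linear_combination (-(1 + 2 * (1 + g.γ) * u + g.index₂ * u ^ 2 + g.index₃ * u ^ 3)) * this
    + (g.Afun u)⁻¹ * u ^ 3 * h3 + (g.Afun u)⁻¹ * u ^ 2 * h2

end PPNMetric

/-! ### Geometry of the unperturbed straight ray. -/

/-- A segment `h + t e`, `s₁ ≤ t ≤ s₂`, of a straight line avoiding the origin, with unit direction
`e`; `h` is the foot of the perpendicular from the origin. -/
structure Chord where
  h : E3
  e : E3
  s₁ : ℝ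
  s₂ : ℝ
  norm_e : ‖e‖ = 1
  inner_h_e : inner ℝ h e = 0
  h_ne : h ≠ 0
  lt : s₁ < s₂

namespace Chord

variable (C : Chord)

/-- the impact parameter -/
def b : ℝ := ‖C.h‖

/-- the length -/
def R : ℝ := C.s₂ - C.s₁

/-- the abscissa along the line of the point of parameter `ξ` -/
def t (ξ : ℝ) : ℝ := C.s₁ + ξ * C.R

/-- the point of parameter `ξ` -/
def pos (ξ : ℝ) : E3 := C.h + C.t ξ • C.e

/-- the distance from the origin to the point of parameter `ξ` -/
def r (ξ : ℝ) : ℝ := √(C.b ^ 2 + C.t ξ ^ 2)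

/-- the orthogonal projection onto the plane normal to the segment -/
def proj : E3 →L[ℝ] E3 :=
  ContinuousLinearMap.id ℝ E3 - (innerSL ℝ C.e).smulRight C.e

theorem b_pos : 0 < C.b := norm_pos_iff.2 C.h_ne

theorem R_pos : 0 < C.R := sub_pos.2 C.lt

theorem inner_e_e : inner ℝ C.e C.e = 1 := by
  rw [real_inner_self_eq_norm_sq, C.norm_e, one_pow]

theorem inner_e_h : inner ℝ C.e C.h = 0 := by rw [real_inner_comm, C.inner_h_e]

theorem inner_h_h : inner ℝ C.h C.h = C.b ^ 2 := real_inner_self_eq_norm_sq _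

theorem t_zero : C.t 0 = C.s₁ := by simp [t]

theorem t_one : C.t 1 = C.s₂ := by simp [t, R]

theorem sq_r (ξ : ℝ) : C.r ξ ^ 2 = C.b ^ 2 + C.t ξ ^ 2 := Real.sq_sqrt (by positivity)

theorem norm_pos_eq (ξ : ℝ) : ‖C.pos ξ‖ = C.r ξ := by
  rw [r, ← Real.sqrt_sq (norm_nonneg _), ← real_inner_self_eq_norm_sq, pos]
  congr 1
  simp only [inner_add_left, inner_add_right, inner_smul_left, inner_smul_right, C.inner_e_e,
    C.inner_e_h, C.inner_h_e, C.inner_h_h]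
  simp
  ring

theorem b_le_r (ξ : ℝ) : C.b ≤ C.r ξ := by
  rw [r]; exact Real.le_sqrt_of_sq_le (by nlinarith [sq_nonneg (C.t ξ)])

theorem r_pos (ξ : ℝ) : 0 < C.r ξ := C.b_pos.trans_le (C.b_le_r ξ)

theorem hasDerivAt_t (ξ : ℝ) : HasDerivAt C.t C.R ξ := by
  have h : HasDerivAt (fun x => C.s₁ + x * C.R) (1 * C.R) ξ :=
    ((hasDerivAt_id ξ).mul_const C.R).const_add C.s₁
  rwa [one_mul] at h

theorem hasDerivAt_pos (ξ : ℝ) : HasDerivAt C.pos (C.R • C.e) ξ :=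
  ((C.hasDerivAt_t ξ).smul_const C.e).const_add C.h

theorem hasDerivAt_r (ξ : ℝ) : HasDerivAt C.r (C.R * C.t ξ / C.r ξ) ξ := by
  have h1 := ((C.hasDerivAt_t ξ).pow 2).const_add (C.b ^ 2)
  have h2 := h1.sqrt (show C.b ^ 2 + C.t ξ ^ 2 ≠ 0 from
    (by have := C.b_pos; positivity : 0 < C.b ^ 2 + C.t ξ ^ 2).ne')
  refine HasDerivAt.congr_deriv (f := C.r) h2 ?_
  have := C.r_pos ξ
  change _ / (2 * C.r ξ) = _
  field_simp
  simp
  ring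

theorem continuous_r : Continuous C.r :=
  continuous_iff_continuousAt.2 fun ξ => (C.hasDerivAt_r ξ).continuousAt

theorem continuous_pos : Continuous C.pos :=
  continuous_iff_continuousAt.2 fun ξ => (C.hasDerivAt_pos ξ).continuousAt

theorem proj_apply (v : E3) : C.proj v = v - inner ℝ C.e v • C.e := rfl

theorem proj_e : C.proj C.e = 0 := by simp [proj_apply, C.norm_e]

theorem proj_h : C.proj C.h = C.h := by simp [proj_apply, C.inner_e_h]

theorem proj_pos (ξ : ℝ) : C.proj (C.pos ξ) = C.h := by
  simp [pos, C.proj_e, C.proj_h]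

theorem inner_h_proj (v : E3) : inner ℝ C.h (C.proj v) = inner ℝ C.h v := by
  simp [proj_apply, inner_sub_right, inner_smul_right, C.inner_h_e]

theorem eq_proj_add (v : E3) : v = C.proj v + inner ℝ C.e v • C.e := by
  simp [proj_apply]

theorem inner_e_proj (v : E3) : inner ℝ C.e (C.proj v) = 0 := by
  simp [proj_apply, inner_sub_right, inner_smul_right, C.norm_e]

end Chord

/-! ### The ray and its velocity are first order perturbations of the segment. -/

section Ray

variable {E : Type*} [NormedAddCommGroup E] [NormedSpace ℝ E]

/-- The `ξ`-derivative is `fderiv ℝ f` applied to `(0, 1)`, again an analytic family, so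
`UnifBigO.of_analyticAt` applies to it. -/
theorem UnifBigO.deriv_of_analyticAt [CompleteSpace E] {f : ℝ × ℝ → E} {φ : ℝ → E} {φ' : ℝ → E}
    (hf : ∀ ξ ∈ Set.Icc (0 : ℝ) 1, AnalyticAt ℝ f (0, ξ))
    (h0 : ∀ ξ ∈ Set.Icc (0 : ℝ) 1, f (0, ξ) = φ ξ)
    (hφ : ∀ ξ ∈ Set.Icc (0 : ℝ) 1, HasDerivAt φ (φ' ξ) ξ) :
    UnifBigO (Set.Icc 0 1) 1 (fun p => deriv (fun ξ => f (p.1, ξ)) p.2 - φ' p.2) := by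
  have hpart : ∀ p : ℝ × ℝ, DifferentiableAt ℝ f p →
      HasDerivAt (fun ξ => f (p.1, ξ)) (fderiv ℝ f p (0, 1)) p.2 := by
    intro p hp
    have h1 : HasDerivAt (fun ξ : ℝ => (p.1, ξ)) ((0 : ℝ), (1 : ℝ)) p.2 :=
      (hasDerivAt_const _ _).prodMk (hasDerivAt_id _)
    exact hp.hasFDerivAt.comp_hasDerivAt p.2 h1
  have hd : ∀ᶠ p in unif (Set.Icc 0 1), DifferentiableAt ℝ f p := by
    refine eventually_unif_iff.2 (Filter.Eventually.filter_mono nhdsWithin_le_nhds ?_)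
    refine isCompact_Icc.eventually_forall_of_forall_eventually fun ξ hξ => ?_
    exact (hf ξ hξ).eventually_analyticAt.mono fun z hz => hz.differentiableAt
  have han : ∀ ξ ∈ Set.Icc (0 : ℝ) 1, AnalyticAt ℝ (fun p => fderiv ℝ f p (0, 1)) (0, ξ) :=
    fun ξ hξ => ((ContinuousLinearMap.apply ℝ E ((0 : ℝ), (1 : ℝ))).analyticAt _).comp
      (AnalyticAt.fderiv (hf ξ hξ))
  refine (UnifBigO.of_analyticAt isCompact_Icc han).congr' ?_
  filter_upwards [hd, eventually_mem_unif] with p hp hmem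
  rw [(hpart p hp).deriv]
  congr 1
  -- The unperturbed motion is prescribed on `[0, 1]` only, so the two derivatives are compared
  -- within that interval, which also covers its end points.
  have h1 := (hpart (0, p.2) (hf p.2 hmem).differentiableAt).hasDerivWithinAt (s := Set.Icc 0 1)
  have h2 := ((hφ p.2 hmem).hasDerivWithinAt (s := Set.Icc 0 1)).congr
    (fun y hy => h0 y hy) (h0 _ hmem)
  exact (uniqueDiffOn_Icc zero_lt_one p.2 hmem).eq_deriv _ h1 h2

end Ray

/-- `(x⁰, 𝐱)` is the quasi-Minkowskian ray joining the ends of the segment `C`. -/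
def Chord.IsRay (C : Chord) (g : PPNMetric) (c tA : ℝ) (x0 : ℝ → ℝ → ℝ) (x : ℝ → ℝ → E3) :
    Prop :=
  g.IsQuasiMinkowskianRay c tA (C.pos 0) (C.pos 1) x0 x

namespace Chord.IsRay

variable {C : Chord} {g : PPNMetric} {c tA : ℝ} {x0 : ℝ → ℝ → ℝ} {x : ℝ → ℝ → E3}

theorem pos_one_sub (C : Chord) : C.pos 1 - C.pos 0 = C.R • C.e := by
  simp only [Chord.pos, Chord.t_one, Chord.t_zero, Chord.R, sub_smul]; abel

theorem norm_pos_one_sub (C : Chord) : ‖C.pos 1 - C.pos 0‖ = C.R := by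
  rw [pos_one_sub, norm_smul, C.norm_e, mul_one, Real.norm_eq_abs, abs_of_pos C.R_pos]

theorem zeroth (hr : C.IsRay g c tA x0 x) {ξ : ℝ} (hξ : ξ ∈ Set.Icc (0 : ℝ) 1) :
    x 0 ξ = C.pos ξ := by
  rw [hr.zeroth_space ξ hξ, pos_one_sub]
  simp only [Chord.pos, Chord.t, zero_mul, add_zero, add_smul, mul_smul]
  abel

theorem space_sub (hr : C.IsRay g c tA x0 x) :
    UnifBigO (Set.Icc 0 1) 1 (fun p => x p.1 p.2 - C.pos p.2) := by
  refine (UnifBigO.of_analyticAt isCompact_Icc hr.analytic_space).congr' ?_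
  filter_upwards [eventually_mem_unif] with p hp
  rw [← hr.zeroth hp]

theorem velocity_sub (hr : C.IsRay g c tA x0 x) :
    UnifBigO (Set.Icc 0 1) 1 (fun p => deriv (x p.1) p.2 - C.R • C.e) :=
  UnifBigO.deriv_of_analyticAt (f := fun p : ℝ × ℝ => x p.1 p.2) hr.analytic_space
    (fun _ h => hr.zeroth h) (fun ξ _ => C.hasDerivAt_pos ξ)

theorem time_velocity_sub (hr : C.IsRay g c tA x0 x) :
    UnifBigO (Set.Icc 0 1) 1 (fun p => deriv (x0 p.1) p.2 - C.R) := by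
  refine UnifBigO.deriv_of_analyticAt (f := fun p : ℝ × ℝ => x0 p.1 p.2)
    (φ := fun ξ => c * tA + ξ * C.R) (φ' := fun _ => C.R) hr.analytic_time (fun ξ h => ?_)
    (fun ξ _ => ?_)
  · rw [hr.zeroth_time ξ h, norm_pos_one_sub]
  · simpa using ((hasDerivAt_id ξ).mul_const C.R).const_add (c * tA)

theorem geodesic' (hr : C.IsRay g c tA x0 x) :
    ∀ᶠ p in unif (Set.Icc 0 1), g.IsNullGeodesic p.1 (x0 p.1) (x p.1) :=
  eventually_unif_iff.2 (hr.geodesic.mono fun _ h _ _ => h)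

theorem bounded_pos : UnifBigO (Set.Icc 0 1) 0 (fun p => C.pos p.2) :=
  UnifBigO.of_continuousOn isCompact_Icc C.continuous_pos.continuousOn

theorem bounded_r : UnifBigO (Set.Icc 0 1) 0 (fun p => C.r p.2) :=
  UnifBigO.of_continuousOn isCompact_Icc C.continuous_r.continuousOn

theorem eventually_b_le {s : Set ℝ} : ∀ᶠ p in unif s, C.b ≤ C.r p.2 :=
  Eventually.of_forall fun p => C.b_le_r p.2

theorem bounded_inv_r {s : Set ℝ} : UnifBigO s 0 (fun p => (C.r p.2)⁻¹) :=
  UnifBigO.inv C.b_pos eventually_b_le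

theorem bounded_space (hr : C.IsRay g c tA x0 x) :
    UnifBigO (Set.Icc 0 1) 0 (fun p => x p.1 p.2) :=
  hr.space_sub.bounded_of_sub bounded_pos

theorem bounded_velocity (hr : C.IsRay g c tA x0 x) :
    UnifBigO (Set.Icc 0 1) 0 (fun p => deriv (x p.1) p.2) :=
  hr.velocity_sub.bounded_of_sub (UnifBigO.const _)

theorem bounded_time_velocity (hr : C.IsRay g c tA x0 x) :
    UnifBigO (Set.Icc 0 1) 0 (fun p => deriv (x0 p.1) p.2) :=
  hr.time_velocity_sub.bounded_of_sub (UnifBigO.const _)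

theorem radius_sub (hr : C.IsRay g c tA x0 x) :
    UnifBigO (Set.Icc 0 1) 1 (fun p => ‖x p.1 p.2‖ - C.r p.2) :=
  hr.space_sub.norm_sub_norm.congr fun p => by rw [C.norm_pos_eq]

theorem eventually_radius (hr : C.IsRay g c tA x0 x) :
    ∀ᶠ p in unif (Set.Icc 0 1), C.b / 2 ≤ ‖x p.1 p.2‖ :=
  hr.radius_sub.eventually_half_le C.b_pos eventually_b_le

theorem bounded_inv_radius (hr : C.IsRay g c tA x0 x) :
    UnifBigO (Set.Icc 0 1) 0 (fun p => ‖x p.1 p.2‖⁻¹) :=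
  UnifBigO.inv (half_pos C.b_pos) hr.eventually_radius

theorem inv_radius_sub (hr : C.IsRay g c tA x0 x) :
    UnifBigO (Set.Icc 0 1) 1 (fun p => ‖x p.1 p.2‖⁻¹ - (C.r p.2)⁻¹) :=
  UnifBigO.inv_sub_inv (half_pos C.b_pos) C.b_pos hr.radius_sub hr.eventually_radius
    eventually_b_le

theorem potential (hr : C.IsRay g c tA x0 x) :
    UnifBigO (Set.Icc 0 1) 1 (fun p => p.1 / ‖x p.1 p.2‖) :=
  (UnifBigO.fst.mul hr.bounded_inv_radius).congr fun p => (div_eq_mul_inv _ _).symm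

theorem A_sub (hr : C.IsRay g c tA x0 x) :
    UnifBigO (Set.Icc 0 1) 1 (fun p => g.A p.1 ‖x p.1 p.2‖ - 1) := by
  have h := g.analyticAt_Afun.differentiableAt.isBigO_sub
  simp only [g.Afun_zero, sub_zero] at h
  exact UnifBigO.comp_of_isBigO (k := 1) (φ := fun u => g.Afun u - 1)
    (h.congr_right fun u => (pow_one u).symm) hr.potential

end Chord.IsRay

theorem PPNMetric.Bfun_zero (g : PPNMetric) : g.Bfun 0 = 1 := by
  rw [PPNMetric.Bfun, tsum_eq_single 0]
  · simp [coeffBinv]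
  · intro n hn; simp [hn]

namespace Chord.IsRay

variable {C : Chord} {g : PPNMetric} {c tA : ℝ} {x0 : ℝ → ℝ → ℝ} {x : ℝ → ℝ → E3}

theorem B_sub (hr : C.IsRay g c tA x0 x) :
    UnifBigO (Set.Icc 0 1) 1 (fun p => g.Binv p.1 ‖x p.1 p.2‖ - 1) := by
  have h := g.analyticAt_Bfun.differentiableAt.isBigO_sub
  simp only [g.Bfun_zero, sub_zero] at h
  exact UnifBigO.comp_of_isBigO (k := 1) (φ := fun u => g.Bfun u - 1)
    (h.congr_right fun u => (pow_one u).symm) hr.potential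

theorem eventually_A (hr : C.IsRay g c tA x0 x) :
    ∀ᶠ p in unif (Set.Icc 0 1), 1 / 2 ≤ g.A p.1 ‖x p.1 p.2‖ :=
  hr.A_sub.eventually_half_le one_pos (Eventually.of_forall fun _ => le_rfl)

theorem eventually_B (hr : C.IsRay g c tA x0 x) :
    ∀ᶠ p in unif (Set.Icc 0 1), 1 / 2 ≤ g.Binv p.1 ‖x p.1 p.2‖ :=
  hr.B_sub.eventually_half_le one_pos (Eventually.of_forall fun _ => le_rfl)

theorem bounded_B (hr : C.IsRay g c tA x0 x) :
    UnifBigO (Set.Icc 0 1) 0 (fun p => g.Binv p.1 ‖x p.1 p.2‖) :=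
  hr.B_sub.bounded_of_sub (UnifBigO.const _)

theorem bounded_inv_B (hr : C.IsRay g c tA x0 x) :
    UnifBigO (Set.Icc 0 1) 0 (fun p => (g.Binv p.1 ‖x p.1 p.2‖)⁻¹) :=
  UnifBigO.inv (half_pos one_pos) hr.eventually_B

theorem inv_B_sub (hr : C.IsRay g c tA x0 x) :
    UnifBigO (Set.Icc 0 1) 1 (fun p => (g.Binv p.1 ‖x p.1 p.2‖)⁻¹ - 1) :=
  (UnifBigO.inv_sub_inv (half_pos one_pos) one_pos hr.B_sub hr.eventually_B
    (Eventually.of_forall fun _ => le_rfl)).congr fun p => by rw [inv_one]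

theorem index_sub (hr : C.IsRay g c tA x0 x) :
    UnifBigO (Set.Icc 0 1) 4 (fun p => g.Binv p.1 ‖x p.1 p.2‖ / g.A p.1 ‖x p.1 p.2‖ -
      (1 + 2 * (1 + g.γ) * (p.1 / ‖x p.1 p.2‖) + g.index₂ * (p.1 / ‖x p.1 p.2‖) ^ 2
        + g.index₃ * (p.1 / ‖x p.1 p.2‖) ^ 3)) :=
  UnifBigO.comp_of_isBigO g.index_isBigO hr.potential

/-! ### Energy, momentum and the equation of motion. -/

/-- the conserved energy -/
def energy (g : PPNMetric) (x0 : ℝ → ℝ → ℝ) (x : ℝ → ℝ → E3) (M : ℝ) : ℝ :=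
  g.A M ‖x M 0‖ * deriv (x0 M) 0

theorem energy_sub {s : Set ℝ} (hr : C.IsRay g c tA x0 x) :
    UnifBigO s 1 (fun p => energy g x0 x p.1 - C.R) := by
  have h := (hr.A_sub.mul_sub_mul (g := fun p => deriv (x0 p.1) p.2) hr.time_velocity_sub
    (UnifBigO.const _) hr.bounded_time_velocity).eval (t := s) (ξ := 0) ⟨le_rfl, zero_le_one⟩
  exact h.congr fun p => by rw [energy, one_mul]

theorem energy_eq (hr : C.IsRay g c tA x0 x) :
    ∀ᶠ p in unif (Set.Icc 0 1),
      g.A p.1 ‖x p.1 p.2‖ * deriv (x0 p.1) p.2 = energy g x0 x p.1 := by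
  refine eventually_unif_iff.2 (hr.geodesic.mono fun M h ξ hξ => ?_)
  refine constant_of_has_deriv_right_zero (f := fun s => g.A M ‖x M s‖ * deriv (x0 M) s)
    (fun s hs => (h.geodesic_time s hs).continuousAt.continuousWithinAt)
    (fun s hs => (h.geodesic_time s ⟨hs.1, hs.2.le⟩).hasDerivWithinAt) ξ hξ

/-- the spatial momentum `ℬ⁻¹ d𝐱/dξ` -/
def momentum (g : PPNMetric) (x : ℝ → ℝ → E3) (p : ℝ × ℝ) : E3 :=
  g.Binv p.1 ‖x p.1 p.2‖ • deriv (x p.1) p.2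

/-- `d(momentum)/dξ = force • 𝐱` -/
def force (g : PPNMetric) (x0 : ℝ → ℝ → ℝ) (x : ℝ → ℝ → E3) (p : ℝ × ℝ) : ℝ :=
  p.1 * (‖x p.1 p.2‖⁻¹ * ‖x p.1 p.2‖⁻¹ * ‖x p.1 p.2‖⁻¹) *
    ((deriv g.Afun (p.1 / ‖x p.1 p.2‖) * (deriv (x0 p.1) p.2 * deriv (x0 p.1) p.2)
      - deriv g.Bfun (p.1 / ‖x p.1 p.2‖) * (‖deriv (x p.1) p.2‖ * ‖deriv (x p.1) p.2‖)) * (1 / 2))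

theorem hasGradientAt_radial {φ : ℝ → ℝ} {M : ℝ} {z : E3} (hz : z ≠ 0)
    (hφ : DifferentiableAt ℝ φ (M / ‖z‖)) :
    HasGradientAt (fun y : E3 => φ (M / ‖y‖))
      ((-(M * (‖z‖⁻¹ * ‖z‖⁻¹ * ‖z‖⁻¹) * deriv φ (M / ‖z‖))) • z) z := by
  have hn : ‖z‖ ≠ 0 := norm_ne_zero_iff.2 hz
  have h1 : HasFDerivAt (fun y : E3 => ‖y‖ ^ 2) (2 • innerSL ℝ z) z :=
    (hasStrictFDerivAt_norm_sq z).hasFDerivAt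
  have h2 := h1.sqrt (by positivity)
  simp only [Real.sqrt_sq (norm_nonneg _)] at h2
  have h3 : HasDerivAt (fun ρ : ℝ => φ (M / ρ)) (deriv φ (M / ‖z‖) * (M * (-(‖z‖ ^ 2)⁻¹))) ‖z‖ := by
    have := (hasDerivAt_inv hn).const_mul M
    exact hφ.hasDerivAt.comp ‖z‖ this
  have h4 := h3.comp_hasFDerivAt z h2
  rw [hasGradientAt_iff_hasFDerivAt]
  refine h4.congr_fderiv ?_
  ext v
  simp
  field_simp

theorem differentiable_potentials (hr : C.IsRay g c tA x0 x) :
    ∀ᶠ p in unif (Set.Icc 0 1), DifferentiableAt ℝ g.Afun (p.1 / ‖x p.1 p.2‖) ∧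
      DifferentiableAt ℝ g.Bfun (p.1 / ‖x p.1 p.2‖) :=
  hr.potential.tendsto_zero.eventually
    ((g.analyticAt_Afun.eventually_analyticAt.mono fun _ h => h.differentiableAt).and
      (g.analyticAt_Bfun.eventually_analyticAt.mono fun _ h => h.differentiableAt))

theorem hasDerivAt_momentum (hr : C.IsRay g c tA x0 x) :
    ∀ᶠ p in unif (Set.Icc 0 1), HasDerivAt (fun ξ => momentum g x (p.1, ξ))
      (force g x0 x p • x p.1 p.2) p.2 := by
  filter_upwards [hr.geodesic', hr.differentiable_potentials, eventually_mem_unif,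
    hr.eventually_radius] with p hg hd hmem hrad
  have hz : x p.1 p.2 ≠ 0 := norm_pos_iff.1 ((half_pos C.b_pos).trans_le hrad)
  have hA := hasGradientAt_radial (M := p.1) hz hd.1
  have hB := hasGradientAt_radial (M := p.1) hz hd.2
  have h1 := (hA.hasFDerivAt.mul_const (deriv (x0 p.1) p.2 ^ 2)).sub
    (hB.hasFDerivAt.mul_const (‖deriv (x p.1) p.2‖ ^ 2))
  rw [← map_smul, ← map_smul, ← map_sub] at h1
  have h1 : HasGradientAt (fun y : E3 => g.A p.1 ‖y‖ * deriv (x0 p.1) p.2 ^ 2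
      - g.Binv p.1 ‖y‖ * ‖deriv (x p.1) p.2‖ ^ 2) _ (x p.1 p.2) :=
    hasGradientAt_iff_hasFDerivAt.2 h1
  have h2 := (hg.geodesic_space p.2 hmem).neg
  rw [h1.gradient] at h2
  refine (h2.congr_of_eventuallyEq (Eventually.of_forall fun ξ => ?_)).congr_deriv ?_
  · simp [momentum]
  · simp only [smul_smul, ← sub_smul, ← neg_smul, force]
    congr 1
    ring

theorem deriv_potential_sub (hr : C.IsRay g c tA x0 x) :
    UnifBigO (Set.Icc 0 1) 1 (fun p => deriv g.Afun (p.1 / ‖x p.1 p.2‖) - (-2)) ∧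
    UnifBigO (Set.Icc 0 1) 1 (fun p => deriv g.Bfun (p.1 / ‖x p.1 p.2‖) - 2 * g.γ) :=
  ⟨UnifBigO.comp_of_isBigO (k := 1) (φ := fun u => deriv g.Afun u - (-2))
    (deriv_tsum_sub_isBigO g.h_pos g.summable_A) hr.potential,
  UnifBigO.comp_of_isBigO (k := 1) (φ := fun u => deriv g.Bfun u - 2 * g.γ)
    (deriv_tsum_sub_isBigO g.h_pos g.summable_Binv) hr.potential⟩

theorem speed_sub (hr : C.IsRay g c tA x0 x) :
    UnifBigO (Set.Icc 0 1) 1 (fun p => ‖deriv (x p.1) p.2‖ - C.R) :=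
  hr.velocity_sub.norm_sub_norm.congr fun p => by
    rw [norm_smul, C.norm_e, mul_one, Real.norm_eq_abs, abs_of_pos C.R_pos]

/-- At lowest order the potentials have slopes `-2` and `2γ`, and both `dx⁰/dξ` and `|d𝐱/dξ|` equal
`R`. The half difference in `force` is then `-(1 + γ)R²`; the prefactor `M` raises the error to
second order. -/
theorem force_sub (hr : C.IsRay g c tA x0 x) :
    UnifBigO (Set.Icc 0 1) 2 (fun p => force g x0 x p •  x p.1 p.2 -
      (-((1 + g.γ) * p.1 * C.R ^ 2 * ((C.r p.2)⁻¹ * (C.r p.2)⁻¹ * (C.r p.2)⁻¹))) • C.pos p.2) := by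
  have bi := bounded_inv_r (C := C) (s := Set.Icc 0 1)
  have bi' := hr.bounded_inv_radius
  have hi := hr.inv_radius_sub
  have h2 := hi.mul_sub_mul hi bi bi'
  have h3 := h2.mul_sub_mul hi (bi.mul bi (k := 0)) bi'
  have hT := hr.time_velocity_sub.mul_sub_mul hr.time_velocity_sub (UnifBigO.const _)
    hr.bounded_time_velocity
  have bS := hr.speed_sub.bounded_of_sub (UnifBigO.const _)
  have hS := hr.speed_sub.mul_sub_mul hr.speed_sub (UnifBigO.const _) bS
  have hA := hr.deriv_potential_sub.1.mul_sub_mul hT (UnifBigO.const _)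
    (hr.bounded_time_velocity.mul hr.bounded_time_velocity (k := 0))
  have hB := hr.deriv_potential_sub.2.mul_sub_mul hS (UnifBigO.const _) (bS.mul bS (k := 0))
  have hc := (hA.sub hB).mul (UnifBigO.const (s := Set.Icc 0 1) (1 / 2 : ℝ)) (k := 1)
  have hc' : UnifBigO (Set.Icc 0 1) 1 (fun p : ℝ × ℝ =>
      (deriv g.Afun (p.1 / ‖x p.1 p.2‖) * (deriv (x0 p.1) p.2 * deriv (x0 p.1) p.2)
      - deriv g.Bfun (p.1 / ‖x p.1 p.2‖) * (‖deriv (x p.1) p.2‖ * ‖deriv (x p.1) p.2‖)) * (1 / 2)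
      - (-((1 + g.γ) * C.R ^ 2))) := hc.congr fun p => by ring
  have hq := h3.mul_sub_mul hc' ((bi.mul bi (k := 0)).mul bi (k := 0))
    (hc'.bounded_of_sub (UnifBigO.const _))
  have hv := hq.smul_sub_smul hr.space_sub
    (((bi.mul bi (k := 0)).mul bi (k := 0)).mul (UnifBigO.const _)) hr.bounded_space
  refine (UnifBigO.fst.smul hv (k := 2)).congr fun p => ?_
  simp only [smul_sub, smul_smul, force]
  congr 2 <;> ring

end Chord.IsRay

/-! ### Transverse deflection of the ray at first order. -/

theorem Chord.hasDerivAt_t_mul_inv_r (C : Chord) (ξ : ℝ) :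
    HasDerivAt (fun ξ => C.t ξ * (C.r ξ)⁻¹)
      (C.R * C.b ^ 2 * ((C.r ξ)⁻¹ * (C.r ξ)⁻¹ * (C.r ξ)⁻¹)) ξ := by
  have h := (C.hasDerivAt_t ξ).mul ((C.hasDerivAt_r ξ).inv (C.r_pos ξ).ne')
  refine h.congr_deriv ?_
  have h1 := C.r_pos ξ
  have h2 := C.sq_r ξ
  rw [Pi.inv_apply]
  field_simp
  linear_combination C.R * h2

namespace Chord.IsRay

variable {C : Chord} {g : PPNMetric} {c tA : ℝ} {x0 : ℝ → ℝ → ℝ} {x : ℝ → ℝ → E3}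

theorem hasDerivAt_space (hr : C.IsRay g c tA x0 x) :
    ∀ᶠ p in unif (Set.Icc 0 1), HasDerivAt (x p.1) (deriv (x p.1) p.2) p.2 := by
  filter_upwards [hr.geodesic', eventually_mem_unif] with p hp hmem
  exact ((hp.contDiff_space p.2 hmem).differentiableAt (by norm_num)).hasDerivAt

theorem hasDerivAt_time (hr : C.IsRay g c tA x0 x) :
    ∀ᶠ p in unif (Set.Icc 0 1), HasDerivAt (x0 p.1) (deriv (x0 p.1) p.2) p.2 := by
  filter_upwards [hr.geodesic', eventually_mem_unif] with p hp hmem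
  exact ((hp.contDiff_time p.2 hmem).differentiableAt (by norm_num)).hasDerivAt

theorem start (hr : C.IsRay g c tA x0 x) {s : Set ℝ} :
    ∀ᶠ p in unif s, x p.1 0 = C.pos 0 :=
  eventually_unif_iff.2 (hr.start_space.mono fun _ h _ _ => h)

theorem arrival (hr : C.IsRay g c tA x0 x) {s : Set ℝ} :
    ∀ᶠ p in unif s, x p.1 1 = C.pos 1 :=
  eventually_unif_iff.2 (hr.end_space.mono fun _ h _ _ => h)

theorem of_deriv_Icc {E : Type*} [NormedAddCommGroup E] [NormedSpace ℝ E] {k : ℕ}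
    (f : ℝ × ℝ → E) {f' : ℝ × ℝ → E}
    (hd : ∀ᶠ p in unif (Set.Icc 0 1), HasDerivAt (fun ξ => f (p.1, ξ)) (f' p) p.2)
    (h : UnifBigO (Set.Icc 0 1) k f') :
    UnifBigO (Set.Icc 0 1) k (fun p => f p - f (p.1, 0)) ∧
      UnifBigO (Set.Ioo 0 1) k (fun p => p.2⁻¹ • (f p - f (p.1, 0))) := by
  have h0 := eventually_unif_iff.1 hd
  have hc : ∀ᶠ M in 𝓝[>] (0 : ℝ), ContinuousOn (fun ξ => f (M, ξ)) (Set.Icc 0 1) :=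
    h0.mono fun _ h ξ hξ => (h ξ hξ).continuousAt.continuousWithinAt
  have hd' : ∀ᶠ M in 𝓝[>] (0 : ℝ), ∀ ξ ∈ Set.Ioo (0 : ℝ) 1,
      HasDerivAt (fun ξ => f (M, ξ)) (f' (M, ξ)) ξ :=
    h0.mono fun _ h ξ hξ => h ξ ⟨hξ.1.le, hξ.2.le⟩
  exact ⟨.of_deriv hc hd' (h.mono_set Set.Ioo_subset_Icc_self),
    .of_deriv_slope hc hd' (h.mono_set Set.Ioo_subset_Icc_self)⟩

theorem proj_velocity (hr : C.IsRay g c tA x0 x) :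
    UnifBigO (Set.Icc 0 1) 1 (fun p => C.proj (deriv (x p.1) p.2)) :=
  (hr.velocity_sub.clm C.proj).congr fun p => by simp [C.proj_e]

/-- the initial transverse velocity, up to terms of second order -/
def slope (C : Chord) (g : PPNMetric) (x : ℝ → ℝ → E3) (M : ℝ) : E3 :=
  C.proj (momentum g x (M, 0)) +
    ((1 + g.γ) * M * C.R * (C.b ^ 2)⁻¹ * (C.t 0 * (C.r 0)⁻¹)) • C.h

/-- The projected force is `-(1 + γ)MR² h/r³` up to second order, and `t/r` is a primitive of
`Rb²/r³`. Passing from momentum to velocity costs `(ℬ⁻¹ - 1)` times a transverse velocity, a product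
of two first order terms. -/
theorem transverse_velocity_sub_slope (hr : C.IsRay g c tA x0 x) :
    UnifBigO (Set.Icc 0 1) 2 (fun p => C.proj (deriv (x p.1) p.2) +
      ((1 + g.γ) * p.1 * C.R * (C.b ^ 2)⁻¹ * (C.t p.2 * (C.r p.2)⁻¹)) • C.h
        - slope C g x p.1) := by
  have hd : ∀ᶠ p in unif (Set.Icc 0 1), HasDerivAt (fun ξ => C.proj (momentum g x (p.1, ξ)) +
      ((1 + g.γ) * p.1 * C.R * (C.b ^ 2)⁻¹ * (C.t ξ * (C.r ξ)⁻¹)) • C.h)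
      (C.proj (force g x0 x p • x p.1 p.2) + ((1 + g.γ) * p.1 * C.R * (C.b ^ 2)⁻¹ *
        (C.R * C.b ^ 2 * ((C.r p.2)⁻¹ * (C.r p.2)⁻¹ * (C.r p.2)⁻¹))) • C.h) p.2 := by
    filter_upwards [hr.hasDerivAt_momentum] with p hp
    exact (C.proj.hasFDerivAt.comp_hasDerivAt p.2 hp).add
      (((C.hasDerivAt_t_mul_inv_r p.2).const_mul _).smul_const C.h)
  have h1 : UnifBigO (Set.Icc 0 1) 2 (fun p => C.proj (force g x0 x p • x p.1 p.2) +
      ((1 + g.γ) * p.1 * C.R * (C.b ^ 2)⁻¹ *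
        (C.R * C.b ^ 2 * ((C.r p.2)⁻¹ * (C.r p.2)⁻¹ * (C.r p.2)⁻¹))) • C.h) := by
    refine (hr.force_sub.clm C.proj).congr fun p => ?_
    rw [map_sub, map_smul _ (-_), C.proj_pos, neg_smul, sub_neg_eq_add]
    congr 2
    have := C.b_pos
    field_simp
  have h2 := (of_deriv_Icc (fun p => C.proj (momentum g x p) +
      ((1 + g.γ) * p.1 * C.R * (C.b ^ 2)⁻¹ * (C.t p.2 * (C.r p.2)⁻¹)) • C.h) hd h1).1
  have h3 : UnifBigO (Set.Icc 0 1) 2 (fun p => (g.Binv p.1 ‖x p.1 p.2‖ - 1) •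
      C.proj (deriv (x p.1) p.2)) := hr.B_sub.smul hr.proj_velocity
  refine (h2.sub h3).congr fun p => ?_
  simp only [slope, momentum, map_smul, sub_smul, one_smul]
  abel

theorem hasDerivAt_transverse (hr : C.IsRay g c tA x0 x) :
    ∀ᶠ p in unif (Set.Icc 0 1), HasDerivAt (fun ξ => C.proj (x p.1 ξ) +
      ((1 + g.γ) * p.1 * (C.b ^ 2)⁻¹ * C.r ξ) • C.h - ξ • slope C g x p.1)
      (C.proj (deriv (x p.1) p.2) +
      ((1 + g.γ) * p.1 * C.R * (C.b ^ 2)⁻¹ * (C.t p.2 * (C.r p.2)⁻¹)) • C.h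
        - slope C g x p.1) p.2 := by
  filter_upwards [hr.hasDerivAt_space] with p hp
  have h1 := ((C.proj.hasFDerivAt.comp_hasDerivAt p.2 hp).add
    (((C.hasDerivAt_r p.2).const_mul ((1 + g.γ) * p.1 * (C.b ^ 2)⁻¹)).smul_const C.h)).sub
    ((hasDerivAt_id p.2).smul_const (slope C g x p.1))
  refine h1.congr_deriv ?_
  rw [one_smul]
  congr 3
  ring

/-- A second integration uses `dr/dξ = R t/r`. Both ends of the ray project to `h`, and this
boundary condition determines the constant of integration. -/
theorem slope_sub (hr : C.IsRay g c tA x0 x) {s : Set ℝ} :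
    UnifBigO s 2 (fun p => slope C g x p.1 -
      ((1 + g.γ) * p.1 * (C.b ^ 2)⁻¹ * (C.r 1 - C.r 0)) • C.h) := by
  have h1 := (of_deriv_Icc
    (fun p => C.proj (x p.1 p.2) +
      ((1 + g.γ) * p.1 * (C.b ^ 2)⁻¹ * C.r p.2) • C.h - p.2 • slope C g x p.1)
    hr.hasDerivAt_transverse hr.transverse_velocity_sub_slope).1.eval (t := s) (ξ := 1)
    ⟨zero_le_one, le_rfl⟩
  refine h1.neg.congr' ?_
  filter_upwards [hr.start (s := s), hr.arrival (s := s)] with p h0 h1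
  simp only [h0, h1, C.proj_pos, one_smul, zero_smul, mul_sub, sub_smul]
  abel

theorem transverse_velocity (hr : C.IsRay g c tA x0 x) :
    UnifBigO (Set.Icc 0 1) 2 (fun p => C.proj (deriv (x p.1) p.2) -
      ((1 + g.γ) * p.1 * (C.b ^ 2)⁻¹ *
        (C.r 1 - C.r 0 - C.R * (C.t p.2 * (C.r p.2)⁻¹))) • C.h) := by
  refine (hr.transverse_velocity_sub_slope.add hr.slope_sub).congr fun p => ?_
  module

theorem transverse_position (hr : C.IsRay g c tA x0 x) :
    UnifBigO (Set.Icc 0 1) 2 (fun p => C.proj (x p.1 p.2) - C.h -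
      ((1 + g.γ) * p.1 * (C.b ^ 2)⁻¹ * (p.2 * (C.r 1 - C.r 0) - (C.r p.2 - C.r 0))) • C.h) := by
  have h1 := (of_deriv_Icc
    (fun p => C.proj (x p.1 p.2) +
      ((1 + g.γ) * p.1 * (C.b ^ 2)⁻¹ * C.r p.2) • C.h - p.2 • slope C g x p.1)
    hr.hasDerivAt_transverse hr.transverse_velocity_sub_slope).1
  have h2 : UnifBigO (Set.Icc 0 1) 0 (fun p => p.2) :=
    UnifBigO.of_continuousOn (f := fun ξ => ξ) isCompact_Icc continuousOn_id
  refine (h1.add (h2.smul hr.slope_sub (k := 2))).congr' ?_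
  filter_upwards [hr.start (s := Set.Icc 0 1)] with p h0
  simp only [h0, C.proj_pos]
  module

theorem transverse_chord (hr : C.IsRay g c tA x0 x) :
    UnifBigO (Set.Ioo 0 1) 2 (fun p => C.proj (p.2⁻¹ • (x p.1 p.2 - C.pos 0)) -
      ((1 + g.γ) * p.1 * (C.b ^ 2)⁻¹ * (C.r 1 - C.r 0 - p.2⁻¹ * (C.r p.2 - C.r 0))) • C.h) := by
  have h1 := (of_deriv_Icc
    (fun p => C.proj (x p.1 p.2) +
      ((1 + g.γ) * p.1 * (C.b ^ 2)⁻¹ * C.r p.2) • C.h - p.2 • slope C g x p.1)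
    hr.hasDerivAt_transverse hr.transverse_velocity_sub_slope).2
  refine (h1.add hr.slope_sub).congr' ?_
  filter_upwards [hr.start (s := Set.Ioo 0 1), eventually_mem_unif] with p h0 hp
  have hp0 : p.2 ≠ 0 := hp.1.ne'
  simp only [h0, C.proj_pos, map_smul, map_sub, smul_sub, smul_add, smul_smul,
    inv_mul_cancel₀ hp0]
  module

/-- the mean velocity between the parameters `0` and `ξ` -/
theorem chord_sub (hr : C.IsRay g c tA x0 x) :
    UnifBigO (Set.Ioo 0 1) 1 (fun p => p.2⁻¹ • (x p.1 p.2 - C.pos 0) - C.R • C.e) := by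
  have hd : ∀ᶠ p in unif (Set.Icc 0 1), HasDerivAt (fun ξ => x p.1 ξ - C.pos ξ)
      (deriv (x p.1) p.2 - C.R • C.e) p.2 := by
    filter_upwards [hr.hasDerivAt_space] with p hp
    exact hp.sub (C.hasDerivAt_pos p.2)
  have h1 := (of_deriv_Icc (fun p => x p.1 p.2 - C.pos p.2) hd hr.velocity_sub).2
  refine h1.congr' ?_
  filter_upwards [hr.start (s := Set.Ioo 0 1), eventually_mem_unif] with p h0 hp
  have hp0 : p.2 ≠ 0 := hp.1.ne'
  have h2 : C.R • C.e = p.2⁻¹ • (C.pos p.2 - C.pos 0) := by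
    simp only [pos, t, zero_mul, add_zero, add_sub_add_left_eq_sub, ← sub_smul, smul_smul]
    congr 1
    field_simp
    ring
  rw [h0, sub_self, sub_zero, h2, ← smul_sub]
  congr 1
  abel

end Chord.IsRay

/-! ### An explicit approximate solution of the eikonal equation. -/

section Eikonal

/-- Third order Taylor polynomial of `√(1 + 4 z)`. -/
def weight (z : ℝ) : ℝ := 1 + 2 * z - 2 * z ^ 2 + 4 * z ^ 3

theorem weight_sq (z : ℝ) :
    weight z ^ 2 = 1 + 4 * z + z ^ 4 * (20 - 16 * z + 16 * z ^ 2) := by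
  rw [weight]; ring

/-- The primitive of `σ ↦ weight (μ / σ)`. -/
def weightPrimitive (μ σ : ℝ) : ℝ :=
  σ + 2 * μ * Real.log σ + 2 * μ ^ 2 * σ⁻¹ - 2 * μ ^ 3 * (σ⁻¹) ^ 2

theorem hasDerivAt_weightPrimitive (μ : ℝ) {σ : ℝ} (hσ : σ ≠ 0) :
    HasDerivAt (weightPrimitive μ) (weight (μ * σ⁻¹)) σ := by
  have h1 := (((hasDerivAt_id σ).add ((Real.hasDerivAt_log hσ).const_mul (2 * μ))).add
    ((hasDerivAt_inv hσ).const_mul (2 * μ ^ 2))).sub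
    (((hasDerivAt_inv hσ).pow 2).const_mul (2 * μ ^ 3))
  refine HasDerivAt.congr_deriv (f := weightPrimitive μ) h1 ?_
  rw [weight]
  field_simp
  simp
  field_simp
  ring

variable (μ : ℝ) (xA z : E3)

/-- `‖xA‖ + ‖z‖ + ‖z - xA‖` -/
def sumPlus : ℝ := ‖xA‖ + ‖z‖ + ‖z - xA‖

/-- `‖xA‖ + ‖z‖ - ‖z - xA‖` -/
def sumMinus : ℝ := ‖xA‖ + ‖z‖ - ‖z - xA‖

/-- Solution with vertex `xA`, up to terms of fourth order, of the eikonal equation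
`|∇S|² = 1 + 2 μ / r`. -/
def eikonal : ℝ :=
  (weightPrimitive μ (sumPlus xA z) - weightPrimitive μ (sumMinus xA z)) * (1 / 2)

/-- The gradient of `eikonal`. -/
def eikonalGrad : E3 :=
  ((weight (μ * (sumPlus xA z)⁻¹) + weight (μ * (sumMinus xA z)⁻¹)) * (1 / 2)) •
      (‖z - xA‖⁻¹ • (z - xA)) +
    ((weight (μ * (sumPlus xA z)⁻¹) - weight (μ * (sumMinus xA z)⁻¹)) * (1 / 2)) • (‖z‖⁻¹ • z)

theorem eikonal_self : eikonal μ xA xA = 0 := by simp [eikonal, sumPlus, sumMinus]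

/-- The defect in the eikonal equation. -/
def eikonalDefect : ℝ :=
  (μ * (sumPlus xA z)⁻¹) ^ 4 * (20 - 16 * (μ * (sumPlus xA z)⁻¹)
      + 16 * (μ * (sumPlus xA z)⁻¹) ^ 2) *
      ((1 + inner ℝ (‖z‖⁻¹ • z) (‖z - xA‖⁻¹ • (z - xA))) * (1 / 2)) +
    (μ * (sumMinus xA z)⁻¹) ^ 4 * (20 - 16 * (μ * (sumMinus xA z)⁻¹)
      + 16 * (μ * (sumMinus xA z)⁻¹) ^ 2) *
      ((1 - inner ℝ (‖z‖⁻¹ • z) (‖z - xA‖⁻¹ • (z - xA))) * (1 / 2))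

variable {μ xA z}

/-- With weights `w±` and `k` the cosine between the two unit vectors, the squared norm is `½(1 +
k)w₊² + ½(1 - k)w₋²`. Insert `w² = 1 + 4μ/σ + O(μ⁴)`; the terms linear in `μ` combine by `h6`. -/
theorem norm_sq_eikonalGrad (hz : z ≠ 0) (hzA : z ≠ xA) (hp : sumPlus xA z ≠ 0)
    (hm : sumMinus xA z ≠ 0) :
    ‖eikonalGrad μ xA z‖ ^ 2 = 1 + 2 * μ * ‖z‖⁻¹ + eikonalDefect μ xA z := by
  have hr : ‖z‖ ≠ 0 := norm_ne_zero_iff.2 hz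
  have hd : ‖z - xA‖ ≠ 0 := norm_ne_zero_iff.2 (sub_ne_zero.2 hzA)
  have h1 : inner ℝ (‖z‖⁻¹ • z) (‖z‖⁻¹ • z) = 1 := by
    rw [real_inner_self_eq_norm_sq, norm_smul, norm_inv, norm_norm, inv_mul_cancel₀ hr, one_pow]
  have h2 : inner ℝ (‖z - xA‖⁻¹ • (z - xA)) (‖z - xA‖⁻¹ • (z - xA)) = 1 := by
    rw [real_inner_self_eq_norm_sq, norm_smul, norm_inv, norm_norm, inv_mul_cancel₀ hd, one_pow]
  have h3 : inner ℝ z (z - xA) =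
      ‖z‖ * ‖z - xA‖ * inner ℝ (‖z‖⁻¹ • z) (‖z - xA‖⁻¹ • (z - xA)) := by
    simp only [inner_smul_left, inner_smul_right]
    simp
    field_simp
  have h4 : ‖xA‖ ^ 2 = ‖z‖ ^ 2 - 2 * inner ℝ z (z - xA) + ‖z - xA‖ ^ 2 := by
    rw [← norm_sub_sq_real]; congr 2; abel
  rw [h3] at h4
  have h5 : inner ℝ (‖z - xA‖⁻¹ • (z - xA)) (‖z‖⁻¹ • z) =
      inner ℝ (‖z‖⁻¹ • z) (‖z - xA‖⁻¹ • (z - xA)) := real_inner_comm _ _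
  rw [← real_inner_self_eq_norm_sq, eikonalGrad, eikonalDefect]
  generalize hk : inner ℝ (‖z‖⁻¹ • z) (‖z - xA‖⁻¹ • (z - xA)) = k at *
  generalize (‖z‖⁻¹ • z) = n at *
  generalize (‖z - xA‖⁻¹ • (z - xA)) = m at *
  -- The law of cosines `h4` in the triangle with vertices the origin, `xA` and `z`; this is what
  -- makes the Kepler problem separate in `σ±`.
  have h6 : (1 + k) * (sumPlus xA z)⁻¹ + (1 - k) * (sumMinus xA z)⁻¹ = ‖z‖⁻¹ := by
    field_simp
    simp only [sumPlus, sumMinus]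
    linear_combination -h4
  simp only [inner_add_left, inner_add_right, inner_smul_left, inner_smul_right, h1, h2, h5]
  simp only [conj_trivial, hk]
  have hw1 := weight_sq (μ * (sumPlus xA z)⁻¹)
  have hw2 := weight_sq (μ * (sumMinus xA z)⁻¹)
  linear_combination (1 + k) / 2 * hw1 + (1 - k) / 2 * hw2 + 2 * μ * h6

theorem HasDerivAt.norm_curve {γ : ℝ → E3} {v : E3} {ξ : ℝ} (hγ : HasDerivAt γ v ξ)
    (h0 : γ ξ ≠ 0) : HasDerivAt (fun s => ‖γ s‖) (inner ℝ (‖γ ξ‖⁻¹ • γ ξ) v) ξ := by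
  have h2 := hγ.norm_sq.sqrt (by have := norm_ne_zero_iff.2 h0; positivity)
  simp only [Real.sqrt_sq (norm_nonneg _)] at h2
  refine h2.congr_deriv ?_
  simp only [inner_smul_left, conj_trivial]
  have := norm_ne_zero_iff.2 h0
  field_simp

theorem hasDerivAt_eikonal {γ : ℝ → E3} {v : E3} {ξ : ℝ} (hγ : HasDerivAt γ v ξ)
    (hz : γ ξ ≠ 0) (hzA : γ ξ ≠ xA) (hp : sumPlus xA (γ ξ) ≠ 0) (hm : sumMinus xA (γ ξ) ≠ 0) :
    HasDerivAt (fun s => eikonal μ xA (γ s)) (inner ℝ (eikonalGrad μ xA (γ ξ)) v) ξ := by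
  have h1 := HasDerivAt.norm_curve hγ hz
  have h2 := HasDerivAt.norm_curve (hγ.sub_const xA) (sub_ne_zero.2 hzA)
  have h3 := (hasDerivAt_weightPrimitive μ hp).comp ξ ((h1.const_add ‖xA‖).add h2)
  have h4 := (hasDerivAt_weightPrimitive μ hm).comp ξ ((h1.const_add ‖xA‖).sub h2)
  refine ((h3.sub h4).mul_const (1 / 2)).congr_deriv ?_
  simp only [eikonalGrad, inner_add_left, inner_smul_left, conj_trivial]
  ring

end Eikonal

/-! ### The separating variables along the straight segment. -/

namespace Chord

variable (C : Chord)

/-- `sumPlus` along the segment -/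
def plus (ξ : ℝ) : ℝ := C.r 0 + C.r ξ + C.R * ξ

/-- `sumMinus` along the segment -/
def minus (ξ : ℝ) : ℝ := C.r 0 + C.r ξ - C.R * ξ

theorem abs_t_lt (ξ : ℝ) : |C.t ξ| < C.r ξ := by
  refine abs_lt_of_sq_lt_sq ?_ (C.r_pos ξ).le
  have := C.sq_r ξ
  have := C.b_pos
  nlinarith

theorem minus_pos (ξ : ℝ) : 0 < C.minus ξ := by
  have h1 := (abs_lt.1 (C.abs_t_lt 0)).1
  have h2 := (abs_lt.1 (C.abs_t_lt ξ)).2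
  simp only [minus, t] at *
  linarith

theorem exists_le_minus : ∃ k : ℝ, 0 < k ∧ ∀ ξ ∈ Set.Icc (0 : ℝ) 1, k ≤ C.minus ξ := by
  have hc : Continuous C.minus := by
    have := C.continuous_r
    unfold minus
    fun_prop
  obtain ⟨ξ₀, -, h⟩ := isCompact_Icc.exists_isMinOn (Set.nonempty_Icc.2 zero_le_one)
    hc.continuousOn (s := Set.Icc (0 : ℝ) 1)
  exact ⟨C.minus ξ₀, C.minus_pos ξ₀, fun ξ hξ => h hξ⟩

theorem minus_le_plus {ξ : ℝ} (hξ : 0 ≤ ξ) : C.minus ξ ≤ C.plus ξ := by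
  have := mul_nonneg C.R_pos.le hξ
  simp only [minus, plus]; linarith

theorem plus_pos {ξ : ℝ} (hξ : 0 ≤ ξ) : 0 < C.plus ξ :=
  (C.minus_pos ξ).trans_le (C.minus_le_plus hξ)

/-- The left side is the first order transverse momentum relative to the mean direction from `𝐱_A`;
the right side is the transverse part of the eikonal gradient relative to the same direction. Both
are coefficients of `(1 + γ)M h`, and their equality makes `p - ∇S` second order. -/
theorem deflection_identity {ξ : ℝ} (hξ : 0 < ξ) :
    C.R⁻¹ * (C.b ^ 2)⁻¹ * (ξ⁻¹ * (C.r ξ - C.r 0) - C.R * (C.t ξ * (C.r ξ)⁻¹)) =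
      ((C.plus ξ)⁻¹ - (C.minus ξ)⁻¹) * (C.r ξ)⁻¹ := by
  have h1 := C.minus_pos ξ
  have h2 := C.plus_pos hξ.le
  have h3 := C.r_pos ξ
  have h4 := C.sq_r ξ
  have h5 := C.sq_r 0
  have h6 := C.R_pos
  have h7 := C.b_pos
  have h8 : C.t 0 = C.t ξ - ξ * C.R := by simp [t]
  rw [h8] at h5
  field_simp
  simp only [plus, minus]
  generalize C.r ξ = r at *
  generalize C.r 0 = r0 at *
  generalize C.t ξ = t at *
  generalize C.b = b at *
  generalize C.R = R at *
  linear_combination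
    (-2 * r0 ^ 2 + ((r0 + r) ^ 2 - (R * ξ) ^ 2) + (b ^ 2 + (t - ξ * R) * t - r * r0)) * h4 +
    (-2 * (b ^ 2 + t ^ 2) + (b ^ 2 + (t - ξ * R) * t - r * r0)) * h5

theorem norm_pos_sub {ξ : ℝ} (hξ : 0 ≤ ξ) : ‖C.pos ξ - C.pos 0‖ = C.R * ξ := by
  have : C.pos ξ - C.pos 0 = (C.R * ξ) • C.e := by
    simp only [pos, t, zero_mul, add_zero, add_sub_add_left_eq_sub, ← sub_smul]
    congr 1; ring
  rw [this, norm_smul, C.norm_e, mul_one, Real.norm_eq_abs,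
    abs_of_nonneg (mul_nonneg C.R_pos.le hξ)]

end Chord

/-! ### Comparison of the momentum with the eikonal gradient. -/

namespace Chord.IsRay

variable {C : Chord} {g : PPNMetric} {c tA : ℝ} {x0 : ℝ → ℝ → ℝ} {x : ℝ → ℝ → E3}

theorem dist_sub (hr : C.IsRay g c tA x0 x) :
    UnifBigO (Set.Icc 0 1) 1 (fun p => ‖x p.1 p.2 - C.pos 0‖ - C.R * p.2) := by
  have h : UnifBigO (Set.Icc 0 1) 1
      (fun p => (x p.1 p.2 - C.pos 0) - (C.pos p.2 - C.pos 0)) :=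
    hr.space_sub.congr fun p => by abel
  refine h.norm_sub_norm.congr' ?_
  filter_upwards [eventually_mem_unif] with p hp
  rw [C.norm_pos_sub hp.1]

theorem sumPlus_sub (hr : C.IsRay g c tA x0 x) :
    UnifBigO (Set.Icc 0 1) 1 (fun p => sumPlus (C.pos 0) (x p.1 p.2) - C.plus p.2) :=
  (hr.radius_sub.add hr.dist_sub).congr fun p => by
    rw [sumPlus, plus, C.norm_pos_eq]; ring

theorem sumMinus_sub (hr : C.IsRay g c tA x0 x) :
    UnifBigO (Set.Icc 0 1) 1 (fun p => sumMinus (C.pos 0) (x p.1 p.2) - C.minus p.2) :=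
  (hr.radius_sub.sub hr.dist_sub).congr fun p => by
    rw [sumMinus, minus, C.norm_pos_eq]; ring

theorem inv_sums (hr : C.IsRay g c tA x0 x) :
    ∃ k : ℝ, 0 < k ∧ (∀ᶠ p in unif (Set.Icc 0 1), k ≤ sumPlus (C.pos 0) (x p.1 p.2)) ∧
      (∀ᶠ p in unif (Set.Icc 0 1), k ≤ sumMinus (C.pos 0) (x p.1 p.2)) ∧
      UnifBigO (Set.Icc 0 1) 1
        (fun p => (sumPlus (C.pos 0) (x p.1 p.2))⁻¹ - (C.plus p.2)⁻¹) ∧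
      UnifBigO (Set.Icc 0 1) 1
        (fun p => (sumMinus (C.pos 0) (x p.1 p.2))⁻¹ - (C.minus p.2)⁻¹) := by
  obtain ⟨k, hk, hm⟩ := C.exists_le_minus
  have hm' : ∀ᶠ p in unif (Set.Icc 0 1), k ≤ C.minus p.2 :=
    eventually_mem_unif.mono fun p hp => hm _ hp
  have hp' : ∀ᶠ p in unif (Set.Icc 0 1), k ≤ C.plus p.2 :=
    eventually_mem_unif.mono fun p hp => (hm _ hp).trans (C.minus_le_plus hp.1)
  have h1 := hr.sumPlus_sub.eventually_half_le hk hp'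
  have h2 := hr.sumMinus_sub.eventually_half_le hk hm'
  exact ⟨k / 2, half_pos hk, h1, h2, UnifBigO.inv_sub_inv (half_pos hk) hk hr.sumPlus_sub h1 hp',
    UnifBigO.inv_sub_inv (half_pos hk) hk hr.sumMinus_sub h2 hm'⟩

/-- the gradient of the eikonal function along the ray -/
def grad (C : Chord) (g : PPNMetric) (x : ℝ → ℝ → E3) (p : ℝ × ℝ) : E3 :=
  eikonalGrad ((1 + g.γ) * p.1) (C.pos 0) (x p.1 p.2)

theorem mass (g : PPNMetric) {s : Set ℝ} : UnifBigO s 1 (fun p => (1 + g.γ) * p.1) :=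
  (UnifBigO.const _).mul UnifBigO.fst

theorem weight_sub {s : Set ℝ} {z : ℝ × ℝ → ℝ} (hz : UnifBigO s 1 z) :
    UnifBigO s 2 (fun p => weight (z p) - (1 + 2 * z p)) := by
  have h2 : UnifBigO s 2 (fun p => z p * z p) := hz.mul hz
  have h3 : UnifBigO s 2 (fun p => z p * z p * z p) := h2.mul hz
  refine ((h3.add h3).add (h3.add h3)).sub (h2.add h2) |>.congr fun p => ?_
  rw [weight]; ring

theorem grad_coeffs (hr : C.IsRay g c tA x0 x) :
    UnifBigO (Set.Icc 0 1) 1 (fun p =>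
      (weight ((1 + g.γ) * p.1 * (sumPlus (C.pos 0) (x p.1 p.2))⁻¹) +
        weight ((1 + g.γ) * p.1 * (sumMinus (C.pos 0) (x p.1 p.2))⁻¹)) * (1 / 2) - 1) ∧
    UnifBigO (Set.Icc 0 1) 2 (fun p =>
      (weight ((1 + g.γ) * p.1 * (sumPlus (C.pos 0) (x p.1 p.2))⁻¹) -
        weight ((1 + g.γ) * p.1 * (sumMinus (C.pos 0) (x p.1 p.2))⁻¹)) * (1 / 2) -
        (1 + g.γ) * p.1 * ((C.plus p.2)⁻¹ - (C.minus p.2)⁻¹)) ∧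
    UnifBigO (Set.Icc 0 1) 4 (fun p => eikonalDefect ((1 + g.γ) * p.1) (C.pos 0) (x p.1 p.2)) := by
  obtain ⟨k, hk, hp, hm, hpi, hmi⟩ := hr.inv_sums
  have hzp : UnifBigO (Set.Icc 0 1) 1
      (fun p => (1 + g.γ) * p.1 * (sumPlus (C.pos 0) (x p.1 p.2))⁻¹) :=
    (mass g).mul (UnifBigO.inv hk hp)
  have hzm : UnifBigO (Set.Icc 0 1) 1
      (fun p => (1 + g.γ) * p.1 * (sumMinus (C.pos 0) (x p.1 p.2))⁻¹) :=
    (mass g).mul (UnifBigO.inv hk hm)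
  have hwp := weight_sub hzp
  have hwm := weight_sub hzm
  have hhalf := UnifBigO.const (s := Set.Icc 0 1) (1 / 2 : ℝ)
  refine ⟨?_, ?_, ?_⟩
  · refine ((((hwp.add hwm).of_le one_le_two).mul hhalf (k := 1)).add
      (hzp.add hzm)).congr fun p => by ring
  · have h1 : UnifBigO (Set.Icc 0 1) 2 (fun p => (1 + g.γ) * p.1 *
        ((sumPlus (C.pos 0) (x p.1 p.2))⁻¹ - (C.plus p.2)⁻¹)) := (mass g).mul hpi
    have h2 : UnifBigO (Set.Icc 0 1) 2 (fun p => (1 + g.γ) * p.1 *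
        ((sumMinus (C.pos 0) (x p.1 p.2))⁻¹ - (C.minus p.2)⁻¹)) := (mass g).mul hmi
    exact (((hwp.sub hwm).mul hhalf (k := 2)).add (h1.sub h2)).congr fun p => by ring
  · have hpoly : ∀ {z : ℝ × ℝ → ℝ}, UnifBigO (Set.Icc 0 1) 1 z → UnifBigO (Set.Icc 0 1) 4
        (fun p => z p ^ 4 * (20 - 16 * z p + 16 * z p ^ 2)) := by
      intro z hz
      have hz0 := hz.of_le (Nat.zero_le 1)
      have h2 : UnifBigO (Set.Icc 0 1) 2 (fun p => z p * z p) := hz.mul hz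
      have h4 : UnifBigO (Set.Icc 0 1) 4 (fun p => z p * z p * (z p * z p)) := h2.mul h2
      have h5 : UnifBigO (Set.Icc 0 1) 0 (fun p => 20 - 16 * z p + 16 * (z p * z p)) :=
        ((UnifBigO.const (20 : ℝ)).sub ((UnifBigO.const (16 : ℝ)).mul hz0 (k := 0))).add
          ((UnifBigO.const (16 : ℝ)).mul h2 (k := 0))
      exact (h4.mul h5 (k := 4)).congr fun p => by ring
    have hdir : ∀ v : ℝ × ℝ → E3, UnifBigO (Set.Icc 0 1) 0 (fun p => ‖v p‖⁻¹ • v p) := by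
      intro v
      refine UnifBigO.iff_bound.2 ⟨1, zero_le_one, Eventually.of_forall fun M ξ _ => ?_⟩
      rw [norm_smul, norm_inv, norm_norm, pow_zero, mul_one]
      exact inv_mul_le_one
    have hin := (hdir fun p => x p.1 p.2).inner (hdir fun p => x p.1 p.2 - C.pos 0) (k := 0)
    have h1 := UnifBigO.const (s := Set.Icc 0 1) (1 : ℝ)
    exact ((hpoly hzp).mul ((h1.add hin).mul hhalf (k := 0)) (k := 4)).add
      ((hpoly hzm).mul ((h1.sub hin).mul hhalf (k := 0)) (k := 4))

/-- the momentum normalized by the energy -/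
def unitMomentum (g : PPNMetric) (x0 : ℝ → ℝ → ℝ) (x : ℝ → ℝ → E3) (p : ℝ × ℝ) : E3 :=
  (energy g x0 x p.1)⁻¹ • momentum g x p

theorem eventually_energy (hr : C.IsRay g c tA x0 x) {s : Set ℝ} :
    ∀ᶠ p in unif s, C.R / 2 ≤ energy g x0 x p.1 :=
  hr.energy_sub.eventually_half_le C.R_pos (Eventually.of_forall fun _ => le_rfl)

theorem inv_energy_sub (hr : C.IsRay g c tA x0 x) {s : Set ℝ} :
    UnifBigO s 1 (fun p => (energy g x0 x p.1)⁻¹ - C.R⁻¹) :=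
  UnifBigO.inv_sub_inv (half_pos C.R_pos) C.R_pos hr.energy_sub hr.eventually_energy
    (Eventually.of_forall fun _ => le_rfl)

theorem unitMomentum_sub (hr : C.IsRay g c tA x0 x) :
    UnifBigO (Set.Icc 0 1) 1 (fun p => unitMomentum g x0 x p - C.e) := by
  have h1 := hr.B_sub.smul_sub_smul hr.velocity_sub (UnifBigO.const _) hr.bounded_velocity
  have h2 := hr.inv_energy_sub.smul_sub_smul h1 (UnifBigO.const _)
    (hr.bounded_B.smul hr.bounded_velocity)
  refine h2.congr fun p => ?_
  rw [one_smul, smul_smul C.R⁻¹, inv_mul_cancel₀ C.R_pos.ne', one_smul]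
  rfl

/-- The null condition after elimination of `dx⁰/dξ` through the conserved energy. -/
theorem norm_sq_unitMomentum (hr : C.IsRay g c tA x0 x) :
    ∀ᶠ p in unif (Set.Icc 0 1), ‖unitMomentum g x0 x p‖ ^ 2 =
      g.Binv p.1 ‖x p.1 p.2‖ / g.A p.1 ‖x p.1 p.2‖ := by
  filter_upwards [hr.geodesic', hr.energy_eq, hr.eventually_A, hr.eventually_energy,
    eventually_mem_unif] with p hg hE hA hEp hmem
  have h1 := hg.null p.2 hmem
  have hE0 : energy g x0 x p.1 ≠ 0 := ((half_pos C.R_pos).trans_le hEp).ne'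
  have hA0 : g.A p.1 ‖x p.1 p.2‖ ≠ 0 := by linarith
  rw [unitMomentum, momentum, norm_smul, norm_smul, mul_pow, mul_pow, Real.norm_eq_abs, sq_abs,
    Real.norm_eq_abs, sq_abs, eq_div_iff hA0]
  have h2 : (energy g x0 x p.1)⁻¹ * energy g x0 x p.1 = 1 := inv_mul_cancel₀ hE0
  rw [← hE] at h2 ⊢
  linear_combination (-(g.A p.1 ‖x p.1 p.2‖ * deriv (x0 p.1) p.2)⁻¹ ^ 2
      * g.Binv p.1 ‖x p.1 p.2‖ * g.A p.1 ‖x p.1 p.2‖) * h1 +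
    g.Binv p.1 ‖x p.1 p.2‖ * ((g.A p.1 ‖x p.1 p.2‖ * deriv (x0 p.1) p.2)⁻¹ *
      (g.A p.1 ‖x p.1 p.2‖ * deriv (x0 p.1) p.2) + 1) * h2

theorem transverse_unitMomentum (hr : C.IsRay g c tA x0 x) :
    UnifBigO (Set.Icc 0 1) 2 (fun p => C.proj (unitMomentum g x0 x p) -
      C.R⁻¹ • C.proj (deriv (x p.1) p.2)) := by
  have h1 : UnifBigO (Set.Icc 0 1) 1 (fun p => (energy g x0 x p.1)⁻¹ * g.Binv p.1 ‖x p.1 p.2‖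
      - C.R⁻¹ * 1) :=
    hr.inv_energy_sub.mul_sub_mul hr.B_sub (UnifBigO.const _) hr.bounded_B
  refine (h1.smul hr.proj_velocity (k := 2)).congr fun p => ?_
  simp only [unitMomentum, momentum, map_smul, smul_smul, sub_smul, mul_one]

theorem eventually_regular (hr : C.IsRay g c tA x0 x) :
    ∀ᶠ p in unif (Set.Ioo 0 1), x p.1 p.2 ≠ 0 ∧ x p.1 p.2 ≠ C.pos 0 ∧
      sumPlus (C.pos 0) (x p.1 p.2) ≠ 0 ∧ sumMinus (C.pos 0) (x p.1 p.2) ≠ 0 ∧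
      C.R / 2 ≤ ‖p.2⁻¹ • (x p.1 p.2 - C.pos 0)‖ := by
  obtain ⟨k, hk, hp, hm, -⟩ := hr.inv_sums
  have h1 : UnifBigO (Set.Ioo 0 1) 1 (fun p => ‖p.2⁻¹ • (x p.1 p.2 - C.pos 0)‖ - C.R) :=
    hr.chord_sub.norm_sub_norm.congr fun p => by
      rw [norm_smul _ C.e, C.norm_e, mul_one, Real.norm_eq_abs, abs_of_pos C.R_pos]
  have h2 := h1.eventually_half_le C.R_pos (Eventually.of_forall fun _ => le_rfl)
  have hle := unif_mono (s := Set.Ioo (0 : ℝ) 1) Set.Ioo_subset_Icc_self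
  filter_upwards [h2, hp.filter_mono hle, hm.filter_mono hle,
    hr.eventually_radius.filter_mono hle] with p h2 hp hm hrad
  refine ⟨norm_pos_iff.1 ((half_pos C.b_pos).trans_le hrad), ?_, (hk.trans_le hp).ne',
    (hk.trans_le hm).ne', h2⟩
  intro h0
  rw [h0, sub_self, smul_zero, norm_zero] at h2
  linarith [C.R_pos]

theorem inv_chord_sub (hr : C.IsRay g c tA x0 x) :
    UnifBigO (Set.Ioo 0 1) 1 (fun p => ‖p.2⁻¹ • (x p.1 p.2 - C.pos 0)‖⁻¹ - C.R⁻¹) := by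
  refine UnifBigO.inv_sub_inv (half_pos C.R_pos) C.R_pos ?_
    (hr.eventually_regular.mono fun _ h => h.2.2.2.2) (Eventually.of_forall fun _ => le_rfl)
  exact hr.chord_sub.norm_sub_norm.congr fun p => by
    rw [norm_smul _ C.e, C.norm_e, mul_one, Real.norm_eq_abs, abs_of_pos C.R_pos]

/-- Rescaling by `ξ⁻¹` replaces a vector that vanishes at `ξ = 0` by the mean velocity, whose length
stays near `R`. -/
theorem direction_eq {s : Set ℝ} (hs : s ⊆ Set.Ioi 0) : ∀ᶠ p in unif s,
    ‖x p.1 p.2 - C.pos 0‖⁻¹ • (x p.1 p.2 - C.pos 0) =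
      ‖p.2⁻¹ • (x p.1 p.2 - C.pos 0)‖⁻¹ • p.2⁻¹ • (x p.1 p.2 - C.pos 0) := by
  filter_upwards [eventually_mem_unif] with p hp
  have h0 : (0 : ℝ) < p.2 := hs hp
  rw [norm_smul, norm_inv, Real.norm_eq_abs, abs_of_pos h0, smul_smul, mul_inv, inv_inv]
  congr 1
  field_simp

theorem direction_sub (hr : C.IsRay g c tA x0 x) :
    UnifBigO (Set.Ioo 0 1) 1
      (fun p => ‖x p.1 p.2 - C.pos 0‖⁻¹ • (x p.1 p.2 - C.pos 0) - C.e) := by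
  have h1 := hr.inv_chord_sub.smul_sub_smul hr.chord_sub (UnifBigO.const _)
    (hr.chord_sub.bounded_of_sub (UnifBigO.const _))
  refine h1.congr' ?_
  filter_upwards [direction_eq (C := C) (x := x) (s := Set.Ioo 0 1) fun _ h => h.1] with p hp
  rw [hp, smul_smul C.R⁻¹, inv_mul_cancel₀ C.R_pos.ne', one_smul]

theorem bounded_sums_inv {s : Set ℝ} (hs : s ⊆ Set.Icc 0 1) :
    UnifBigO s 0 (fun p => (C.plus p.2)⁻¹ - (C.minus p.2)⁻¹) := by
  obtain ⟨k, hk, hm⟩ := C.exists_le_minus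
  exact (UnifBigO.inv hk (eventually_mem_unif.mono fun p hp =>
      (hm _ (hs hp)).trans (C.minus_le_plus (hs hp).1))).sub
    (UnifBigO.inv hk (eventually_mem_unif.mono fun p hp => hm _ (hs hp)))

theorem transverse_grad (hr : C.IsRay g c tA x0 x) :
    UnifBigO (Set.Ioo 0 1) 2 (fun p => C.proj (grad C g x p) -
      (C.R⁻¹ • C.proj (p.2⁻¹ • (x p.1 p.2 - C.pos 0)) +
        ((1 + g.γ) * p.1 * ((C.plus p.2)⁻¹ - (C.minus p.2)⁻¹) * (C.r p.2)⁻¹) • C.h)) := by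
  obtain ⟨h1, h2, -⟩ := hr.grad_coeffs
  have hI : Set.Ioo (0 : ℝ) 1 ⊆ Set.Icc 0 1 := Set.Ioo_subset_Icc_self
  have hy : UnifBigO (Set.Ioo 0 1) 1 (fun p => C.proj (p.2⁻¹ • (x p.1 p.2 - C.pos 0))) :=
    (hr.chord_sub.clm C.proj).congr fun p => by simp [C.proj_e]
  have hc := (h1.mono_set hI).mul_sub_mul hr.inv_chord_sub (UnifBigO.const _)
    (hr.inv_chord_sub.bounded_of_sub (UnifBigO.const _))
  have hA := hc.smul hy (k := 2)
  have hz : UnifBigO (Set.Icc 0 1) 1 (fun p => C.proj (x p.1 p.2) - C.h) :=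
    (hr.space_sub.clm C.proj).congr fun p => by rw [map_sub, C.proj_pos]
  have hz' := (hr.inv_radius_sub.smul_sub_smul hz bounded_inv_r
    (hz.bounded_of_sub (UnifBigO.const _))).mono_set hI
  have hβ : UnifBigO (Set.Ioo 0 1) 1
      (fun p => (1 + g.γ) * p.1 * ((C.plus p.2)⁻¹ - (C.minus p.2)⁻¹)) :=
    (mass g).mul (bounded_sums_inv hI)
  have hB := ((h2.mono_set hI).smul (hz'.bounded_of_sub
    (bounded_inv_r.smul (UnifBigO.const C.h) (k := 0))) (k := 2)).add (hβ.smul hz' (k := 2))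
  refine (hA.add hB).congr' ?_
  filter_upwards [direction_eq (C := C) (x := x) (s := Set.Ioo 0 1) fun _ h => h.1] with p hp
  rw [grad, eikonalGrad, hp]
  simp only [map_add, map_smul]
  module

theorem transverse_defect (hr : C.IsRay g c tA x0 x) :
    UnifBigO (Set.Ioo 0 1) 2 (fun p => C.proj (unitMomentum g x0 x p - grad C g x p)) := by
  have hI : Set.Ioo (0 : ℝ) 1 ⊆ Set.Icc 0 1 := Set.Ioo_subset_Icc_self
  have h1 := (hr.transverse_unitMomentum.mono_set hI).sub hr.transverse_grad
  have hR := UnifBigO.const (s := Set.Ioo 0 1) C.R⁻¹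
  have h2 := hR.smul ((hr.transverse_velocity.mono_set hI).sub hr.transverse_chord) (k := 2)
  refine (h1.add h2).congr' ?_
  filter_upwards [eventually_mem_unif] with p hp
  have hid := C.deflection_identity hp.1
  have : ((1 + g.γ) * p.1 * ((C.plus p.2)⁻¹ - (C.minus p.2)⁻¹) * (C.r p.2)⁻¹) • C.h =
      ((1 + g.γ) * p.1 * (C.R⁻¹ * (C.b ^ 2)⁻¹ *
        (p.2⁻¹ * (C.r p.2 - C.r 0) - C.R * (C.t p.2 * (C.r p.2)⁻¹)))) • C.h := by
    rw [hid]; congr 1; ring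
  rw [this, map_sub]
  module

theorem grad_sub (hr : C.IsRay g c tA x0 x) :
    UnifBigO (Set.Ioo 0 1) 1 (fun p => grad C g x p - C.e) := by
  obtain ⟨h1, h2, -⟩ := hr.grad_coeffs
  have hI : Set.Ioo (0 : ℝ) 1 ⊆ Set.Icc 0 1 := Set.Ioo_subset_Icc_self
  have hA := (h1.mono_set hI).smul_sub_smul hr.direction_sub (UnifBigO.const _)
    (hr.direction_sub.bounded_of_sub (UnifBigO.const _))
  have hβ : UnifBigO (Set.Ioo 0 1) 1
      (fun p => (1 + g.γ) * p.1 * ((C.plus p.2)⁻¹ - (C.minus p.2)⁻¹)) :=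
    (mass g).mul (bounded_sums_inv hI)
  have hB := (((h2.mono_set hI).of_le one_le_two).add hβ).smul
    ((hr.bounded_inv_radius.smul hr.bounded_space (k := 0)).mono_set hI) (k := 1)
  refine (hA.add hB).congr fun p => ?_
  rw [grad, eikonalGrad]
  module

theorem norm_sq_grad (hr : C.IsRay g c tA x0 x) :
    UnifBigO (Set.Ioo 0 1) 4 (fun p => ‖grad C g x p‖ ^ 2 -
      (1 + 2 * (1 + g.γ) * (p.1 / ‖x p.1 p.2‖))) := by
  refine (hr.grad_coeffs.2.2.mono_set Set.Ioo_subset_Icc_self).congr' ?_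
  filter_upwards [hr.eventually_regular] with p ⟨h1, h2, h3, h4, _⟩
  rw [grad, norm_sq_eikonalGrad h1 h2 h3 h4]
  ring

theorem norm_sq_sub_norm_sq (hr : C.IsRay g c tA x0 x) :
    UnifBigO (Set.Ioo 0 1) 4 (fun p => ‖unitMomentum g x0 x p‖ ^ 2 - ‖grad C g x p‖ ^ 2 -
      (g.index₂ * (p.1 / ‖x p.1 p.2‖) ^ 2 + g.index₃ * (p.1 / ‖x p.1 p.2‖) ^ 3)) := by
  have hI : Set.Ioo (0 : ℝ) 1 ⊆ Set.Icc 0 1 := Set.Ioo_subset_Icc_self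
  refine ((hr.index_sub.mono_set hI).sub hr.norm_sq_grad).congr' ?_
  filter_upwards [hr.norm_sq_unitMomentum.filter_mono (unif_mono hI)] with p hp
  rw [hp]
  ring

theorem potential_terms (hr : C.IsRay g c tA x0 x) :
    UnifBigO (Set.Icc 0 1) 2 (fun p => g.index₂ * (p.1 / ‖x p.1 p.2‖) ^ 2
      + g.index₃ * (p.1 / ‖x p.1 p.2‖) ^ 3) := by
  have hu := hr.potential
  have h2 : UnifBigO (Set.Icc 0 1) 2 (fun p => p.1 / ‖x p.1 p.2‖ * (p.1 / ‖x p.1 p.2‖)) :=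
    hu.mul hu
  have h3 := h2.mul hu (k := 2)
  exact (((UnifBigO.const g.index₂).mul h2 (k := 2)).add
    ((UnifBigO.const g.index₃).mul h3 (k := 2))).congr fun p => by ring

/-- The momentum along the ray is the gradient of the eikonal function, up to terms of second
order. -/
theorem defect (hr : C.IsRay g c tA x0 x) :
    UnifBigO (Set.Ioo 0 1) 2 (fun p => unitMomentum g x0 x p - grad C g x p) := by
  have hI : Set.Ioo (0 : ℝ) 1 ⊆ Set.Icc 0 1 := Set.Ioo_subset_Icc_self
  have hp := hr.unitMomentum_sub.mono_set hI
  have hsum : UnifBigO (Set.Ioo 0 1) 1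
      (fun p => (unitMomentum g x0 x p + grad C g x p) - (2 : ℝ) • C.e) :=
    (hp.add hr.grad_sub).congr fun p => by module
  have h1 : UnifBigO (Set.Ioo 0 1) 2
      (fun p => ‖unitMomentum g x0 x p‖ ^ 2 - ‖grad C g x p‖ ^ 2) :=
    ((hr.norm_sq_sub_norm_sq.of_le (j := 2) (by norm_num)).add
      (hr.potential_terms.mono_set hI)).congr fun p => by ring
  have hT := hr.transverse_defect
  -- The longitudinal part follows from `(p - q)·(p + q) = |p|² - |q|² = O(M²)`: the transverse part
  -- of `p - q` is already second order, and `p + q` has longitudinal component close to `2`.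
  have h2 : UnifBigO (Set.Ioo 0 1) 2 (fun p =>
      inner ℝ (C.proj (unitMomentum g x0 x p - grad C g x p))
        (unitMomentum g x0 x p + grad C g x p)) :=
    hT.inner (hsum.bounded_of_sub (UnifBigO.const _))
  have h3 : UnifBigO (Set.Ioo 0 1) 1
      (fun p => inner ℝ C.e (unitMomentum g x0 x p + grad C g x p) - 2) :=
    (hsum.clm (innerSL ℝ C.e)).congr fun p => by
      simp [inner_sub_right, inner_smul_right, C.norm_e]
  have h4 := h3.eventually_half_le two_pos (Eventually.of_forall fun _ => le_rfl)
  have h5 := (h1.sub h2).mul (UnifBigO.inv (half_pos two_pos) h4) (k := 2)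
  have h6 : UnifBigO (Set.Ioo 0 1) 2
      (fun p => inner ℝ C.e (unitMomentum g x0 x p - grad C g x p)) := by
    refine h5.congr' ?_
    filter_upwards [h4] with p hp
    have hne : inner ℝ C.e (unitMomentum g x0 x p + grad C g x p) ≠ 0 := by linarith
    rw [← div_eq_mul_inv, div_eq_iff hne, sub_eq_iff_eq_add]
    have e1 : inner ℝ (unitMomentum g x0 x p - grad C g x p)
        (unitMomentum g x0 x p + grad C g x p) =
          ‖unitMomentum g x0 x p‖ ^ 2 - ‖grad C g x p‖ ^ 2 := by
      simp only [inner_sub_left, inner_add_right, real_inner_self_eq_norm_sq]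
      rw [real_inner_comm (grad C g x p)]
      ring
    rw [← e1]
    conv_lhs => rw [C.eq_proj_add (unitMomentum g x0 x p - grad C g x p)]
    rw [inner_add_left, inner_smul_left, conj_trivial]
    ring
  refine (hT.add (h6.smul (UnifBigO.const C.e) (k := 2))).congr fun p => ?_
  exact (C.eq_proj_add _).symm

end Chord.IsRay

/-! ### Closed form of the third order integrals along the segment. -/

namespace Chord

variable (C : Chord) (g : PPNMetric)

/-- the slope of the affine function of the abscissa that interpolates the distance to the origin
between the ends of the segment -/
def chordSlope : ℝ := (C.r 1 - C.r 0) * C.R⁻¹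

/-- the value at the foot of the perpendicular of that affine function -/
def chordHeight : ℝ := C.r 0 - C.chordSlope * C.s₁

/-- primitive of the terms of third order due to the second and third order terms of the
refractive index -/
def thirdPrimitive (ξ : ℝ) : ℝ :=
  (g.index₂ * (1 + g.γ) + g.index₃) / 2 * (C.b ^ 2)⁻¹ * (C.t ξ * (C.r ξ)⁻¹) -
    g.index₂ * (1 + g.γ) *
      (C.chordHeight * (1 / 2 * (C.b ^ 2)⁻¹ * (C.t ξ * ((C.r ξ)⁻¹ * (C.r ξ)⁻¹)) +
        1 / 2 * (C.b ^ 2)⁻¹ * (Real.arctan (C.t ξ / C.b) * C.b⁻¹)) -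
        C.chordSlope * (1 / 2) * ((C.r ξ)⁻¹ * (C.r ξ)⁻¹))

theorem hasDerivAt_arctan (ξ : ℝ) :
    HasDerivAt (fun ξ => Real.arctan (C.t ξ / C.b) * C.b⁻¹)
      (C.R * ((C.r ξ)⁻¹ * (C.r ξ)⁻¹)) ξ := by
  have h := (((C.hasDerivAt_t ξ).div_const C.b).arctan).mul_const C.b⁻¹
  refine h.congr_deriv ?_
  have h1 := C.r_pos ξ
  have h2 := C.sq_r ξ
  have h3 := C.b_pos
  have h4 : 1 + (C.t ξ / C.b) ^ 2 = C.r ξ ^ 2 / C.b ^ 2 := by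
    rw [h2]; field_simp
  rw [h4]
  field_simp

theorem hasDerivAt_inv_r_sq (ξ : ℝ) :
    HasDerivAt (fun ξ => (C.r ξ)⁻¹ * (C.r ξ)⁻¹)
      (-2 * C.R * C.t ξ * ((C.r ξ)⁻¹ * (C.r ξ)⁻¹ * ((C.r ξ)⁻¹ * (C.r ξ)⁻¹))) ξ := by
  have h := (C.hasDerivAt_r ξ).fun_inv (C.r_pos ξ).ne'
  refine (h.mul h).congr_deriv ?_
  have h1 := C.r_pos ξ
  field_simp
  ring

/-- The numerator over `r⁴` is affine in the abscissa `t` (`e4`), so the integrand splits into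
`1/r³`, `1/r⁴` and `t/r⁴`. Their primitives involve `t/r`, then `t/r²` with an arctangent, then
`1/r²`. -/
theorem hasDerivAt_thirdPrimitive (ξ : ℝ) :
    HasDerivAt (C.thirdPrimitive g)
      (C.R * ((g.index₂ * (1 + g.γ) + g.index₃) / 2 * ((C.r ξ)⁻¹ * (C.r ξ)⁻¹ * (C.r ξ)⁻¹) -
        g.index₂ * (1 + g.γ) * (C.r 0 + ξ * (C.r 1 - C.r 0)) *
          ((C.r ξ)⁻¹ * (C.r ξ)⁻¹ * ((C.r ξ)⁻¹ * (C.r ξ)⁻¹)))) ξ := by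
  have h1 := C.hasDerivAt_t_mul_inv_r ξ
  have h2 := C.hasDerivAt_arctan ξ
  have h3 := C.hasDerivAt_inv_r_sq ξ
  have h4 := (C.hasDerivAt_t ξ).mul h3
  have h := (h1.const_mul ((g.index₂ * (1 + g.γ) + g.index₃) / 2 * (C.b ^ 2)⁻¹)).sub
    ((((((h4.const_mul (1 / 2 * (C.b ^ 2)⁻¹)).add (h2.const_mul (1 / 2 * (C.b ^ 2)⁻¹))).const_mul
      C.chordHeight)).sub (h3.const_mul (C.chordSlope * (1 / 2)))).const_mul
        (g.index₂ * (1 + g.γ)))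
  refine HasDerivAt.congr_deriv (f := C.thirdPrimitive g) h ?_
  have e1 := C.sq_r ξ
  have e2 := C.r_pos ξ
  have e3 := C.b_pos
  have e4 : C.r 0 + ξ * (C.r 1 - C.r 0) = C.chordHeight + C.chordSlope * C.t ξ := by
    have := C.R_pos
    simp only [chordHeight, chordSlope, t]
    field_simp
    ring
  rw [e4]
  field_simp
  linear_combination (-2 * g.index₂ * (1 + g.γ) * C.R * C.chordHeight) * e1

end Chord

/-! ### Travel time minus eikonal function. -/

namespace Chord.IsRay

variable {C : Chord} {g : PPNMetric} {c tA : ℝ} {x0 : ℝ → ℝ → ℝ} {x : ℝ → ℝ → E3}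

/-- `Λ` such that `d𝐱/dξ = Λ • unitMomentum` -/
def rate (g : PPNMetric) (x0 : ℝ → ℝ → ℝ) (x : ℝ → ℝ → E3) (p : ℝ × ℝ) : ℝ :=
  energy g x0 x p.1 * (g.Binv p.1 ‖x p.1 p.2‖)⁻¹

theorem rate_sub (hr : C.IsRay g c tA x0 x) :
    UnifBigO (Set.Icc 0 1) 1 (fun p => rate g x0 x p - C.R) :=
  (hr.energy_sub.mul_sub_mul hr.inv_B_sub (UnifBigO.const _) hr.bounded_inv_B).congr
    fun p => by rw [mul_one]; rfl

theorem rate_smul (hr : C.IsRay g c tA x0 x) :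
    ∀ᶠ p in unif (Set.Icc 0 1), deriv (x p.1) p.2 = rate g x0 x p • unitMomentum g x0 x p := by
  filter_upwards [hr.eventually_B, hr.eventually_energy] with p hB hE
  have h1 : g.Binv p.1 ‖x p.1 p.2‖ ≠ 0 := by linarith
  have h2 : energy g x0 x p.1 ≠ 0 := ((half_pos C.R_pos).trans_le hE).ne'
  rw [rate, unitMomentum, momentum, smul_smul, smul_smul]
  rw [show energy g x0 x p.1 * (g.Binv p.1 ‖x p.1 p.2‖)⁻¹ * (energy g x0 x p.1)⁻¹ *
    g.Binv p.1 ‖x p.1 p.2‖ = 1 by field_simp, one_smul]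

theorem time_velocity_eq (hr : C.IsRay g c tA x0 x) :
    ∀ᶠ p in unif (Set.Icc 0 1), deriv (x0 p.1) p.2 =
      rate g x0 x p * ‖unitMomentum g x0 x p‖ ^ 2 := by
  filter_upwards [hr.eventually_A, hr.eventually_B, hr.energy_eq, hr.norm_sq_unitMomentum]
    with p hA hB hE hN
  have h1 : g.Binv p.1 ‖x p.1 p.2‖ ≠ 0 := by linarith
  have h2 : g.A p.1 ‖x p.1 p.2‖ ≠ 0 := by linarith
  rw [hN, rate, ← hE]
  field_simp

/-- The square of the transverse part is of second order, so the longitudinal part is half the first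
order term of the squared index. -/
theorem longitudinal_momentum (hr : C.IsRay g c tA x0 x) :
    UnifBigO (Set.Icc 0 1) 2 (fun p => inner ℝ C.e (unitMomentum g x0 x p) - 1 -
      (1 + g.γ) * p.1 * (C.r p.2)⁻¹) := by
  have hT : UnifBigO (Set.Icc 0 1) 1 (fun p => C.proj (unitMomentum g x0 x p)) :=
    (hr.unitMomentum_sub.clm C.proj).congr fun p => by simp [C.proj_e]
  have hT2 : UnifBigO (Set.Icc 0 1) 2 (fun p => inner ℝ (C.proj (unitMomentum g x0 x p))
      (C.proj (unitMomentum g x0 x p))) := hT.inner hT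
  have hL : UnifBigO (Set.Icc 0 1) 1 (fun p => inner ℝ C.e (unitMomentum g x0 x p) - 1) :=
    (hr.unitMomentum_sub.clm (innerSL ℝ C.e)).congr fun p => by
      simp [inner_sub_right, C.norm_e]
  have hL2 : UnifBigO (Set.Icc 0 1) 2 (fun p => (inner ℝ C.e (unitMomentum g x0 x p) - 1) *
      (inner ℝ C.e (unitMomentum g x0 x p) - 1)) := hL.mul hL
  have hi : UnifBigO (Set.Icc 0 1) 2
      (fun p => (1 + g.γ) * p.1 * (‖x p.1 p.2‖⁻¹ - (C.r p.2)⁻¹)) := (mass g).mul hr.inv_radius_sub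
  have hN := (hr.index_sub.of_le (j := 2) (by norm_num)).add hr.potential_terms
  have hh := UnifBigO.const (s := Set.Icc 0 1) (1 / 2 : ℝ)
  refine (((hN.sub hT2).sub hL2).mul hh (k := 2) |>.add hi).congr' ?_
  filter_upwards [hr.norm_sq_unitMomentum] with p hp
  have e1 : ‖unitMomentum g x0 x p‖ ^ 2 = inner ℝ (C.proj (unitMomentum g x0 x p))
      (C.proj (unitMomentum g x0 x p)) + inner ℝ C.e (unitMomentum g x0 x p) ^ 2 := by
    rw [← real_inner_self_eq_norm_sq]
    conv_lhs => rw [C.eq_proj_add (unitMomentum g x0 x p)]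
    simp only [inner_add_left, inner_add_right, inner_smul_left, inner_smul_right, C.inner_e_e,
      C.inner_e_proj, conj_trivial, real_inner_comm C.e (C.proj _)]
    ring
  rw [← hp, e1]
  ring

/-- Project `d𝐱/dξ = Λp` on `e` and drop the product of two first order terms. No choice of affine
parameter is made: `Λ` is expressed through the unknown longitudinal velocity. -/
theorem rate_expansion (hr : C.IsRay g c tA x0 x) :
    UnifBigO (Set.Icc 0 1) 2 (fun p => rate g x0 x p - C.R -
      (inner ℝ C.e (deriv (x p.1) p.2 - C.R • C.e) -
        C.R * ((1 + g.γ) * p.1 * (C.r p.2)⁻¹))) := by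
  have hL : UnifBigO (Set.Icc 0 1) 1 (fun p => inner ℝ C.e (unitMomentum g x0 x p) - 1) :=
    (hr.unitMomentum_sub.clm (innerSL ℝ C.e)).congr fun p => by
      simp [inner_sub_right, C.norm_e]
  have h1 : UnifBigO (Set.Icc 0 1) 2 (fun p => (rate g x0 x p - C.R) *
    (inner ℝ C.e (unitMomentum g x0 x p) - 1)) := hr.rate_sub.mul hL
  have h2 := (UnifBigO.const (s := Set.Icc 0 1) C.R).mul hr.longitudinal_momentum (k := 2)
  refine (h1.add h2).neg.congr' ?_
  filter_upwards [hr.rate_smul] with p hp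
  rw [hp, inner_sub_right, inner_smul_right, inner_smul_right, C.inner_e_e]
  ring

/-- first order variation of `r⁻²` along the ray -/
def varInvSq (C : Chord) (g : PPNMetric) (x : ℝ → ℝ → E3) (p : ℝ × ℝ) : ℝ :=
  -2 * (C.t p.2 * inner ℝ C.e (x p.1 p.2 - C.pos p.2) +
    (1 + g.γ) * p.1 * (p.2 * (C.r 1 - C.r 0) - (C.r p.2 - C.r 0))) *
      ((C.r p.2)⁻¹ * (C.r p.2)⁻¹ * ((C.r p.2)⁻¹ * (C.r p.2)⁻¹))

/-- The transverse displacement is known explicitly at first order; only the longitudinal one is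
left unevaluated. -/
theorem inner_pos_sub (hr : C.IsRay g c tA x0 x) :
    UnifBigO (Set.Icc 0 1) 2 (fun p => inner ℝ (C.pos p.2) (x p.1 p.2 - C.pos p.2) -
      (C.t p.2 * inner ℝ C.e (x p.1 p.2 - C.pos p.2) +
        (1 + g.γ) * p.1 * (p.2 * (C.r 1 - C.r 0) - (C.r p.2 - C.r 0)))) := by
  refine (hr.transverse_position.clm (innerSL ℝ C.h)).congr fun p => ?_
  have h1 : inner ℝ C.h (C.proj (x p.1 p.2) - C.h) = inner ℝ C.h (x p.1 p.2 - C.pos p.2) := by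
    rw [← C.inner_h_proj (x p.1 p.2 - C.pos p.2), map_sub, C.proj_pos]
  have h2 := C.b_pos
  rw [innerSL_apply_apply, inner_sub_right, h1, inner_smul_right, C.inner_h_h]
  conv_rhs => rw [show inner ℝ (C.pos p.2) (x p.1 p.2 - C.pos p.2) =
    inner ℝ C.h (x p.1 p.2 - C.pos p.2) + C.t p.2 * inner ℝ C.e (x p.1 p.2 - C.pos p.2) by
      conv_lhs => rw [Chord.pos, inner_add_left, inner_smul_left, conj_trivial]
      rfl]
  field_simp
  ring

theorem bounded_inv_r_sq {s : Set ℝ} :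
    UnifBigO s 0 (fun p => (C.r p.2)⁻¹ * (C.r p.2)⁻¹) :=
  bounded_inv_r.mul bounded_inv_r

theorem inv_sq_sub (hr : C.IsRay g c tA x0 x) :
    UnifBigO (Set.Icc 0 1) 1
      (fun p => ‖x p.1 p.2‖⁻¹ * ‖x p.1 p.2‖⁻¹ - (C.r p.2)⁻¹ * (C.r p.2)⁻¹) :=
  hr.inv_radius_sub.mul_sub_mul hr.inv_radius_sub bounded_inv_r hr.bounded_inv_radius

theorem inv_sq_expansion (hr : C.IsRay g c tA x0 x) :
    UnifBigO (Set.Icc 0 1) 2 (fun p => ‖x p.1 p.2‖⁻¹ * ‖x p.1 p.2‖⁻¹ -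
      (C.r p.2)⁻¹ * (C.r p.2)⁻¹ - varInvSq C g x p) := by
  have hsq : UnifBigO (Set.Icc 0 1) 2
      (fun p => inner ℝ (x p.1 p.2 - C.pos p.2) (x p.1 p.2 - C.pos p.2)) :=
    hr.space_sub.inner hr.space_sub
  have h0 := hr.inner_pos_sub
  have h1 := ((h0.add h0).add hsq).mul
    ((bounded_inv_r_sq (C := C)).mul (bounded_inv_r_sq (C := C)) (k := 0)) (k := 2)
  have hd : UnifBigO (Set.Icc 0 1) 1
      (fun p => ‖x p.1 p.2‖ * ‖x p.1 p.2‖ - C.r p.2 * C.r p.2) :=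
    hr.radius_sub.mul_sub_mul hr.radius_sub bounded_r hr.bounded_space.norm
  have h2 : UnifBigO (Set.Icc 0 1) 2 (fun p =>
      (‖x p.1 p.2‖ * ‖x p.1 p.2‖ - C.r p.2 * C.r p.2) *
      (‖x p.1 p.2‖⁻¹ * ‖x p.1 p.2‖⁻¹ - (C.r p.2)⁻¹ * (C.r p.2)⁻¹) *
      ((C.r p.2)⁻¹ * (C.r p.2)⁻¹)) := (hd.mul hr.inv_sq_sub (k := 2)).mul bounded_inv_r_sq
  refine (h1.add h2).neg.congr' ?_
  filter_upwards [hr.eventually_radius] with p hp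
  have e1 : ‖x p.1 p.2‖ ≠ 0 := ((half_pos C.b_pos).trans_le hp).ne'
  have e2 := (C.r_pos p.2).ne'
  have e3 : ‖x p.1 p.2‖ ^ 2 = C.r p.2 ^ 2 + 2 * inner ℝ (C.pos p.2) (x p.1 p.2 - C.pos p.2) +
      inner ℝ (x p.1 p.2 - C.pos p.2) (x p.1 p.2 - C.pos p.2) := by
    rw [real_inner_self_eq_norm_sq, ← C.norm_pos_eq, ← norm_add_sq_real]
    congr 2; abel
  rw [varInvSq]
  generalize inner ℝ (x p.1 p.2 - C.pos p.2) (x p.1 p.2 - C.pos p.2) = k at *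
  field_simp
  linear_combination (‖x p.1 p.2‖ ^ 2) * e3

theorem rate_mul_inv_sq (hr : C.IsRay g c tA x0 x) :
    UnifBigO (Set.Icc 0 1) 2 (fun p => rate g x0 x p * (‖x p.1 p.2‖⁻¹ * ‖x p.1 p.2‖⁻¹) -
      (C.R * ((C.r p.2)⁻¹ * (C.r p.2)⁻¹) +
        (inner ℝ C.e (deriv (x p.1) p.2 - C.R • C.e) -
          C.R * ((1 + g.γ) * p.1 * (C.r p.2)⁻¹)) * ((C.r p.2)⁻¹ * (C.r p.2)⁻¹) +
        C.R * varInvSq C g x p)) := by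
  have h1 : UnifBigO (Set.Icc 0 1) 2 (fun p => (rate g x0 x p - C.R) *
    (‖x p.1 p.2‖⁻¹ * ‖x p.1 p.2‖⁻¹ - (C.r p.2)⁻¹ * (C.r p.2)⁻¹)) := hr.rate_sub.mul hr.inv_sq_sub
  have h2 := hr.rate_expansion.mul (bounded_inv_r_sq (C := C)) (k := 2)
  have h3 := (UnifBigO.const (s := Set.Icc 0 1) C.R).mul hr.inv_sq_expansion (k := 2)
  exact ((h1.add h2).add h3).congr fun p => by ring

theorem rate_mul_inv_cube (hr : C.IsRay g c tA x0 x) :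
    UnifBigO (Set.Icc 0 1) 1 (fun p => rate g x0 x p *
      (‖x p.1 p.2‖⁻¹ * ‖x p.1 p.2‖⁻¹ * ‖x p.1 p.2‖⁻¹) -
        C.R * ((C.r p.2)⁻¹ * (C.r p.2)⁻¹ * (C.r p.2)⁻¹)) :=
  hr.rate_sub.mul_sub_mul
    (hr.inv_sq_sub.mul_sub_mul hr.inv_radius_sub bounded_inv_r_sq hr.bounded_inv_radius)
    (UnifBigO.const _) ((hr.bounded_inv_radius.mul hr.bounded_inv_radius (k := 0)).mul
      hr.bounded_inv_radius)

/-- time minus eikonal function, along the ray -/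
def timeDefect (C : Chord) (g : PPNMetric) (x0 : ℝ → ℝ → ℝ) (x : ℝ → ℝ → E3) (p : ℝ × ℝ) : ℝ :=
  x0 p.1 p.2 - eikonal ((1 + g.γ) * p.1) (C.pos 0) (x p.1 p.2)

/-- the derivative of `timeDefect` -/
def timeDefect' (C : Chord) (g : PPNMetric) (x0 : ℝ → ℝ → ℝ) (x : ℝ → ℝ → E3)
    (p : ℝ × ℝ) : ℝ :=
  deriv (x0 p.1) p.2 - inner ℝ (grad C g x p) (deriv (x p.1) p.2)

theorem hasDerivAt_timeDefect (hr : C.IsRay g c tA x0 x) :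
    ∀ᶠ p in unif (Set.Ioo 0 1), HasDerivAt (fun ξ => timeDefect C g x0 x (p.1, ξ))
      (timeDefect' C g x0 x p) p.2 := by
  have hle := unif_mono (s := Set.Ioo (0 : ℝ) 1) Set.Ioo_subset_Icc_self
  filter_upwards [hr.hasDerivAt_space.filter_mono hle, hr.hasDerivAt_time.filter_mono hle,
    hr.eventually_regular] with p h1 h2 ⟨h3, h4, h5, h6, _⟩
  have h7 := hasDerivAt_eikonal (μ := (1 + g.γ) * p.1) h1 h3 h4 h5 h6
  unfold timeDefect timeDefect' grad
  exact HasDerivAt.fun_sub h2 h7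

theorem continuousOn_timeDefect (hr : C.IsRay g c tA x0 x) :
    ∀ᶠ M in 𝓝[>] (0 : ℝ), ContinuousOn (fun ξ => timeDefect C g x0 x (M, ξ)) (Set.Icc 0 1) := by
  obtain ⟨k, hk, hp, hm, -⟩ := hr.inv_sums
  filter_upwards [eventually_unif_iff.1 hr.hasDerivAt_space,
    eventually_unif_iff.1 hr.hasDerivAt_time, eventually_unif_iff.1 hp,
    eventually_unif_iff.1 hm] with M h1 h2 h3 h4 ξ hξ
  have c1 : ContinuousAt (x M) ξ := (h1 ξ hξ).continuousAt
  have c2 : ContinuousAt (x0 M) ξ := (h2 ξ hξ).continuousAt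
  have c3 := (hasDerivAt_weightPrimitive ((1 + g.γ) * M) (hk.trans_le (h3 ξ hξ)).ne').continuousAt
  have c4 := (hasDerivAt_weightPrimitive ((1 + g.γ) * M) (hk.trans_le (h4 ξ hξ)).ne').continuousAt
  have c5 : ContinuousAt (fun s => sumPlus (C.pos 0) (x M s)) ξ := by
    unfold sumPlus; fun_prop
  have c6 : ContinuousAt (fun s => sumMinus (C.pos 0) (x M s)) ξ := by
    unfold sumMinus; fun_prop
  have c7 := ContinuousAt.comp (f := fun s => sumPlus (C.pos 0) (x M s)) c3 c5
  have c8 := ContinuousAt.comp (f := fun s => sumMinus (C.pos 0) (x M s)) c4 c6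
  exact (c2.sub ((c7.sub c8).mul continuousAt_const)).continuousWithinAt

/-- The identity `|p|² - p·q = ½(|p - q|² + |p|² - |q|²)`: by `defect` the first square is of fourth
order, and `norm_sq_sub_norm_sq` evaluates the rest. -/
theorem timeDefect_deriv (hr : C.IsRay g c tA x0 x) :
    UnifBigO (Set.Ioo 0 1) 4 (fun p => timeDefect' C g x0 x p -
      1 / 2 * (g.index₂ * p.1 ^ 2 * (rate g x0 x p * (‖x p.1 p.2‖⁻¹ * ‖x p.1 p.2‖⁻¹)) +
        g.index₃ * p.1 ^ 3 *
          (rate g x0 x p * (‖x p.1 p.2‖⁻¹ * ‖x p.1 p.2‖⁻¹ * ‖x p.1 p.2‖⁻¹)))) := by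
  have hI : Set.Ioo (0 : ℝ) 1 ⊆ Set.Icc 0 1 := Set.Ioo_subset_Icc_self
  have hq : UnifBigO (Set.Ioo 0 1) 4 (fun p => inner ℝ (unitMomentum g x0 x p - grad C g x p)
      (unitMomentum g x0 x p - grad C g x p)) := hr.defect.inner hr.defect
  have hΛ := (hr.rate_sub.bounded_of_sub (UnifBigO.const _)).mono_set hI
  have h1 := ((UnifBigO.const (1 / 2 : ℝ)).mul
    (hΛ.mul (hq.add hr.norm_sq_sub_norm_sq) (k := 4)) (k := 4))
  refine h1.congr' ?_
  filter_upwards [hr.rate_smul.filter_mono (unif_mono hI),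
    hr.time_velocity_eq.filter_mono (unif_mono hI)] with p hx ht
  rw [timeDefect', ht, hx, inner_smul_right]
  have e1 : inner ℝ (unitMomentum g x0 x p - grad C g x p)
      (unitMomentum g x0 x p - grad C g x p) = ‖unitMomentum g x0 x p‖ ^ 2 -
        2 * inner ℝ (grad C g x p) (unitMomentum g x0 x p) + ‖grad C g x p‖ ^ 2 := by
    rw [real_inner_self_eq_norm_sq, norm_sub_sq_real, real_inner_comm]
  rw [e1]
  ring

/-- The terms of second and third order of `timeDefect`. -/
def correction (C : Chord) (g : PPNMetric) (x : ℝ → ℝ → E3) (p : ℝ × ℝ) : ℝ :=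
  1 / 2 * g.index₂ * p.1 ^ 2 * (Real.arctan (C.t p.2 / C.b) * C.b⁻¹ +
      inner ℝ C.e (x p.1 p.2 - C.pos p.2) * ((C.r p.2)⁻¹ * (C.r p.2)⁻¹)) +
    p.1 ^ 3 * C.thirdPrimitive g p.2

/-- the derivative of `correction` -/
def correction' (C : Chord) (g : PPNMetric) (x : ℝ → ℝ → E3) (p : ℝ × ℝ) : ℝ :=
  1 / 2 * g.index₂ * p.1 ^ 2 * (C.R * ((C.r p.2)⁻¹ * (C.r p.2)⁻¹) +
      (inner ℝ C.e (deriv (x p.1) p.2 - C.R • C.e) * ((C.r p.2)⁻¹ * (C.r p.2)⁻¹) +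
      inner ℝ C.e (x p.1 p.2 - C.pos p.2) *
      (-2 * C.R * C.t p.2 * ((C.r p.2)⁻¹ * (C.r p.2)⁻¹ * ((C.r p.2)⁻¹ * (C.r p.2)⁻¹))))) +
    p.1 ^ 3 * (C.R * ((g.index₂ * (1 + g.γ) + g.index₃) / 2 *
      ((C.r p.2)⁻¹ * (C.r p.2)⁻¹ * (C.r p.2)⁻¹) -
        g.index₂ * (1 + g.γ) * (C.r 0 + p.2 * (C.r 1 - C.r 0)) *
          ((C.r p.2)⁻¹ * (C.r p.2)⁻¹ * ((C.r p.2)⁻¹ * (C.r p.2)⁻¹))))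

theorem hasDerivAt_correction (hr : C.IsRay g c tA x0 x) :
    ∀ᶠ p in unif (Set.Icc 0 1), HasDerivAt (fun ξ => correction C g x (p.1, ξ))
      (correction' C g x p) p.2 := by
  filter_upwards [hr.hasDerivAt_space] with p hp
  have h1 : HasDerivAt (fun ξ => inner ℝ C.e (x p.1 ξ - C.pos ξ))
      (inner ℝ C.e (deriv (x p.1) p.2 - C.R • C.e)) p.2 :=
    (innerSL ℝ C.e).hasFDerivAt.comp_hasDerivAt p.2 (hp.sub (C.hasDerivAt_pos p.2))
  exact (((C.hasDerivAt_arctan p.2).add (h1.mul (C.hasDerivAt_inv_r_sq p.2))).const_mul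
    (1 / 2 * g.index₂ * p.1 ^ 2)).add ((C.hasDerivAt_thirdPrimitive g p.2).const_mul (p.1 ^ 3))

/-- The terms containing the longitudinal displacement `y` assemble into the exact derivative of
`⟪e, y⟫/r²`, so `y` itself never has to be computed. -/
theorem timeDefect_sub_correction (hr : C.IsRay g c tA x0 x) :
    UnifBigO (Set.Ioo 0 1) 4 (fun p => timeDefect' C g x0 x p - correction' C g x p) := by
  have hI : Set.Ioo (0 : ℝ) 1 ⊆ Set.Icc 0 1 := Set.Ioo_subset_Icc_self
  have h2 := ((UnifBigO.const (1 / 2 * g.index₂)).mul (UnifBigO.fst_pow 2) (k := 2)).mul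
    (hr.rate_mul_inv_sq.mono_set hI) (k := 4)
  have h3 := ((UnifBigO.const (1 / 2 * g.index₃)).mul (UnifBigO.fst_pow 3) (k := 3)).mul
    (hr.rate_mul_inv_cube.mono_set hI) (k := 4)
  refine ((hr.timeDefect_deriv.add h2).add h3).congr fun p => ?_
  have hl : (C.r p.2)⁻¹ * C.r p.2 = 1 := inv_mul_cancel₀ (C.r_pos p.2).ne'
  rw [correction', varInvSq]
  generalize (C.r p.2)⁻¹ = l at *
  linear_combination (-g.index₂ * p.1 ^ 3 * C.R * l ^ 3 * (1 + g.γ)) * hl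

/-- The travel time along the ray, up to terms of fourth order. -/
theorem travel_time (hr : C.IsRay g c tA x0 x) :
    (fun M => x0 M 1 - x0 M 0 - (eikonal ((1 + g.γ) * M) (C.pos 0) (C.pos 1) +
      (1 / 2 * g.index₂ * M ^ 2 * ((Real.arctan (C.s₂ / C.b) - Real.arctan (C.s₁ / C.b)) * C.b⁻¹)
        + M ^ 3 * (C.thirdPrimitive g 1 - C.thirdPrimitive g 0))))
      =O[𝓝[>] 0] fun M => M ^ 4 := by
  have hc := (eventually_unif_iff.1 hr.hasDerivAt_correction).mono fun M h =>
    show ContinuousOn (fun ξ => correction C g x (M, ξ)) (Set.Icc 0 1) from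
      fun ξ hξ => (h ξ hξ).continuousAt.continuousWithinAt
  have hle := unif_mono (s := Set.Ioo (0 : ℝ) 1) Set.Ioo_subset_Icc_self
  have h := UnifBigO.of_deriv (f := fun p => timeDefect C g x0 x p - correction C g x p)
    ((hr.continuousOn_timeDefect.and hc).mono fun M h => h.1.sub h.2)
    (eventually_unif_iff.1 ((hr.hasDerivAt_timeDefect.and
      (hr.hasDerivAt_correction.filter_mono hle)).mono fun p h => h.1.sub h.2))
    hr.timeDefect_sub_correction
  obtain ⟨K, -, hK⟩ := UnifBigO.iff_bound.1 h
  refine IsBigO.of_bound K ?_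
  filter_upwards [hK, hr.start_space, hr.end_space, self_mem_nhdsWithin] with M h hs he hM
  have h1 := h 1 ⟨zero_le_one, le_rfl⟩
  rw [Real.norm_eq_abs (M ^ 4), abs_of_pos (pow_pos hM 4)]
  refine le_of_eq_of_le (congrArg norm ?_) h1
  -- The longitudinal displacement vanishes at both ends, hence it drops out of the travel time.
  simp only [timeDefect, correction, hs, he, eikonal_self, C.t_zero, C.t_one, sub_self,
    inner_zero_right]
  ring

end Chord.IsRay

/-! ### Identification of the coefficients of the time transfer expansion. -/

theorem eq_zero_and_isBigO_of_add_mul {d : ℝ} {f : ℝ → ℝ} {k : ℕ} (hf : ContinuousAt f 0)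
    (h : (fun M => d + M * f M) =O[𝓝[>] 0] fun M => M ^ (k + 1)) :
    d = 0 ∧ f =O[𝓝[>] 0] fun M => M ^ k := by
  have hd : d = 0 := by
    have h1 : Tendsto (fun M : ℝ => M ^ (k + 1)) (𝓝[>] 0) (𝓝 0) := by
      have := (continuous_pow (M := ℝ) (k + 1)).tendsto 0
      rw [zero_pow (Nat.succ_ne_zero k)] at this
      exact this.mono_left nhdsWithin_le_nhds
    have h2 := h.trans_tendsto h1
    have h3 : Tendsto (fun M => d + M * f M) (𝓝[>] 0) (𝓝 (d + 0 * f 0)) :=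
      ((continuousAt_const.add (continuousAt_id.mul hf)).tendsto).mono_left nhdsWithin_le_nhds
    simpa using tendsto_nhds_unique h3 h2
  refine ⟨hd, ?_⟩
  obtain ⟨K, hK⟩ := h.bound
  refine IsBigO.of_bound K ?_
  filter_upwards [hK, self_mem_nhdsWithin] with M h1 hM
  have hM' : 0 < ‖M‖ := norm_pos_iff.2 (ne_of_gt hM)
  rw [hd, zero_add, norm_mul, pow_succ, norm_mul, ← mul_assoc, mul_comm ‖M‖] at h1
  exact le_of_mul_le_mul_right h1 hM'

theorem coeffs_eq_zero_of_isBigO {d₀ d₁ d₂ d₃ : ℝ}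
    (h : (fun M => d₀ + d₁ * M + d₂ * M ^ 2 + d₃ * M ^ 3) =O[𝓝[>] (0 : ℝ)] fun M => M ^ 4) :
    d₁ = 0 ∧ d₂ = 0 ∧ d₃ = 0 := by
  obtain ⟨-, h1⟩ := eq_zero_and_isBigO_of_add_mul (d := d₀)
    (f := fun M => d₁ + M * (d₂ + M * d₃)) (k := 3) (by fun_prop)
    (h.congr_left fun M => by ring)
  obtain ⟨e1, h2⟩ := eq_zero_and_isBigO_of_add_mul (k := 2) (by fun_prop) h1
  obtain ⟨e2, h3⟩ := eq_zero_and_isBigO_of_add_mul (d := d₂) (f := fun _ => d₃) (k := 1)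
    (by fun_prop) h2
  obtain ⟨e3, -⟩ := eq_zero_and_isBigO_of_add_mul (d := d₃) (f := fun _ => 0) (k := 0)
    (by fun_prop) (h3.congr_left fun M => by ring)
  exact ⟨e1, e2, e3⟩

/-- Summability for small positive `M` only is enough to reduce to `tsum_sub_partialSum_isBigO`,
with `ε⁻¹` in the role of `h`. -/
theorem sub_partialSum_isBigO_of_hasSum {a : ℕ → ℝ} {f : ℝ → ℝ}
    (h : ∀ᶠ M in 𝓝[>] (0 : ℝ), HasSum (fun n => a n * M ^ n) (f M)) (n : ℕ) :
    (fun M => f M - ∑ k ∈ Finset.range n, a k * M ^ k) =O[𝓝[>] 0] fun M => M ^ n := by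
  obtain ⟨ε, hε, hs⟩ := mem_nhdsGT_iff_exists_Ioo_subset.1 h
  have hε' : (0 : ℝ) < ε := hε
  have hsum : ∀ u : ℝ, 0 ≤ u → u * ε⁻¹ < 1 → Summable fun n => a n * u ^ n := by
    intro u hu hlt
    rcases hu.eq_or_lt with rfl | hu
    · exact summable_of_ne_finset_zero (s := {0}) fun n hn => by
        rw [zero_pow (by simpa using hn), mul_zero]
    · rw [← div_eq_mul_inv, div_lt_one hε'] at hlt
      exact (hs ⟨hu, hlt⟩ : HasSum _ _).summable
  refine ((tsum_sub_partialSum_isBigO (inv_pos.2 hε') hsum n).mono nhdsWithin_le_nhds).congr' ?_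
    EventuallyEq.rfl
  filter_upwards [h] with M hM
  rw [hM.tsum_eq]

theorem Chord.IsRay.coefficients {C : Chord} {g : PPNMetric} {c m : ℝ} (hc : 0 < c) (hm : 0 < m)
    {T : ℕ → ℝ} (h : g.IsTimeTransferExpansion c m (C.pos 0) (C.pos 1) T) :
    T 1 = m / c * ((1 + g.γ) * (Real.log (C.plus 1) - Real.log (C.minus 1))) ∧
    T 2 = m ^ 2 / c * ((1 + g.γ) ^ 2 * ((C.plus 1)⁻¹ - (C.minus 1)⁻¹) +
      1 / 2 * g.index₂ * ((Real.arctan (C.s₂ / C.b) - Real.arctan (C.s₁ / C.b)) * C.b⁻¹)) ∧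
    T 3 = m ^ 3 / c * ((1 + g.γ) ^ 3 * ((C.minus 1)⁻¹ ^ 2 - (C.plus 1)⁻¹ ^ 2) +
      (C.thirdPrimitive g 1 - C.thirdPrimitive g 0)) := by
  obtain ⟨tA, x0, x, hr, hsum⟩ := h
  have hr : C.IsRay g c tA x0 x := hr
  have hsum' : ∀ᶠ M in 𝓝[>] (0 : ℝ),
      HasSum (fun n => (T n * m⁻¹ ^ n) * M ^ n) ((x0 M 1 - x0 M 0) / c) :=
    hsum.mono fun M hM => hM.congr_fun fun n => by rw [div_eq_mul_inv, mul_pow]; ring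
  have h1 := (sub_partialSum_isBigO_of_hasSum hsum' 4).const_mul_left c
  have h2 := hr.travel_time.sub h1
  have hp : sumPlus (C.pos 0) (C.pos 1) = C.plus 1 := by
    rw [sumPlus, Chord.plus, C.norm_pos_eq, C.norm_pos_eq, C.norm_pos_sub zero_le_one]
  have hq : sumMinus (C.pos 0) (C.pos 1) = C.minus 1 := by
    rw [sumMinus, Chord.minus, C.norm_pos_eq, C.norm_pos_eq, C.norm_pos_sub zero_le_one]
  have h3 : (fun M : ℝ => (c * T 0 - (C.plus 1 - C.minus 1) * (1 / 2)) +
      (c * (T 1 * m⁻¹) - (1 + g.γ) * (Real.log (C.plus 1) - Real.log (C.minus 1))) * M +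
      (c * (T 2 * m⁻¹ ^ 2) - ((1 + g.γ) ^ 2 * ((C.plus 1)⁻¹ - (C.minus 1)⁻¹) +
      1 / 2 * g.index₂ * ((Real.arctan (C.s₂ / C.b) - Real.arctan (C.s₁ / C.b)) * C.b⁻¹))) * M ^ 2
      + (c * (T 3 * m⁻¹ ^ 3) - ((1 + g.γ) ^ 3 * ((C.minus 1)⁻¹ ^ 2 - (C.plus 1)⁻¹ ^ 2) +
      (C.thirdPrimitive g 1 - C.thirdPrimitive g 0))) * M ^ 3) =O[𝓝[>] (0 : ℝ)] fun M => M ^ 4 := by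
    refine h2.congr_left fun M => ?_
    simp only [eikonal, weightPrimitive, hp, hq, Finset.sum_range_succ, Finset.sum_range_zero]
    field_simp
    ring
  obtain ⟨e1, e2, e3⟩ := coeffs_eq_zero_of_isBigO h3
  refine ⟨?_, ?_, ?_⟩
  · rw [← sub_eq_zero.1 e1]; field_simp
  · rw [← sub_eq_zero.1 e2]; field_simp
  · rw [← sub_eq_zero.1 e3]; field_simp

/-! ### Behaviour of the coefficients near opposition. -/

namespace Chord

variable (C : Chord)

/-- `1 + 𝐧_A · 𝐧_B = δ` for the ends of the segment -/
def HasAngle (δ : ℝ) : Prop := C.b ^ 2 + C.s₁ * C.s₂ = C.r 0 * C.r 1 * (δ - 1)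

variable {C} {δ : ℝ}

theorem sq_r_zero : C.r 0 ^ 2 = C.b ^ 2 + C.s₁ ^ 2 := by rw [C.sq_r, C.t_zero]

theorem sq_r_one : C.r 1 ^ 2 = C.b ^ 2 + C.s₂ ^ 2 := by rw [C.sq_r, C.t_one]

/-- The law of cosines, with `cos = δ - 1`. -/
theorem HasAngle.sq_R (h : C.HasAngle δ) :
    C.R ^ 2 = (C.r 0 + C.r 1) ^ 2 - 2 * (C.r 0 * C.r 1) * δ := by
  have h0 := C.sq_r_zero
  have h1 := C.sq_r_one
  rw [HasAngle] at h
  rw [R]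
  linear_combination -2 * h - h0 - h1

/-- Twice the area of the triangle formed with the origin, computed in two ways and squared; `δ(2 -
δ)` is the squared sine. -/
theorem HasAngle.sq_R_mul_sq_b (h : C.HasAngle δ) :
    C.R ^ 2 * C.b ^ 2 = (C.r 0 * C.r 1) ^ 2 * (δ * (2 - δ)) := by
  have h0 := C.sq_r_zero
  have h1 := C.sq_r_one
  rw [HasAngle] at h
  rw [R]
  linear_combination -(C.r 0 * C.r 1 * (δ - 1) + (C.b ^ 2 + C.s₁ * C.s₂)) * h -
    (C.r 1) ^ 2 * h0 - (C.b ^ 2 + C.s₁ ^ 2) * h1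

theorem HasAngle.plus_mul_minus (h : C.HasAngle δ) :
    C.plus 1 * C.minus 1 = 2 * (C.r 0 * C.r 1) * δ := by
  rw [plus, minus]
  linear_combination -h.sq_R

theorem HasAngle.chordHeight_mul (h : C.HasAngle δ) :
    C.chordHeight * C.R ^ 2 = C.r 0 * C.r 1 * (C.r 0 + C.r 1) * (2 - δ) := by
  have h0 := C.sq_r_zero
  have hR := C.R_pos.ne'
  have h2 := h.sq_R
  rw [HasAngle] at h
  have h3 : C.s₁ * C.R = C.r 0 * C.r 1 * (δ - 1) - C.r 0 ^ 2 := by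
    rw [R]; linear_combination h + h0
  have h4 : C.chordHeight * C.R ^ 2 = C.r 0 * C.R ^ 2 - (C.r 1 - C.r 0) * (C.s₁ * C.R) := by
    rw [chordHeight, chordSlope]; field_simp
  rw [h4, h3, h2]
  ring

theorem R_le : C.R ≤ C.r 0 + C.r 1 := by
  have h0 := (abs_lt.1 (C.abs_t_lt 0)).1
  have h1 := (abs_lt.1 (C.abs_t_lt 1)).2
  rw [t_zero] at h0
  rw [t_one] at h1
  rw [R]; linarith

/-- By `4 r_A r_B ≤ (r_A + r_B)²` the law of cosines gives `R² ≥ (1 - δ/2)(r_A + r_B)²`, and `(1 +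
δ)²(1 - δ/2) ≥ 1` for `0 < δ < 1`. -/
theorem HasAngle.le_mul_R (h : C.HasAngle δ) (h0 : 0 < δ) (h1 : δ < 1) :
    C.r 0 + C.r 1 ≤ (1 + δ) * C.R := by
  have hA := C.r_pos 0
  have hB := C.r_pos 1
  have hR := C.R_pos
  refine le_of_sq_le_sq ?_ (by positivity)
  have h2 : (C.r 0 + C.r 1) ^ 2 * (1 - δ / 2) ≤ C.R ^ 2 := by
    rw [h.sq_R]; nlinarith [sq_nonneg (C.r 0 - C.r 1)]
  have h3 : (0 : ℝ) ≤ (1 + δ) ^ 2 * (1 - δ / 2) - 1 := by nlinarith [mul_pos h0 h0]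
  nlinarith [sq_nonneg (C.r 0 + C.r 1), mul_nonneg h3 (sq_nonneg (C.r 0 + C.r 1)),
    mul_le_mul_of_nonneg_left h2 (sq_nonneg (1 + δ))]

/-- `(r_A + r_B) / |𝐱_B - 𝐱_A|` -/
def ratio (C : Chord) : ℝ := (C.r 0 + C.r 1) / C.R

theorem ratio_pos : 0 < C.ratio := div_pos (add_pos (C.r_pos 0) (C.r_pos 1)) C.R_pos

theorem one_le_ratio : 1 ≤ C.ratio := (one_le_div C.R_pos).2 C.R_le

theorem HasAngle.ratio_le (h : C.HasAngle δ) (h0 : 0 < δ) (h1 : δ < 1) : C.ratio ≤ 1 + δ :=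
  (div_le_iff₀ C.R_pos).2 (h.le_mul_R h0 h1)

theorem HasAngle.sq_eta (h : C.HasAngle δ) :
    ((C.r 0 + C.r 1) * C.b / (C.r 0 * C.r 1)) ^ 2 = C.ratio ^ 2 * (δ * (2 - δ)) := by
  have hA := C.r_pos 0
  have hB := C.r_pos 1
  have hR := C.R_pos
  have := h.sq_R_mul_sq_b
  rw [ratio]
  field_simp
  linear_combination this

/-- The quantity `(r_A + r_B) r_c / (r_A r_B)` is controlled by `√δ`. -/
theorem HasAngle.eta_le (h : C.HasAngle δ) (h0 : 0 < δ) (h1 : δ < 1) :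
    (C.r 0 + C.r 1) * C.b / (C.r 0 * C.r 1) ≤ 3 * √δ := by
  have hA := C.r_pos 0
  have hB := C.r_pos 1
  refine le_of_sq_le_sq ?_ (by positivity)
  rw [h.sq_eta, mul_pow, Real.sq_sqrt h0.le]
  have h2 := h.ratio_le h0 h1
  have h3 : C.ratio ^ 2 ≤ 4 := by nlinarith [C.ratio_pos]
  nlinarith [mul_le_mul_of_nonneg_right h3 (show 0 ≤ δ * (2 - δ) by nlinarith)]

theorem abs_arctan_sub_le (u v : ℝ) : |Real.arctan u - Real.arctan v| ≤ Real.pi := by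
  have h1 := Real.arctan_lt_pi_div_two u
  have h2 := Real.neg_pi_div_two_lt_arctan u
  have h3 := Real.arctan_lt_pi_div_two v
  have h4 := Real.neg_pi_div_two_lt_arctan v
  rw [abs_le]; constructor <;> linarith

/-- First order term. -/
theorem HasAngle.first_order (h : C.HasAngle δ) (h0 : 0 < δ) (h1 : δ < 1) :
    |(Real.log (C.plus 1) - Real.log (C.minus 1)) / Real.log (4 * C.r 0 * C.r 1 / C.b ^ 2) - 1| ≤
      |Real.log ((C.ratio + 1) ^ 2 * (2 - δ) / 8)| := by
  have hA := C.r_pos 0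
  have hB := C.r_pos 1
  have hR := C.R_pos
  have hb := C.b_pos
  have hp := C.plus_pos zero_le_one
  have hm := C.minus_pos 1
  have hρ := C.ratio_pos
  have h2 : (0 : ℝ) < 2 - δ := by linarith
  have e2 := h.sq_R_mul_sq_b
  have e3 := h.plus_mul_minus
  have hplus : C.plus 1 = (C.ratio + 1) * C.R := by
    rw [plus, ratio]; field_simp
  have hZ : C.plus 1 / C.minus 1 =
      4 * C.r 0 * C.r 1 / C.b ^ 2 * ((C.ratio + 1) ^ 2 * (2 - δ) / 8) := by
    rw [div_eq_iff hm.ne']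
    have : C.plus 1 * C.plus 1 = 4 * C.r 0 * C.r 1 / C.b ^ 2 * ((C.ratio + 1) ^ 2 * (2 - δ) / 8) *
        (C.plus 1 * C.minus 1) := by
      rw [e3, hplus]
      field_simp
      linear_combination 8 * e2
    exact mul_left_cancel₀ hp.ne' (by linear_combination this)
  have hZ0 : 0 < 4 * C.r 0 * C.r 1 / C.b ^ 2 := by positivity
  have hlog : Real.log (C.plus 1) - Real.log (C.minus 1) =
      Real.log (4 * C.r 0 * C.r 1 / C.b ^ 2) + Real.log ((C.ratio + 1) ^ 2 * (2 - δ) / 8) := by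
    rw [← Real.log_div hp.ne' hm.ne', hZ, Real.log_mul hZ0.ne' (by positivity)]
  -- Since `b² ≤ r_A r_B`, the argument is at least `4 > e`. The logarithm in the denominator is
  -- therefore at least `1`, and dividing by it cannot enlarge the error.
  have hbig : Real.exp 1 ≤ 4 * C.r 0 * C.r 1 / C.b ^ 2 := by
    refine (Real.exp_one_lt_d9.le.trans (by norm_num : (2.7182818286 : ℝ) ≤ 4)).trans ?_
    rw [le_div_iff₀ (by positivity)]
    have e4 : C.r 0 * C.r 1 ≤ C.R ^ 2 := by
      rw [h.sq_R]; nlinarith [mul_pos hA hB, sq_nonneg (C.r 0 - C.r 1)]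
    have e5 : δ * (2 - δ) ≤ 1 := by nlinarith [sq_nonneg (δ - 1)]
    have e6 : C.r 0 * C.r 1 * C.b ^ 2 ≤ C.r 0 * C.r 1 * (C.r 0 * C.r 1) :=
      calc C.r 0 * C.r 1 * C.b ^ 2 ≤ C.R ^ 2 * C.b ^ 2 :=
            mul_le_mul_of_nonneg_right e4 (by positivity)
        _ = (C.r 0 * C.r 1) ^ 2 * (δ * (2 - δ)) := e2
        _ ≤ (C.r 0 * C.r 1) ^ 2 * 1 := mul_le_mul_of_nonneg_left e5 (by positivity)
        _ = _ := by ring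
    have e7 := le_of_mul_le_mul_left e6 (mul_pos hA hB)
    linarith
  have hlog1 : 1 ≤ Real.log (4 * C.r 0 * C.r 1 / C.b ^ 2) :=
    (Real.le_log_iff_exp_le hZ0).2 hbig
  have hlog0 : 0 < Real.log (4 * C.r 0 * C.r 1 / C.b ^ 2) := by linarith
  rw [hlog, add_div, div_self hlog0.ne', add_sub_cancel_left, abs_div, abs_of_pos hlog0]
  exact div_le_self (abs_nonneg _) hlog1

/-- Second order term. -/
theorem HasAngle.second_order (h : C.HasAngle δ) (h0 : 0 < δ) (h1 : δ < 1) {a : ℝ} (ha : a ≠ 0)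
    (k : ℝ) :
    |(a ^ 2 * ((C.plus 1)⁻¹ - (C.minus 1)⁻¹) + 1 / 2 * k *
        ((Real.arctan (C.s₂ / C.b) - Real.arctan (C.s₁ / C.b)) * C.b⁻¹)) /
      (-2 * (a ^ 2 / (C.r 0 + C.r 1)) * (C.r 0 * C.r 1 / C.b ^ 2)) - C.ratio * (2 - δ) / 2| ≤
      |k / (4 * a ^ 2)| * Real.pi * (3 * √δ) := by
  have hA := C.r_pos 0
  have hB := C.r_pos 1
  have hR := C.R_pos
  have hb := C.b_pos
  have hp := C.plus_pos zero_le_one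
  have hm := C.minus_pos 1
  have e2 := h.sq_R_mul_sq_b
  have e3 := h.plus_mul_minus
  have e1 : (C.plus 1)⁻¹ - (C.minus 1)⁻¹ = -C.R / (C.r 0 * C.r 1 * δ) := by
    have : (C.plus 1)⁻¹ - (C.minus 1)⁻¹ = (C.minus 1 - C.plus 1) / (C.plus 1 * C.minus 1) := by
      field_simp
    rw [this, e3, minus, plus]
    field_simp
    ring
  -- The eikonal part of the quotient is exactly `ratio * (2 - δ) / 2`, so only the arctangent term
  -- survives, multiplied by the small quantity of `eta_le`.
  have key : (a ^ 2 * ((C.plus 1)⁻¹ - (C.minus 1)⁻¹) + 1 / 2 * k *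
        ((Real.arctan (C.s₂ / C.b) - Real.arctan (C.s₁ / C.b)) * C.b⁻¹)) /
      (-2 * (a ^ 2 / (C.r 0 + C.r 1)) * (C.r 0 * C.r 1 / C.b ^ 2)) - C.ratio * (2 - δ) / 2 =
      -(k / (4 * a ^ 2)) * (Real.arctan (C.s₂ / C.b) - Real.arctan (C.s₁ / C.b)) *
        ((C.r 0 + C.r 1) * C.b / (C.r 0 * C.r 1)) := by
    rw [e1, ratio]
    generalize Real.arctan (C.s₂ / C.b) - Real.arctan (C.s₁ / C.b) = θ
    have hS : C.r 0 + C.r 1 ≠ 0 := by positivity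
    field_simp
    linear_combination 8 * a ^ 2 * e2
  have hη : 0 ≤ (C.r 0 + C.r 1) * C.b / (C.r 0 * C.r 1) := by positivity
  rw [key, abs_mul, abs_mul, abs_neg, abs_of_nonneg hη]
  gcongr
  · exact abs_arctan_sub_le _ _
  · exact h.eta_le h0 h1

theorem abs_chordSlope_le : |C.chordSlope| ≤ 1 := by
  have hA := C.r_pos 0
  have hB := C.r_pos 1
  have hR := C.R_pos
  rw [chordSlope, ← div_eq_mul_inv, abs_div, abs_of_pos hR, div_le_one hR, ← C.norm_pos_eq,
    ← C.norm_pos_eq]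
  have := abs_norm_sub_norm_le (C.pos 1) (C.pos 0)
  rwa [C.norm_pos_sub zero_le_one, mul_one] at this

/-- After multiplication by `b²` everything is bounded, being built from `t/r`, `b/r`, an arctangent
and the chord slope, except for the factor `chordHeight / b`, which grows near opposition. -/
theorem abs_thirdPrimitive_le (C : Chord) (g : PPNMetric) (ξ : ℝ) (hH : 0 ≤ C.chordHeight) :
    |C.thirdPrimitive g ξ| * C.b ^ 2 ≤ |(g.index₂ * (1 + g.γ) + g.index₃) / 2| +
      |g.index₂ * (1 + g.γ)| * (C.chordHeight * C.b⁻¹ * 2 + 1) := by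
  have hr := C.r_pos ξ
  have hb := C.b_pos
  have hbr := C.b_le_r ξ
  have ht : |C.t ξ * (C.r ξ)⁻¹| ≤ 1 := by
    rw [abs_mul, abs_inv, abs_of_pos hr, ← div_eq_mul_inv, div_le_one hr]
    exact (C.abs_t_lt ξ).le
  have hbr' : C.b * (C.r ξ)⁻¹ ≤ 1 := by rw [← div_eq_mul_inv, div_le_one hr]; exact hbr
  have hbr0 : 0 ≤ C.b * (C.r ξ)⁻¹ := by positivity
  have hat : |Real.arctan (C.t ξ / C.b)| ≤ 2 := by
    have h1 := Real.arctan_lt_pi_div_two (C.t ξ / C.b)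
    have h2 := Real.neg_pi_div_two_lt_arctan (C.t ξ / C.b)
    have h3 := Real.pi_lt_four
    rw [abs_le]; constructor <;> linarith
  have key : C.thirdPrimitive g ξ * C.b ^ 2 =
      (g.index₂ * (1 + g.γ) + g.index₃) / 2 * (C.t ξ * (C.r ξ)⁻¹) - g.index₂ * (1 + g.γ) *
        (C.chordHeight * C.b⁻¹ * (1 / 2 * (C.t ξ * (C.r ξ)⁻¹ * (C.b * (C.r ξ)⁻¹)) +
          1 / 2 * Real.arctan (C.t ξ / C.b)) -
          C.chordSlope * (1 / 2) * ((C.b * (C.r ξ)⁻¹) * (C.b * (C.r ξ)⁻¹))) := by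
    rw [thirdPrimitive]
    field_simp
  rw [← abs_of_pos (pow_pos hb 2), ← abs_mul, key]
  generalize C.t ξ * (C.r ξ)⁻¹ = u at *
  generalize C.b * (C.r ξ)⁻¹ = v at *
  generalize Real.arctan (C.t ξ / C.b) = w at *
  have hHb : 0 ≤ C.chordHeight * C.b⁻¹ := by positivity
  have huv : |u * v| ≤ 1 := by
    rw [abs_mul, abs_of_nonneg hbr0]; exact mul_le_one₀ ht hbr0 hbr'
  have hvv : |v * v| ≤ 1 := by
    rw [abs_mul, abs_of_nonneg hbr0]; exact mul_le_one₀ hbr' hbr0 hbr'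
  have h1 : |1 / 2 * (u * v) + 1 / 2 * w| ≤ 2 := by
    rw [abs_le] at *; constructor <;> linarith
  have h2 : |C.chordSlope * (1 / 2) * (v * v)| ≤ 1 := by
    rw [abs_mul, abs_mul, abs_of_pos (by norm_num : (0 : ℝ) < 1 / 2)]
    nlinarith [C.abs_chordSlope_le, abs_nonneg C.chordSlope, abs_nonneg (v * v)]
  refine (abs_sub _ _).trans (add_le_add ?_ ?_)
  · rw [abs_mul]; exact mul_le_of_le_one_right (abs_nonneg _) ht
  · rw [abs_mul]
    refine mul_le_mul_of_nonneg_left ((abs_sub _ _).trans (add_le_add ?_ h2)) (abs_nonneg _)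
    rw [abs_mul, abs_of_nonneg hHb]
    exact mul_le_mul_of_nonneg_left h1 hHb

/-- One factor `η` absorbs the growth of `H`, the other supplies the decay `3σ`. The constant `17 =
2 · 8 + 1` is not sharp. -/
theorem add_mul_mul_sq_le {X Y H η σ : ℝ} (hX : 0 ≤ X) (hY : 0 ≤ Y) (hη0 : 0 ≤ η)
    (hη : η ≤ 3 * σ) (hσ : σ ≤ 1) (hH : H * η ≤ 8) :
    (X + Y * (H * 2 + 1)) * η ^ 2 ≤ (X + 17 * Y) * (9 * σ) := by
  have hη2 : η ^ 2 ≤ 9 * σ := by nlinarith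
  have hHη : H * η ^ 2 ≤ 24 * σ := by
    have := mul_le_mul_of_nonneg_right hH hη0
    linarith
  have h1 := mul_le_mul_of_nonneg_left hη2 hX
  have h2 := mul_le_mul_of_nonneg_left (show H * η ^ 2 * 2 + η ^ 2 ≤ 17 * (9 * σ) by linarith) hY
  linarith

/-- Third order term. -/
theorem HasAngle.third_order (h : C.HasAngle δ) (h0 : 0 < δ) (h1 : δ < 1) (g : PPNMetric)
    {a : ℝ} (ha : a ≠ 0) :
    |(a ^ 3 * ((C.minus 1)⁻¹ ^ 2 - (C.plus 1)⁻¹ ^ 2) +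
        (C.thirdPrimitive g 1 - C.thirdPrimitive g 0)) /
      (4 * (a ^ 3 / (C.r 0 + C.r 1) ^ 2) * (C.r 0 * C.r 1 / C.b ^ 2) ^ 2) -
        C.ratio ^ 3 * (2 - δ) ^ 2 / 4| ≤
      2 * (|(g.index₂ * (1 + g.γ) + g.index₃) / 2| + 17 * |g.index₂ * (1 + g.γ)|) *
        |1 / (4 * a ^ 3)| * (9 * √δ) := by
  have hA := C.r_pos 0
  have hB := C.r_pos 1
  have hR := C.R_pos
  have hb := C.b_pos
  have hp := C.plus_pos zero_le_one
  have hm := C.minus_pos 1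
  have e2 := h.sq_R_mul_sq_b
  have e3 := h.plus_mul_minus
  have e1 : (C.minus 1)⁻¹ ^ 2 - (C.plus 1)⁻¹ ^ 2 =
      (C.r 0 + C.r 1) * C.R / (C.r 0 * C.r 1 * δ) ^ 2 := by
    have : (C.minus 1)⁻¹ ^ 2 - (C.plus 1)⁻¹ ^ 2 =
        (C.plus 1 ^ 2 - C.minus 1 ^ 2) / (C.plus 1 * C.minus 1) ^ 2 := by
      field_simp
    rw [this, e3, minus, plus]
    field_simp
    ring
  have hS : C.r 0 + C.r 1 ≠ 0 := by positivity
  have key : (a ^ 3 * ((C.minus 1)⁻¹ ^ 2 - (C.plus 1)⁻¹ ^ 2) +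
        (C.thirdPrimitive g 1 - C.thirdPrimitive g 0)) /
      (4 * (a ^ 3 / (C.r 0 + C.r 1) ^ 2) * (C.r 0 * C.r 1 / C.b ^ 2) ^ 2) -
        C.ratio ^ 3 * (2 - δ) ^ 2 / 4 =
      (C.thirdPrimitive g 1 - C.thirdPrimitive g 0) * C.b ^ 2 * (1 / (4 * a ^ 3)) *
        ((C.r 0 + C.r 1) * C.b / (C.r 0 * C.r 1)) ^ 2 := by
    rw [e1, ratio]
    generalize C.thirdPrimitive g 1 - C.thirdPrimitive g 0 = θ
    field_simp
    linear_combination a ^ 3 * (C.r 0 + C.r 1) *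
      (C.R ^ 2 * C.b ^ 2 + (C.r 0 * C.r 1) ^ 2 * (δ * (2 - δ))) * e2
  set η := (C.r 0 + C.r 1) * C.b / (C.r 0 * C.r 1) with hηdef
  have hη0 : 0 < η := by positivity
  have hη := h.eta_le h0 h1
  rw [← hηdef] at hη
  have hsq : √δ ≤ 1 := Real.sqrt_le_one.2 h1.le
  have hsq0 := Real.sqrt_nonneg δ
  have hη3 : η ≤ 3 := by linarith
  have hHR := h.chordHeight_mul
  -- The growing factor `chordHeight / b` is of order `1/η` exactly, so the third order remainder is
  -- `O(η)` and not merely bounded.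
  have hH : C.chordHeight * C.b⁻¹ * η = C.ratio ^ 2 * (2 - δ) := by
    rw [hηdef, ratio]
    field_simp
    linear_combination hHR
  have hH0 : 0 ≤ C.chordHeight := by
    have : 0 < C.chordHeight * C.R ^ 2 := by
      rw [hHR]; have : 0 < 2 - δ := by linarith
      positivity
    exact (pos_of_mul_pos_left this (by positivity)).le
  have hH8 : C.chordHeight * C.b⁻¹ * η ≤ 8 := by
    rw [hH]
    have h2 := h.ratio_le h0 h1
    have h3 : C.ratio ^ 2 ≤ 4 := by nlinarith [C.ratio_pos]
    nlinarith [sq_nonneg C.ratio]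
  have hbound : ∀ ξ, |C.thirdPrimitive g ξ| * C.b ^ 2 * η ^ 2 ≤
      (|(g.index₂ * (1 + g.γ) + g.index₃) / 2| + 17 * |g.index₂ * (1 + g.γ)|) * (9 * √δ) := by
    intro ξ
    have h2 := mul_le_mul_of_nonneg_right (C.abs_thirdPrimitive_le g ξ hH0) (sq_nonneg η)
    refine h2.trans ?_
    exact add_mul_mul_sq_le (abs_nonneg _) (abs_nonneg _) hη0.le hη hsq hH8
  have hηη : η ^ 2 = |η ^ 2| := (abs_of_nonneg (sq_nonneg η)).symm
  have hbb : C.b ^ 2 = |C.b ^ 2| := (abs_of_nonneg (sq_nonneg C.b)).symm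
  rw [key, abs_mul, abs_mul, abs_mul, ← hηη, ← hbb]
  have h3 := abs_sub (C.thirdPrimitive g 1) (C.thirdPrimitive g 0)
  have h4 : |C.thirdPrimitive g 1 - C.thirdPrimitive g 0| * C.b ^ 2 * η ^ 2 ≤
      2 * ((|(g.index₂ * (1 + g.γ) + g.index₃) / 2| + 17 * |g.index₂ * (1 + g.γ)|) *
        (9 * √δ)) := by
    have h5 : |C.thirdPrimitive g 1 - C.thirdPrimitive g 0| * C.b ^ 2 * η ^ 2 ≤
        (|C.thirdPrimitive g 1| + |C.thirdPrimitive g 0|) * C.b ^ 2 * η ^ 2 := by gcongr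
    linarith [hbound 1, hbound 0]
  have h6 := mul_le_mul_of_nonneg_right h4 (abs_nonneg (1 / (4 * a ^ 3)))
  linarith

end Chord

/-! ### From pairs of points to segments. -/

theorem Chord.inner_pos (C : Chord) (ξ η : ℝ) :
    inner ℝ (C.pos ξ) (C.pos η) = C.b ^ 2 + C.t ξ * C.t η := by
  simp only [Chord.pos, inner_add_left, inner_add_right, inner_smul_left, inner_smul_right,
    C.inner_e_e, C.inner_e_h, C.inner_h_e, C.inner_h_h, conj_trivial]
  ring

theorem Chord.zero_notMem_segment (C : Chord) :
    (0 : E3) ∉ segment ℝ (C.pos 0) (C.pos 1) := by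
  rw [segment_eq_image_lineMap]
  rintro ⟨ξ, -, h⟩
  have h1 : AffineMap.lineMap (C.pos 0) (C.pos 1) ξ = C.pos ξ := by
    rw [AffineMap.lineMap_apply, vsub_eq_sub, vadd_eq_add, Chord.IsRay.pos_one_sub]
    simp only [Chord.pos, Chord.t, add_smul, mul_smul, zero_smul]
    abel
  rw [h1] at h
  have := C.norm_pos_eq ξ
  rw [h, norm_zero] at this
  exact (C.r_pos ξ).ne this

theorem norm_sq_cross (u v : E3) :
    ‖cross u v‖ ^ 2 = ‖u‖ ^ 2 * ‖v‖ ^ 2 - inner ℝ u v ^ 2 := by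
  simp only [EuclideanSpace.norm_sq_eq, Real.norm_eq_abs, sq_abs, cross, crossProduct,
    PiLp.inner_apply, Fin.sum_univ_three]
  simp
  ring

theorem norm_unitVec {u : E3} (hu : u ≠ 0) : ‖unitVec u‖ = 1 := by
  rw [unitVec, norm_smul, norm_inv, norm_norm, inv_mul_cancel₀ (norm_ne_zero_iff.2 hu)]

theorem inner_unitVec_nonneg (u v : E3) : 0 ≤ 1 + inner ℝ (unitVec u) (unitVec v) := by
  have h : ∀ u : E3, ‖unitVec u‖ ≤ 1 := fun u => by
    rw [unitVec, norm_smul, norm_inv, norm_norm]; exact inv_mul_le_one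
  have h1 := (abs_le.1 (abs_real_inner_le_norm (unitVec u) (unitVec v))).1
  have h2 := mul_le_one₀ (h u) (norm_nonneg _) (h v)
  linarith

/-- Two points seen from the origin in directions that are almost, but not exactly, opposite are
the ends of a segment which avoids the origin. -/
theorem exists_chord {xA xB : E3} {δ : ℝ} (hδ : 1 + inner ℝ (unitVec xA) (unitVec xB) = δ)
    (h0 : 0 < δ) (h1 : δ < 1) :
    ∃ C : Chord, C.pos 0 = xA ∧ C.pos 1 = xB ∧ C.HasAngle δ ∧ rc xA xB = C.b := by
  -- `unitVec 0 = 0` would give `δ = 1`, which `δ < 1` excludes.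
  have hA : xA ≠ 0 := by
    rintro rfl
    simp [unitVec] at hδ
    linarith
  have hB : xB ≠ 0 := by
    rintro rfl
    simp [unitVec] at hδ
    linarith
  have hA' : 0 < ‖xA‖ := norm_pos_iff.2 hA
  have hB' : 0 < ‖xB‖ := norm_pos_iff.2 hB
  have hin : inner ℝ xA xB = ‖xA‖ * ‖xB‖ * (δ - 1) := by
    rw [← hδ, unitVec, unitVec, inner_smul_left, inner_smul_right, conj_trivial]
    field_simp
    ring
  have hne : xB - xA ≠ 0 := by
    intro h
    rw [sub_eq_zero.1 h, real_inner_self_eq_norm_sq] at hin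
    nlinarith [mul_pos hA' hA']
  have hd : 0 < ‖xB - xA‖ := norm_pos_iff.2 hne
  have hnorm : ‖‖xB - xA‖⁻¹ • (xB - xA)‖ = 1 := norm_unitVec hne
  obtain ⟨e, he⟩ : ∃ e, e = ‖xB - xA‖⁻¹ • (xB - xA) := ⟨_, rfl⟩
  rw [← he] at hnorm
  have hsub : ‖xB - xA‖ • e = xB - xA := by
    rw [he, smul_smul, mul_inv_cancel₀ hd.ne', one_smul]
  have hBe : xB = xA + ‖xB - xA‖ • e := by rw [hsub]; abel
  have hee : inner ℝ e e = 1 := by rw [real_inner_self_eq_norm_sq, hnorm, one_pow]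
  -- If the line passed through the origin, both points would be multiples of `e` and the squared
  -- cosine `(δ - 1)²` would be `1`, contrary to `0 < δ < 1`.
  have hh : xA - inner ℝ xA e • e ≠ 0 := by
    intro h
    have hxA : xA = inner ℝ xA e • e := sub_eq_zero.1 h
    have hxB : xB = (inner ℝ xA e + ‖xB - xA‖) • e := by rw [add_smul, ← hxA]; exact hBe
    have e1 : ‖xA‖ ^ 2 = inner ℝ xA e ^ 2 := by
      conv_lhs => rw [hxA, norm_smul, hnorm, mul_one, Real.norm_eq_abs, sq_abs]
    have e2 : ‖xB‖ ^ 2 = (inner ℝ xA e + ‖xB - xA‖) ^ 2 := by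
      conv_lhs => rw [hxB, norm_smul, hnorm, mul_one, Real.norm_eq_abs, sq_abs]
    have e3 : inner ℝ xA xB = inner ℝ xA e * (inner ℝ xA e + ‖xB - xA‖) := by
      conv_lhs => rw [hxA, hxB, inner_smul_left, inner_smul_right, hee, conj_trivial, mul_one]
    have e4 : (‖xA‖ * ‖xB‖) ^ 2 * (δ * (2 - δ)) = 0 := by
      have : (‖xA‖ * ‖xB‖) ^ 2 = (‖xA‖ * ‖xB‖ * (δ - 1)) ^ 2 := by
        rw [← hin, e3, mul_pow, e1, e2]; ring
      linear_combination this
    have : 0 < (‖xA‖ * ‖xB‖) ^ 2 * (δ * (2 - δ)) := by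
      have : 0 < 2 - δ := by linarith
      positivity
    linarith
  refine ⟨⟨xA - inner ℝ xA e • e, e, inner ℝ xA e, inner ℝ xA e + ‖xB - xA‖, hnorm, ?_, hh,
    by linarith⟩, ?_⟩
  · rw [inner_sub_left, inner_smul_left, hee, conj_trivial, mul_one, sub_self]
  generalize hC : Chord.mk _ _ _ _ _ _ _ _ = C
  have hp0 : C.pos 0 = xA := by
    rw [Chord.pos, Chord.t_zero, ← hC]; simp
  have hp1 : C.pos 1 = xB := by
    rw [Chord.pos, Chord.t_one, ← hC]
    simp only [add_smul]
    rw [← add_assoc, sub_add_cancel, hsub]; abel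
  have hang : C.HasAngle δ := by
    have := C.inner_pos 0 1
    rw [C.t_zero, C.t_one, hp0, hp1] at this
    rw [Chord.HasAngle, ← this, hin, ← C.norm_pos_eq, ← C.norm_pos_eq, hp0, hp1]
  refine ⟨hp0, hp1, hang, ?_⟩
  have hR : ‖xB - xA‖ = C.R := by
    rw [← hp0, ← hp1, Chord.IsRay.norm_pos_one_sub]
  have hsq := hang.sq_R_mul_sq_b
  rw [← C.norm_pos_eq, ← C.norm_pos_eq, hp0, hp1, ← hR] at hsq
  have hrc0 : 0 ≤ rc xA xB := by rw [rc]; positivity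
  refine (sq_eq_sq₀ hrc0 C.b_pos.le).1 ?_
  refine mul_left_cancel₀ (pow_pos hd 2).ne' ?_
  rw [hsq, rc, mul_pow, norm_sq_cross, norm_unitVec hA, norm_unitVec hB,
    show inner ℝ (unitVec xA) (unitVec xB) = δ - 1 by linarith]
  field_simp
  ring

/-! ### The limit of opposite directions. -/

theorem tendsto_of_abs_sub_le {α : Type*} {l : Filter α} {u f b : α → ℝ} {L : ℝ}
    (hf : Tendsto f l (𝓝 L)) (hb : Tendsto b l (𝓝 0)) (h : ∀ᶠ x in l, |u x - f x| ≤ b x) :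
    Tendsto u l (𝓝 L) := by
  have h1 : Tendsto (fun x => u x - f x) l (𝓝 0) :=
    squeeze_zero_norm' (h.mono fun x hx => by rwa [Real.norm_eq_abs]) hb
  simpa using h1.add hf

/-- `δ = 1 + 𝐧_A · 𝐧_B` -/
def oppositeness (p : E3 × E3) : ℝ := 1 + inner ℝ (unitVec p.1) (unitVec p.2)

theorem tendsto_oppositeness : Tendsto oppositeness oppositeLimit (𝓝 0) :=
  (tendsto_comap (f := oppositeness)).mono_right nhdsWithin_le_nhds

theorem eventually_oppositeness :
    ∀ᶠ p in oppositeLimit, 0 < oppositeness p ∧ oppositeness p < 1 := by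
  have h1 : ∀ᶠ p in oppositeLimit, oppositeness p ≠ 0 :=
    (tendsto_comap (f := oppositeness)).eventually self_mem_nhdsWithin
  filter_upwards [h1, tendsto_oppositeness.eventually (Iio_mem_nhds zero_lt_one)] with p h2 h3
  exact ⟨lt_of_le_of_ne (inner_unitVec_nonneg _ _) h2.symm, h3⟩

theorem tendsto_ratio : Tendsto (fun p : E3 × E3 => (‖p.1‖ + ‖p.2‖) / ‖p.2 - p.1‖)
    oppositeLimit (𝓝 1) := by
  refine tendsto_of_abs_sub_le tendsto_const_nhds tendsto_oppositeness ?_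
  filter_upwards [eventually_oppositeness] with p hp
  obtain ⟨C, hA, hB, hang, -⟩ := exists_chord (xA := p.1) (xB := p.2) rfl hp.1 hp.2
  have h : (‖p.1‖ + ‖p.2‖) / ‖p.2 - p.1‖ = C.ratio := by
    rw [← hA, ← hB, C.norm_pos_eq, C.norm_pos_eq, Chord.IsRay.norm_pos_one_sub, Chord.ratio]
  rw [h, abs_of_nonneg (sub_nonneg.2 C.one_le_ratio)]
  linarith [show C.ratio ≤ 1 + oppositeness p from hang.ratio_le hp.1 hp.2]

theorem tendsto_sqrt_oppositeness : Tendsto (fun p => √(oppositeness p)) oppositeLimit (𝓝 0) := by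
  simpa using tendsto_oppositeness.sqrt

end TimeTransfer

end

/-! ### The asymptotic equivalents of the first three orders. -/

open TimeTransfer in
theorem proposition6 (g : TimeTransfer.PPNMetric) (hγ : g.γ ≠ -1)
    (c m : ℝ) (hc : 0 < c) (hm : 0 < m)
    (T : ℕ → TimeTransfer.E3 → TimeTransfer.E3 → ℝ)
    (hT : ∀ xA xB : TimeTransfer.E3, xA ≠ xB → (0 : TimeTransfer.E3) ∉ segment ℝ xA xB →
      g.IsTimeTransferExpansion c m xA xB (fun n => T n xA xB)) :
    (fun p : TimeTransfer.E3 × TimeTransfer.E3 => T 1 p.1 p.2)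
      ~[TimeTransfer.oppositeLimit]
        (fun p => (1 + g.γ) * m / c
          * Real.log (4 * ‖p.1‖ * ‖p.2‖ / TimeTransfer.rc p.1 p.2 ^ 2)) ∧
    (fun p : TimeTransfer.E3 × TimeTransfer.E3 => T 2 p.1 p.2)
      ~[TimeTransfer.oppositeLimit]
        (fun p => -2 * ((1 + g.γ) ^ 2 * m ^ 2 / (c * (‖p.1‖ + ‖p.2‖)))
          * (‖p.1‖ * ‖p.2‖ / TimeTransfer.rc p.1 p.2 ^ 2)) ∧
    (fun p : TimeTransfer.E3 × TimeTransfer.E3 => T 3 p.1 p.2)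
      ~[TimeTransfer.oppositeLimit]
        (fun p => 4 * ((1 + g.γ) ^ 3 * m ^ 3 / (c * (‖p.1‖ + ‖p.2‖) ^ 2))
          * (‖p.1‖ * ‖p.2‖ / TimeTransfer.rc p.1 p.2 ^ 2) ^ 2) := by
  have ha : 1 + g.γ ≠ 0 := fun h => hγ (by linarith)
  have hkey : ∀ p : E3 × E3, 0 < oppositeness p ∧ oppositeness p < 1 → ∃ C : Chord,
      C.HasAngle (oppositeness p) ∧ ‖p.1‖ = C.r 0 ∧ ‖p.2‖ = C.r 1 ∧ rc p.1 p.2 = C.b ∧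
      (‖p.1‖ + ‖p.2‖) / ‖p.2 - p.1‖ = C.ratio ∧
      g.IsTimeTransferExpansion c m (C.pos 0) (C.pos 1) (fun n => T n p.1 p.2) := by
    intro p hp
    obtain ⟨C, hA, hB, hang, hrc⟩ := exists_chord (xA := p.1) (xB := p.2) rfl hp.1 hp.2
    refine ⟨C, hang, by rw [← hA, C.norm_pos_eq], by rw [← hB, C.norm_pos_eq], hrc, ?_, ?_⟩
    · rw [← hA, ← hB, C.norm_pos_eq, C.norm_pos_eq, Chord.IsRay.norm_pos_one_sub, Chord.ratio]
    · have hne : p.1 ≠ p.2 := by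
        intro h
        have := Chord.IsRay.norm_pos_one_sub C
        rw [hA, hB, h, sub_self, norm_zero] at this
        exact C.R_pos.ne this
      have hseg := C.zero_notMem_segment
      rw [hA, hB] at hseg ⊢
      exact hT p.1 p.2 hne hseg
  have hδ := tendsto_oppositeness
  have hρ := tendsto_ratio
  have h2δ : Tendsto (fun p => 2 - oppositeness p) oppositeLimit (𝓝 2) := by
    simpa using hδ.const_sub 2
  -- Each quotient lies within a bound tending to `0` of an explicit function of `ratio` and `δ`
  -- (the constant `1` at first order). As `ratio → 1` and `δ → 0` these functions tend to `1`.
  refine ⟨isEquivalent_of_tendsto_one ?_, isEquivalent_of_tendsto_one ?_,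
    isEquivalent_of_tendsto_one ?_⟩
  · have hb : Tendsto (fun p : E3 × E3 => |Real.log ((((‖p.1‖ + ‖p.2‖) / ‖p.2 - p.1‖ + 1) ^ 2 *
        (2 - oppositeness p)) / 8)|) oppositeLimit (𝓝 0) := by
      have h := ((((hρ.add_const 1).pow 2).mul h2δ).div_const 8).log (by norm_num)
      have h' := h.abs
      norm_num at h'
      simpa using h'
    refine tendsto_of_abs_sub_le (tendsto_const_nhds (x := (1 : ℝ))) hb ?_
    filter_upwards [eventually_oppositeness] with p hp
    obtain ⟨C, hang, hA, hB, hrc, hr, hexp⟩ := hkey p hp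
    have h1 := (Chord.IsRay.coefficients hc hm hexp).1
    have h2 := hang.first_order hp.1 hp.2
    rw [Pi.div_apply, hr, hA, hB, hrc]
    rw [h1]
    refine le_of_eq_of_le ?_ h2
    congr 2
    rw [← mul_assoc, mul_div_mul_comm, show m / c * (1 + g.γ) / ((1 + g.γ) * m / c) = 1 by
      field_simp, one_mul]
  · have hf : Tendsto (fun p : E3 × E3 => (‖p.1‖ + ‖p.2‖) / ‖p.2 - p.1‖ * (2 - oppositeness p) / 2)
        oppositeLimit (𝓝 1) := by
      simpa using (hρ.mul h2δ).div_const 2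
    have hb := (tendsto_sqrt_oppositeness.const_mul 3).const_mul
      (|g.index₂ / (4 * (1 + g.γ) ^ 2)| * Real.pi)
    simp only [mul_zero] at hb
    refine tendsto_of_abs_sub_le hf hb ?_
    filter_upwards [eventually_oppositeness] with p hp
    obtain ⟨C, hang, hA, hB, hrc, hr, hexp⟩ := hkey p hp
    have h1 := (Chord.IsRay.coefficients hc hm hexp).2.1
    have h2 := hang.second_order hp.1 hp.2 ha g.index₂
    rw [Pi.div_apply, hr, hA, hB, hrc]
    rw [h1]
    refine le_of_eq_of_le ?_ h2
    congr 2
    have hS : 0 < C.r 0 + C.r 1 := add_pos (C.r_pos 0) (C.r_pos 1)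
    rw [show -2 * ((1 + g.γ) ^ 2 * m ^ 2 / (c * (C.r 0 + C.r 1))) * (C.r 0 * C.r 1 / C.b ^ 2) =
      m ^ 2 / c * (-2 * ((1 + g.γ) ^ 2 / (C.r 0 + C.r 1)) * (C.r 0 * C.r 1 / C.b ^ 2)) by
        field_simp, mul_div_mul_left _ _ (by positivity)]
  · have hf : Tendsto (fun p : E3 × E3 => ((‖p.1‖ + ‖p.2‖) / ‖p.2 - p.1‖) ^ 3 *
        (2 - oppositeness p) ^ 2 / 4) oppositeLimit (𝓝 1) := by
      have h := ((hρ.pow 3).mul (h2δ.pow 2)).div_const 4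
      norm_num at h
      exact h
    have hb := (tendsto_sqrt_oppositeness.const_mul 9).const_mul
      (2 * (|(g.index₂ * (1 + g.γ) + g.index₃) / 2| + 17 * |g.index₂ * (1 + g.γ)|) *
        |1 / (4 * (1 + g.γ) ^ 3)|)
    simp only [mul_zero] at hb
    refine tendsto_of_abs_sub_le hf hb ?_
    filter_upwards [eventually_oppositeness] with p hp
    obtain ⟨C, hang, hA, hB, hrc, hr, hexp⟩ := hkey p hp
    have h1 := (Chord.IsRay.coefficients hc hm hexp).2.2
    have h2 := hang.third_order hp.1 hp.2 g ha
    rw [Pi.div_apply, hr, hA, hB, hrc]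
    rw [h1]
    refine le_of_eq_of_le ?_ h2
    congr 2
    have hS : 0 < C.r 0 + C.r 1 := add_pos (C.r_pos 0) (C.r_pos 1)
    rw [show 4 * ((1 + g.γ) ^ 3 * m ^ 3 / (c * (C.r 0 + C.r 1) ^ 2)) *
        (C.r 0 * C.r 1 / C.b ^ 2) ^ 2 =
      m ^ 3 / c * (4 * ((1 + g.γ) ^ 3 / (C.r 0 + C.r 1) ^ 2) * (C.r 0 * C.r 1 / C.b ^ 2) ^ 2) by
        field_simp, mul_div_mul_left _ _ (by positivity)]
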